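/- **Setting.** Let $d\ge 1$, let $\Omega\subset\mathbb R^d$ be a nonempty bounded open set with smooth boundary and outer unit normal $\nu$, and let $T>0$. Let $\mathbf x_0\in\mathbb R^d\setminus\overline\Omega$ be such that $r(\mathbf x)=|\mathbf x-\mathbf x_0|>1$ for all $\mathbf x\in\Omega$, and let $b>\max_{\overline\Omega} r$. For $\beta,\lambda>0$ put $w_\lambda(\mathbf x)=e^{2\lambda b^{-\beta}r(\mathbf x)^{\beta}}$. Let $\{\Psi_n\}_{n\ge1}$ be an orthonormal basis of $L^2(0,T)$ consisting of functions in $C^1([0,T])$, let $N$ be a cut-off number, let $S=(s_{mn})_{m,n=1}^N$ with $s_{mn}=\int_0^T\Psi_n'\Psi_m\,dt$, and let $c\in C^1(\mathbb R^d)$ with $c\ge c_0>0$. For $F=F(\mathbf x,t,s,\mathbf p)\in C^1(\mathbb R^d\times\mathbb R\times\mathbb R\times\mathbb R^d)$ put $$\|F\|_{C^1}=\sup_{\mathbf x\in\Omega,\ t\in(0,T),\ s\in\mathbb R,\ \mathbf p\in\mathbb R^d}\big(|F|+|\partial_sF|+|\nabla_{\mathbf p}F|\big),$$ and for $U=(u_1,\dots,u_N)\in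 H^2(\Omega)^N$ let $\mathbf F(\mathbf x,U,\nabla U)$ be the vector with components $$F_m(\mathbf x,U,\nabla U)=\int_0^TF\Big(\mathbf x,t,\sum_{n=1}^Nu_n(\mathbf x)\Psi_n(t),\sum_{n=1}^N\nabla u_n(\mathbf x)\Psi_n(t)\Big)\Psi_m(t)\,dt .$$ For Cauchy data $G,Q:\partial\Omega\to\mathbb R^N$ let $H=\{V\in H^2(\Omega)^N:\ V|_{\partial\Omega}=G,\ \partial_\nu V|_{\partial\Omega}=Q\}$, and let $U^*=(u_1^*,\dots,u_N^*)\in H$ be a solution (for instance, the unique one) of $$\Delta U-cSU+\mathbf F(\mathbf x,U,\nabla U)=0\ \text{ in }\Omega,\qquad U=G,\quad \partial_\nu U=Q\ \text{ on }\partial\Omega .$$ Let $U^{(0)}\in H^2(\Omega)^N$ be arbitrary and, for $k\ge1$, let $U^{(k)}=(u^{(k)}_1,\dots,u^{(k)}_N)$ be the minimizer over $V\in H$ of $$J^{(k)}(V)=\int_\Omega w_\lambda\,\big|\Delta V-cSV+\mathbf F(\mathbf x,U^{(k-1)},\nabla U^{(k-1)})\big|^2d\mathbf x .$$ Put $p^{(k)}=\sum_{n=1}^Nu_n^{(k)}\Psi_n(0)$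 and $p^*=\sum_{n=1}^Nu_n^*\Psi_n(0)$, and $$E_\lambda(V)=\lambda^{-2}|D^2V|^2+|\nabla V|^2+|V|^2 .$$ **Claim.** There is $\beta_0>0$, depending only on $b,\mathbf x_0,\Omega,d$, such that for every $\beta\ge\beta_0$ there is $\lambda_0>1$, depending only on $\beta,b,\mathbf x_0,\Omega,d$, with the following properties. (0) (Carleman estimate.) There is $K>0$ such that for all $\lambda\ge\lambda_0$ and all $v\in H^2(\Omega)$ with $v=\partial_\nu v=0$ on $\partial\Omega$, $$\int_\Omega w_\lambda|\Delta v|^2\,d\mathbf x\ \ge\ K\lambda^{-1}\int_\Omega w_\lambda|D^2v|^2\,d\mathbf x+K\lambda^3\int_\Omega w_\lambda|v|^2\,d\mathbf x+K\lambda\int_\Omega w_\lambda|\nabla v|^2\,d\mathbf x .$$ For all $T$, $\{\Psi_n\}$, $N$, $c$ as above and all $M\ge0$ there is $C>0$, depending only on these, on $\mathbf x_0,\Omega,d,b,\beta$ and on $\lambda_0$, such that for every $F$ with $\|F\|_{C^1}\le M$, all $G,Q,U^*,U^{(0)}$ and all $\lambda\ge\lambda_0$, the sequence $U^{(k)}$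 satisfies: (1) for all $k\ge0$, $$\int_\Omega w_\lambda E_\lambda(U^{(k)}-U^*)\,d\mathbf x\le\Big(\frac C\lambda\Big)^k\int_\Omega w_\lambda E_\lambda(U^{(0)}-U^*)\,d\mathbf x;$$ (2) if $\theta=C/\lambda\in(0,1)$, then for all $k\ge0$, $$\min_{\overline\Omega}w_\lambda\int_\Omega E_\lambda(U^{(k)}-U^*)\,d\mathbf x\ \le\ \theta^k\,\max_{\overline\Omega}w_\lambda\int_\Omega E_\lambda(U^{(0)}-U^*)\,d\mathbf x,$$ and consequently $U^{(k)}\to U^*$ in $H^2(\Omega)^N$ and $p^{(k)}\to p^*$ in $H^2(\Omega)$ as $k\to\infty$. -/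

import Mathlib

open MeasureTheory Set Filter Topology
open scoped ENNReal NNReal ContDiff

noncomputable section

/-- The Euclidean space of dimension `d`. -/
abbrev Pt (d : ℕ) : Type := EuclideanSpace ℝ (Fin d)

/-! ### Bounded domains with smooth boundary -/

/-- `ρ` is a smooth defining function of `Ω`: it is `C^∞`, `Ω = {ρ < 0}`, and `∇ρ ≠ 0` on `∂Ω`. -/
structure IsDefiningFunction {d : ℕ} (Ω : Set (Pt d)) (ρ : Pt d → ℝ) : Prop where
  smooth : ContDiff ℝ ∞ ρ
  eq_sublevel : Ω = {x | ρ x < 0}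
  gradient_ne_zero : ∀ x ∈ frontier Ω, gradient ρ x ≠ 0

/-- A nonempty bounded open set with `C^∞` boundary. A bounded open set has a `C^∞` boundary (is
locally the set below the graph of a smooth function, in suitable coordinates) if and only if it
has a global smooth defining function. -/
structure IsSmoothBoundedDomain {d : ℕ} (Ω : Set (Pt d)) : Prop where
  isOpen : IsOpen Ω
  isBounded : Bornology.IsBounded Ω
  nonempty : Ω.Nonempty
  exists_defining : ∃ ρ, IsDefiningFunction Ω ρ

open Classical in
/-- The outer unit normal `ν = ∇ρ / |∇ρ|` on `∂Ω`; on `∂Ω` it does not depend on the choice of the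
defining function `ρ`. -/
def outerNormal {d : ℕ} (Ω : Set (Pt d)) (x : Pt d) : Pt d :=
  if h : ∃ ρ, IsDefiningFunction Ω ρ then
    ‖gradient h.choose x‖⁻¹ • gradient h.choose x
  else 0

/-- The surface measure on `∂Ω`: the `(d - 1)`-dimensional Hausdorff measure, normalised so as to
agree with Lebesgue measure on hyperplanes. -/
def surfaceMeasure {d : ℕ} (Ω : Set (Pt d)) : Measure (Pt d) :=
  (Measure.euclideanHausdorffMeasure (d - 1) : Measure (Pt d)).restrict (frontier Ω)

/-! ### The Sobolev space `H²(Ω)` -/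

/-- The classical partial derivative `∂φ/∂x_i`. -/
def pderiv {d : ℕ} (i : Fin d) (φ : Pt d → ℝ) (x : Pt d) : ℝ :=
  fderiv ℝ φ x (EuclideanSpace.single i 1)

/-- `w` is the weak (distributional) partial derivative `∂u/∂x_i` in `Ω`. -/
def IsWeakPartial {d : ℕ} (Ω : Set (Pt d)) (i : Fin d) (u w : Pt d → ℝ) : Prop :=
  ∀ φ : Pt d → ℝ, ContDiff ℝ ∞ φ → HasCompactSupport φ → tsupport φ ⊆ Ω →
    ∫ x in Ω, u x * pderiv i φ x = -∫ x in Ω, w x * φ x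

theorem pderiv_continuous {d : ℕ} {i : Fin d} {φ : Pt d → ℝ} (h : ContDiff ℝ ∞ φ) :
    Continuous (pderiv i φ) := by
  have := h.continuous_fderiv (by simp)
  unfold pderiv
  fun_prop

theorem pderiv_hasCompactSupport {d : ℕ} {i : Fin d} {φ : Pt d → ℝ} (h : HasCompactSupport φ) :
    HasCompactSupport (pderiv i φ) :=
  h.fderiv_apply (𝕜 := ℝ) (EuclideanSpace.single i 1)

theorem integrable_mul_test {d : ℕ} {Ω : Set (Pt d)} {u ψ : Pt d → ℝ}
    (hu : MemLp u 2 (volume.restrict Ω)) (hψ : Continuous ψ) (hc : HasCompactSupport ψ) :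
    Integrable (fun x => u x * ψ x) (volume.restrict Ω) :=
  hu.integrable_mul (hψ.memLp_of_hasCompactSupport hc : MemLp ψ 2 (volume.restrict Ω))

theorem IsWeakPartial.add {d : ℕ} {Ω : Set (Pt d)} {i : Fin d} {u u' w w' : Pt d → ℝ}
    (hu : MemLp u 2 (volume.restrict Ω)) (hu' : MemLp u' 2 (volume.restrict Ω))
    (hw : MemLp w 2 (volume.restrict Ω)) (hw' : MemLp w' 2 (volume.restrict Ω))
    (h : IsWeakPartial Ω i u w) (h' : IsWeakPartial Ω i u' w') :
    IsWeakPartial Ω i (u + u') (w + w') := by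
  intro φ h1 h2 h3
  have c1 := pderiv_continuous (i := i) h1
  have c2 := pderiv_hasCompactSupport (i := i) h2
  simp only [Pi.add_apply, add_mul]
  rw [integral_add (integrable_mul_test hu c1 c2) (integrable_mul_test hu' c1 c2),
    integral_add (integrable_mul_test hw h1.continuous h2)
      (integrable_mul_test hw' h1.continuous h2), h φ h1 h2 h3, h' φ h1 h2 h3]
  ring

theorem IsWeakPartial.smul {d : ℕ} {Ω : Set (Pt d)} {i : Fin d} {u w : Pt d → ℝ} (a : ℝ)
    (h : IsWeakPartial Ω i u w) : IsWeakPartial Ω i (a • u) (a • w) := by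
  intro φ h1 h2 h3
  simp only [Pi.smul_apply, smul_eq_mul, mul_assoc]
  rw [integral_const_mul, integral_const_mul, h φ h1 h2 h3]
  ring

/-- The Sobolev space `H²(Ω)`: square integrable functions `u` on `Ω`, together with square
integrable weak partial derivatives `∂_i u` and `∂_j ∂_i u`. Elements are not identified when they
agree almost everywhere. -/
def sobolevH2 {d : ℕ} (Ω : Set (Pt d)) :
    Submodule ℝ ((Pt d → ℝ) × (Fin d → Pt d → ℝ) × (Fin d → Fin d → Pt d → ℝ)) where
  carrier := {v | MemLp v.1 2 (volume.restrict Ω) ∧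
    (∀ i, MemLp (v.2.1 i) 2 (volume.restrict Ω) ∧ IsWeakPartial Ω i v.1 (v.2.1 i)) ∧
    ∀ i j, MemLp (v.2.2 i j) 2 (volume.restrict Ω) ∧ IsWeakPartial Ω j (v.2.1 i) (v.2.2 i j)}
  add_mem' := by
    rintro v w ⟨v0, v1, v2⟩ ⟨w0, w1, w2⟩
    exact ⟨v0.add w0,
      fun i => ⟨(v1 i).1.add (w1 i).1,
        IsWeakPartial.add v0 w0 (v1 i).1 (w1 i).1 (v1 i).2 (w1 i).2⟩,
      fun i j => ⟨(v2 i j).1.add (w2 i j).1,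
        IsWeakPartial.add (v1 i).1 (w1 i).1 (v2 i j).1 (w2 i j).1 (v2 i j).2 (w2 i j).2⟩⟩
  zero_mem' := by
    refine ⟨MemLp.zero, fun i => ⟨MemLp.zero, ?_⟩, fun i j => ⟨MemLp.zero, ?_⟩⟩ <;>
    · intro φ _ _ _
      simp
  smul_mem' := by
    rintro a v ⟨v0, v1, v2⟩
    exact ⟨v0.const_smul a,
      fun i => ⟨(v1 i).1.const_smul a, (v1 i).2.smul a⟩,
      fun i j => ⟨(v2 i j).1.const_smul a, (v2 i j).2.smul a⟩⟩

/-- The type of elements of `H²(Ω)`. -/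
abbrev H2 {d : ℕ} (Ω : Set (Pt d)) : Type := ↥(sobolevH2 Ω)

namespace H2

variable {d : ℕ} {Ω : Set (Pt d)}

/-- The function itself. -/
def val (v : H2 Ω) : Pt d → ℝ := v.1.1

/-- The weak derivative `∂_i v`. -/
def grad (v : H2 Ω) (i : Fin d) : Pt d → ℝ := v.1.2.1 i

/-- The weak derivative `∂_j ∂_i v`. -/
def hess (v : H2 Ω) (i j : Fin d) : Pt d → ℝ := v.1.2.2 i j

/-- The gradient as a vector. -/
def gradVec (v : H2 Ω) (x : Pt d) : Pt d := WithLp.toLp 2 fun i => v.grad i x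

/-- The Laplacian `Δ v = ∑ ∂_i ∂_i v`. -/
def lap (v : H2 Ω) (x : Pt d) : ℝ := ∑ i, v.hess i i x

/-- `|∇v(x)|²`. -/
def gradSq (v : H2 Ω) (x : Pt d) : ℝ := ∑ i, (v.grad i x) ^ 2

/-- `|D²v(x)|²`. -/
def hessSq (v : H2 Ω) (x : Pt d) : ℝ := ∑ i, ∑ j, (v.hess i j x) ^ 2

/-- The norm of `H²(Ω)`. -/
def norm2 (v : H2 Ω) : ℝ :=
  Real.sqrt (∫ x in Ω, (v.hessSq x + v.gradSq x + (v.val x) ^ 2))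

/-- The norm of `H²(Ω)^N`. -/
def vecNorm2 {N : ℕ} (V : Fin N → H2 Ω) : ℝ :=
  Real.sqrt (∫ x in Ω, ∑ n, ((V n).hessSq x + (V n).gradSq x + ((V n).val x) ^ 2))

end H2

/-! ### Boundary values -/

/-- `g ∈ L¹(∂Ω)` is the trace on `∂Ω` of the function `u` with weak gradient `Du`, expressed by
the Gauss-Green formula `∫_Ω (u ∂_i φ + φ ∂_i u) dx = ∫_{∂Ω} g φ ν_i dσ` for all smooth compactly
supported `φ` on the whole space. This determines `g` almost everywhere on `∂Ω`. -/
def HasTrace {d : ℕ} (Ω : Set (Pt d)) (u : Pt d → ℝ) (Du : Fin d → Pt d → ℝ)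
    (g : Pt d → ℝ) : Prop :=
  Integrable g (surfaceMeasure Ω) ∧
  ∀ φ : Pt d → ℝ, ContDiff ℝ ∞ φ → HasCompactSupport φ → ∀ i : Fin d,
    ∫ x in Ω, (u x * pderiv i φ x + Du i x * φ x) =
      ∫ x, g x * φ x * outerNormal Ω x i ∂(surfaceMeasure Ω)

/-- `v = g` on `∂Ω`. -/
def HasBoundaryValue {d : ℕ} {Ω : Set (Pt d)} (v : H2 Ω) (g : Pt d → ℝ) : Prop :=
  HasTrace Ω v.val v.grad g

/-- `∂_ν v = q` on `∂Ω`, where `∂_ν v = ∑_i ν_i ∂_i v` with the traces of the `∂_i v`. -/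
def HasNormalDerivative {d : ℕ} {Ω : Set (Pt d)} (v : H2 Ω) (q : Pt d → ℝ) : Prop :=
  ∃ g : Fin d → Pt d → ℝ, (∀ i, HasTrace Ω (v.grad i) (v.hess i) (g i)) ∧
    ∀ᵐ x ∂(surfaceMeasure Ω), q x = ∑ i, outerNormal Ω x i * g i x

/-- The set of admissible functions
`H = {V ∈ H²(Ω)^N : V = G and ∂_ν V = Q on ∂Ω}`. -/
def admissible {d : ℕ} (Ω : Set (Pt d)) {N : ℕ} (G Q : Fin N → Pt d → ℝ) :
    Set (Fin N → H2 Ω) :=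
  {V | ∀ n, HasBoundaryValue (V n) (G n) ∧ HasNormalDerivative (V n) (Q n)}

/-! ### The Carleman weight and the Carleman estimate -/

/-- The weight `exp (2 λ b^{-β} r(x)^β)` with `r(x) = |x - x₀|`. -/
def carlemanWeight {d : ℕ} (x₀ : Pt d) (b β lam : ℝ) (x : Pt d) : ℝ :=
  Real.exp (2 * lam * b ^ (-β) * (dist x x₀) ^ β)

/-- The Carleman estimate for the Laplacian, valid for all `λ ≥ lam₀` and all `v ∈ H²(Ω)` with
`v = ∂_ν v = 0` on `∂Ω`, with a constant `K` that does not depend on `λ` and `v`. -/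
def CarlemanEstimate {d : ℕ} (Ω : Set (Pt d)) (x₀ : Pt d) (b β lam₀ : ℝ) : Prop :=
  ∃ K : ℝ, 0 < K ∧ ∀ lam : ℝ, lam₀ ≤ lam → ∀ v : H2 Ω,
    HasBoundaryValue v 0 → HasNormalDerivative v 0 →
    K * lam⁻¹ * (∫ x in Ω, carlemanWeight x₀ b β lam x * v.hessSq x)
      + K * lam ^ 3 * (∫ x in Ω, carlemanWeight x₀ b β lam x * (v.val x) ^ 2)
      + K * lam * (∫ x in Ω, carlemanWeight x₀ b β lam x * v.gradSq x)
      ≤ ∫ x in Ω, carlemanWeight x₀ b β lam x * (v.lap x) ^ 2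

/-! ### The nonlinear elliptic system -/

/-- `Ψ 0, Ψ 1, …` is an orthonormal basis of `L²(0,T)` consisting of functions that are `C¹` on
`[0,T]`. -/
structure IsC1OrthonormalBasis (T : ℝ) (Ψ : ℕ → ℝ → ℝ) : Prop where
  contDiffOn : ∀ n, ContDiffOn ℝ 1 (Ψ n) (Icc 0 T)
  orthonormal : ∀ m n, ∫ t in (0 : ℝ)..T, Ψ m t * Ψ n t = if m = n then 1 else 0
  complete : ∀ f : ℝ → ℝ, MemLp f 2 (volume.restrict (Ioo 0 T)) →
    (∀ n, ∫ t in (0 : ℝ)..T, f t * Ψ n t = 0) → f =ᵐ[volume.restrict (Ioo 0 T)] 0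

/-- The entries `s_{mn} = ∫_0^T Ψ_n'(t) Ψ_m(t) dt` of the matrix `S`. -/
def sEntry (T : ℝ) (Ψ : ℕ → ℝ → ℝ) (m n : ℕ) : ℝ :=
  ∫ t in (0 : ℝ)..T, deriv (Ψ n) t * Ψ m t

/-- `F_m(x, U(x), ∇U(x)) = ∫_0^T F(x, t, ∑ u_n(x) Ψ_n(t), ∑ ∇u_n(x) Ψ_n(t)) Ψ_m(t) dt`. -/
def nonlin {d N : ℕ} {Ω : Set (Pt d)} (T : ℝ) (Ψ : ℕ → ℝ → ℝ)
    (F : Pt d → ℝ → ℝ → Pt d → ℝ) (U : Fin N → H2 Ω) (m : Fin N) (x : Pt d) : ℝ :=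
  ∫ t in (0 : ℝ)..T,
    F x t (∑ n : Fin N, (U n).val x * Ψ n t) (∑ n : Fin N, Ψ n t • (U n).gradVec x) * Ψ m t

/-- The `m`-th component of `ΔV - c S V + 𝐅(x, W, ∇W)` at `x`. -/
def sysResidual {d N : ℕ} {Ω : Set (Pt d)} (T : ℝ) (Ψ : ℕ → ℝ → ℝ) (c : Pt d → ℝ)
    (F : Pt d → ℝ → ℝ → Pt d → ℝ) (W V : Fin N → H2 Ω) (m : Fin N) (x : Pt d) : ℝ :=
  (V m).lap x - c x * (∑ n : Fin N, sEntry T Ψ m n * (V n).val x) + nonlin T Ψ F W m x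

/-- `U` solves `ΔU - c S U + 𝐅(x, U, ∇U) = 0` in `Ω`, `U = G` and `∂_ν U = Q` on `∂Ω`. -/
def IsSystemSolution {d N : ℕ} {Ω : Set (Pt d)} (T : ℝ) (Ψ : ℕ → ℝ → ℝ) (c : Pt d → ℝ)
    (F : Pt d → ℝ → ℝ → Pt d → ℝ) (G Q : Fin N → Pt d → ℝ) (U : Fin N → H2 Ω) : Prop :=
  U ∈ admissible Ω G Q ∧
    ∀ᵐ x ∂(volume.restrict Ω), ∀ m, sysResidual T Ψ c F U U m x = 0

/-- The functional `J(V) = ∫_Ω e^{2λ b^{-β} r^β} |ΔV - c S V + 𝐅(x, W, ∇W)|² dx`, where `W` is the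
previous iterate. -/
def carlemanFunctional {d N : ℕ} {Ω : Set (Pt d)} (x₀ : Pt d) (b β lam T : ℝ)
    (Ψ : ℕ → ℝ → ℝ) (c : Pt d → ℝ) (F : Pt d → ℝ → ℝ → Pt d → ℝ) (W V : Fin N → H2 Ω) : ℝ :=
  ∫ x in Ω, carlemanWeight x₀ b β lam x * ∑ m, (sysResidual T Ψ c F W V m x) ^ 2

/-- `U 0` is an arbitrary element of `H²(Ω)^N`, and for every `k` the function `U (k + 1)` is the
minimiser over the admissible set of the functional built from `U k`. -/
def IsCarlemanIteration {d N : ℕ} {Ω : Set (Pt d)} (x₀ : Pt d) (b β lam T : ℝ)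
    (Ψ : ℕ → ℝ → ℝ) (c : Pt d → ℝ) (F : Pt d → ℝ → ℝ → Pt d → ℝ) (G Q : Fin N → Pt d → ℝ)
    (U : ℕ → Fin N → H2 Ω) : Prop :=
  ∀ k, U (k + 1) ∈ admissible Ω G Q ∧
    IsMinOn (carlemanFunctional x₀ b β lam T Ψ c F (U k)) (admissible Ω G Q) (U (k + 1))

/-- The `C¹` norm of `F(x, t, s, p)` in the variables `(s, p)`, uniformly in
`(x, t) ∈ Ω × (0, T)`, as an extended nonnegative number. -/
def c1Norm {d : ℕ} (Ω : Set (Pt d)) (T : ℝ) (F : Pt d → ℝ → ℝ → Pt d → ℝ) : ℝ≥0∞ :=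
  ⨆ x ∈ Ω, ⨆ t ∈ Ioo 0 T, ⨆ (s : ℝ) (p : Pt d),
    ENNReal.ofReal (|F x t s p| + |deriv (fun s' => F x t s' p) s| + ‖gradient (F x t s) p‖)

/-- `λ^{-2} |D²V(x)|² + |∇V(x)|² + |V(x)|²`. -/
def errorDensity {d N : ℕ} {Ω : Set (Pt d)} (lam : ℝ) (V : Fin N → H2 Ω) (x : Pt d) : ℝ :=
  ∑ n, ((lam ^ 2)⁻¹ * (V n).hessSq x + (V n).gradSq x + ((V n).val x) ^ 2)

/-- The initial condition `∑_n u_n Ψ_n(0)` reconstructed from `V = (u_1, …, u_N)`. -/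
def initialCondition {d N : ℕ} {Ω : Set (Pt d)} (Ψ : ℕ → ℝ → ℝ) (V : Fin N → H2 Ω) : H2 Ω :=
  ∑ n : Fin N, Ψ n 0 • V n

end

/-!
The iteration contracts because a Carleman estimate with the weight `e^{2λφ}`, `φ = b^{-β} r^β`,
controls a function with vanishing Cauchy data by its Laplacian with a gain of powers of `λ`.

*Carleman estimate.* For `β ≥ 2` the function `φ` is uniformly convex and has no critical point near
`closure Ω`. With `u = e^{λφ} v`, the function `e^{λφ} Δv` is `A - B`, where
`A = Δu + λ² |∇φ|² u` and `B = 2λ ∇φ · ∇u + λ Δφ u`, and `(A - B)² ≥ -2AB`. Up to divergences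
(`carleman_multiplier_identity`), `-2AB` is the form
`4λ D²φ(∇u, ∇u) + 4λ³ D²φ(∇φ, ∇φ) u² + 2λ u ∇Δφ · ∇u`, which convexity makes positive for large `λ`
(`commutator_lower_bound`). The second derivatives of `u` are recovered from `∫ |D²u|² = ∫ |Δu|²`.
All this is collected in `pointwise_carleman`, a pointwise inequality modulo divergences, and gives
`IsConvexWeight.carleman_smooth` for test functions supported near `closure Ω`.

*From test functions to `H²`.* If `v` and `∂_ν v` vanish on `∂Ω`, the traces `g_i` of `∂_i v` satisfy
`g_i ν_j = g_j ν_i` by the symmetry of the Hessian, so they all vanish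
(`integral_grad_mul_pderiv_of_zero_trace`). Hence the extension of `v` by zero is in `H²` of the whole
space. Its mollifications are test functions, and the estimate passes to the limit by Fatou's lemma
and Jensen's inequality (`IsConvexWeight.carleman_sobolev`). The regularity of the boundary
enters only here, through the Gauss-Green formulas defining the traces.

*Contraction.* The error `U - U*` of a minimiser has vanishing Cauchy data. Comparing the functional
at `U` and at `U*` bounds `(Δ - cS)(U - U*)` by the difference of the nonlinear terms at the previous
iterate and at `U*`, hence by the previous error, as `F` is Lipschitz
(`integral_linear_residual_le`). The Carleman estimate applied to the components of `U - U*` then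
yields the factor `C / λ` (`energy_estimate`, `exists_contraction`). The threshold `λ₀` may not depend
on `c` and `S`; for the bounded range of `λ ≥ λ₀` in which the term `cS` is not absorbed, the weights
are comparable to a single one, and the comparison constant goes into `C`.
-/

/-! ### Calculus of classical partial derivatives -/

section Calculus

variable {d : ℕ} {f g φ : Pt d → ℝ}

theorem ContDiff.pderiv (i : Fin d) (h : ContDiff ℝ ∞ f) : ContDiff ℝ ∞ (pderiv i f) := by
  have : ContDiff ℝ ∞ (fderiv ℝ f) := h.fderiv_right (by simp)
  exact this.clm_apply contDiff_const

theorem pderiv_add_apply (i : Fin d) (hf : ContDiff ℝ ∞ f) (hg : ContDiff ℝ ∞ g) (x : Pt d) :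
    pderiv i (fun y => f y + g y) x = pderiv i f x + pderiv i g x := by
  have h1 := hf.differentiable (by simp) x
  have h2 := hg.differentiable (by simp) x
  simp [pderiv, fderiv_fun_add h1 h2]

theorem pderiv_mul_apply (i : Fin d) (hf : ContDiff ℝ ∞ f) (hg : ContDiff ℝ ∞ g) (x : Pt d) :
    pderiv i (fun y => f y * g y) x = pderiv i f x * g x + f x * pderiv i g x := by
  have h1 := hf.differentiable (by simp) x
  have h2 := hg.differentiable (by simp) x
  simp [pderiv, fderiv_fun_mul h1 h2]
  ring

theorem pderiv_const_mul_apply (i : Fin d) (a : ℝ) (hf : ContDiff ℝ ∞ f) (x : Pt d) :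
    pderiv i (fun y => a * f y) x = a * pderiv i f x := by
  have h1 := hf.differentiable (by simp) x
  simp [pderiv, fderiv_const_mul h1]

theorem pderiv_exp_apply (i : Fin d) (hf : ContDiff ℝ ∞ f) (x : Pt d) :
    pderiv i (fun y => Real.exp (f y)) x = Real.exp (f x) * pderiv i f x := by
  have h1 := hf.differentiable (by simp) x
  simp [pderiv, fderiv_exp h1]

theorem pderiv_comm (hf : ContDiff ℝ ∞ f) (i j : Fin d) :
    pderiv i (pderiv j f) = pderiv j (pderiv i f) := by
  funext x
  have hs : IsSymmSndFDerivAt ℝ f x := hf.contDiffAt.isSymmSndFDerivAt (by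
    simp only [minSmoothness_of_isRCLikeNormedField]
    exact WithTop.coe_le_coe.2 le_top)
  have hd : DifferentiableAt ℝ (fderiv ℝ f) x :=
    (hf.fderiv_right (m := ∞) (by simp)).differentiable (by simp) x
  have key : ∀ k l : Fin d, pderiv k (pderiv l f) x =
      fderiv ℝ (fderiv ℝ f) x (EuclideanSpace.single k 1) (EuclideanSpace.single l 1) := by
    intro k l
    unfold pderiv
    rw [fderiv_clm_apply hd (by fun_prop)]
    simp
  rw [key, key]
  exact hs _ _

theorem integral_pderiv_eq_zero (i : Fin d) (hf : ContDiff ℝ ∞ f) (hc : HasCompactSupport f) :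
    ∫ x, pderiv i f x = 0 := by
  have hi : Integrable f := hf.continuous.integrable_of_hasCompactSupport hc
  have hi' : Integrable (pderiv i f) :=
    (hf.pderiv i).continuous.integrable_of_hasCompactSupport (pderiv_hasCompactSupport hc)
  have := integral_mul_fderiv_eq_neg_fderiv_mul_of_integrable (μ := (volume : Measure (Pt d)))
    (f := fun _ => (1 : ℝ)) (g := f) (v := EuclideanSpace.single i 1) (by simp)
    (by simp only [one_mul]; exact hi') (by simpa using hi) (by simp) (fun x _ => hf.differentiable (by simp) x)
  simpa [pderiv] using this

end Calculus

/-! ### Divergence identities -/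

section DivergenceIdentities

variable {d : ℕ}

/-- The cross term of the conjugated operator. Summed over `i` and `j`, the first product is
`-2 (Δu + λ² |∇φ|² u) (2 λ ∇φ · ∇u + λ Δφ u)`, minus twice the product of the symmetric and the
antisymmetric part of `e^{λφ} Δ e^{-λφ}`. Up to divergences it equals the remaining terms, which
contain no second derivatives of `u`. -/
theorem carleman_multiplier_identity {u φ : Pt d → ℝ} (hu : ContDiff ℝ ∞ u)
    (hc : HasCompactSupport u) (hφ : ContDiff ℝ ∞ φ) (lam : ℝ) (i j : Fin d) :
    ∫ x, (-2 * ((pderiv i (pderiv i u) x + lam ^ 2 * (pderiv i φ x) ^ 2 * u x) *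
        (2 * lam * pderiv j φ x * pderiv j u x + lam * pderiv j (pderiv j φ) x * u x)) -
      (4 * lam * (pderiv i (pderiv j φ) x * pderiv i u x * pderiv j u x) +
        2 * lam * (pderiv i (pderiv j (pderiv j φ)) x * u x * pderiv i u x) +
        4 * lam ^ 3 * (pderiv i (pderiv j φ) x * pderiv i φ x * pderiv j φ x) * u x ^ 2)) = 0 := by
  have hui := hu.pderiv i
  have huj := hu.pderiv j
  have hφi := hφ.pderiv i
  have hφj := hφ.pderiv j
  have hφjj := hφj.pderiv j
  set A : Pt d → ℝ := fun x => u x * ((-2 * lam) * (pderiv j (pderiv j φ) x * pderiv i u x)) +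
    pderiv i u x * ((-4 * lam) * (pderiv j φ x * pderiv j u x)) with hA
  set B : Pt d → ℝ := fun x => pderiv i u x * ((2 * lam) * (pderiv j φ x * pderiv i u x)) +
    u x * ((-2 * lam ^ 3) * (pderiv i φ x * (pderiv i φ x * (pderiv j φ x * u x)))) with hB
  have hAs : ContDiff ℝ ∞ A := by fun_prop
  have hBs : ContDiff ℝ ∞ B := by fun_prop
  have hAc : HasCompactSupport A :=
    (HasCompactSupport.mul_right hc).add (HasCompactSupport.mul_right (pderiv_hasCompactSupport hc))
  have hBc : HasCompactSupport B :=
    (HasCompactSupport.mul_right (pderiv_hasCompactSupport hc)).add (HasCompactSupport.mul_right hc)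
  have h0 : ∫ x, (pderiv i A x + pderiv j B x) = 0 := by
    rw [integral_add, integral_pderiv_eq_zero i hAs hAc, integral_pderiv_eq_zero j hBs hBc,
      add_zero]
    · exact (hAs.pderiv i).continuous.integrable_of_hasCompactSupport (pderiv_hasCompactSupport hAc)
    · exact (hBs.pderiv j).continuous.integrable_of_hasCompactSupport (pderiv_hasCompactSupport hBc)
  rw [← h0]
  congr 1
  funext x
  have e1 := congrFun (pderiv_comm hu j i) x
  have e2 := congrFun (pderiv_comm hφ j i) x
  rw [hA, hB, pderiv_add_apply _ (by fun_prop) (by fun_prop),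
    pderiv_add_apply _ (by fun_prop) (by fun_prop)]
  rw [pderiv_mul_apply _ hu (by fun_prop), pderiv_mul_apply _ hui (by fun_prop),
    pderiv_mul_apply _ hui (by fun_prop), pderiv_mul_apply _ hu (by fun_prop)]
  repeat rw [pderiv_const_mul_apply _ _ (by fun_prop)]
  rw [pderiv_mul_apply _ hφjj hui, pderiv_mul_apply _ hφj huj, pderiv_mul_apply _ hφj hui,
    pderiv_mul_apply _ hφi (by fun_prop), pderiv_mul_apply _ hφi (by fun_prop),
    pderiv_mul_apply _ hφj hu, e1, e2]
  ring

/-- `|D²u|²` and `(Δu)²` have the same integral, term by term. -/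
theorem integral_hessian_null_lagrangian {u : Pt d → ℝ} (hu : ContDiff ℝ ∞ u)
    (hc : HasCompactSupport u) (i j : Fin d) :
    ∫ x, ((pderiv i (pderiv j u) x) ^ 2 -
      pderiv i (pderiv i u) x * pderiv j (pderiv j u) x) = 0 := by
  have hui := hu.pderiv i
  have huj := hu.pderiv j
  have huij := hui.pderiv j
  have hujj := huj.pderiv j
  set A : Pt d → ℝ := fun x => pderiv i u x * pderiv j (pderiv i u) x with hA
  set B : Pt d → ℝ := fun x => pderiv i u x * pderiv j (pderiv j u) x with hB
  have hAs : ContDiff ℝ ∞ A := by fun_prop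
  have hBs : ContDiff ℝ ∞ B := by fun_prop
  have hAc : HasCompactSupport A := HasCompactSupport.mul_right (pderiv_hasCompactSupport hc)
  have hBc : HasCompactSupport B := HasCompactSupport.mul_right (pderiv_hasCompactSupport hc)
  have h0 : ∫ x, (pderiv j A x - pderiv i B x) = 0 := by
    rw [integral_sub, integral_pderiv_eq_zero j hAs hAc, integral_pderiv_eq_zero i hBs hBc,
      sub_zero]
    · exact (hAs.pderiv j).continuous.integrable_of_hasCompactSupport (pderiv_hasCompactSupport hAc)
    · exact (hBs.pderiv i).continuous.integrable_of_hasCompactSupport (pderiv_hasCompactSupport hBc)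
  rw [← h0]
  congr 1
  funext x
  rw [hA, hB, pderiv_mul_apply _ hui huij, pderiv_mul_apply _ hui hujj, pderiv_comm hu i j,
    pderiv_comm huj i j, pderiv_comm hu i j]
  ring

end DivergenceIdentities

/-! ### The pointwise estimate for the conjugated operator -/

section PointwiseCarleman

open Finset

variable {d : ℕ} {p g : Fin d → ℝ} {h H τ : Fin d → Fin d → ℝ} {U lam m B : ℝ}

/-- The commutator form is positive, with the powers `λ |∇u|²` and `λ³ u²`, once `λ` is large: the
convexity of `φ` makes the two quadratic terms positive, and the mixed term with the third
derivatives of `φ` is absorbed. -/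
theorem commutator_lower_bound (hm : 0 < m) (hlam : 1 ≤ lam)
    (hlB : B ≤ 4 * m ^ 3 * lam ^ 2)
    (hconv : ∀ ξ : Fin d → ℝ, m * ∑ i, ξ i ^ 2 ≤ ∑ i, ∑ j, h i j * ξ i * ξ j)
    (hp : m ≤ ∑ i, p i ^ 2) (hτ : ∑ i, (∑ j, τ i j) ^ 2 ≤ B) :
    2 * lam * m * ∑ i, g i ^ 2 + 2 * lam ^ 3 * m ^ 2 * U ^ 2 ≤
      ∑ i, ∑ j, (4 * lam * (h i j * g i * g j) + 2 * lam * (τ i j * U * g i) +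
        4 * lam ^ 3 * (h i j * p i * p j) * U ^ 2) := by
  have e : ∑ i, ∑ j, (4 * lam * (h i j * g i * g j) + 2 * lam * (τ i j * U * g i) +
        4 * lam ^ 3 * (h i j * p i * p j) * U ^ 2) =
      4 * lam * ∑ i, ∑ j, h i j * g i * g j + lam * ∑ i, 2 * (U * (∑ j, τ i j) * g i) +
        4 * lam ^ 3 * U ^ 2 * ∑ i, ∑ j, h i j * p i * p j := by
    simp only [mul_sum, sum_mul, ← sum_add_distrib]
    refine sum_congr rfl fun i _ => sum_congr rfl fun j _ => ?_
    ring
  have h1 := hconv g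
  have h2 : m * m ≤ ∑ i, ∑ j, h i j * p i * p j :=
    (mul_le_mul_of_nonneg_left hp hm.le).trans (hconv p)
  have h3 : -(2 * m * ∑ i, g i ^ 2 + U ^ 2 / (2 * m) * B) ≤
      ∑ i, 2 * (U * (∑ j, τ i j) * g i) := by
    have : ∑ i, -(2 * m * g i ^ 2 + U ^ 2 / (2 * m) * (∑ j, τ i j) ^ 2) ≤
        ∑ i, 2 * (U * (∑ j, τ i j) * g i) := by
      refine sum_le_sum fun i _ => ?_
      -- a weighted arithmetic-geometric mean inequality
      have : 0 ≤ (2 * m * g i + U * ∑ j, τ i j) ^ 2 / (2 * m) := by positivity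
      have e : (2 * m * g i + U * ∑ j, τ i j) ^ 2 / (2 * m) =
          2 * m * g i ^ 2 + 2 * (U * (∑ j, τ i j) * g i) +
            U ^ 2 / (2 * m) * (∑ j, τ i j) ^ 2 := by
        field_simp
        ring
      linarith
    rw [sum_neg_distrib, sum_add_distrib, ← mul_sum, ← mul_sum] at this
    have : U ^ 2 / (2 * m) * ∑ i, (∑ j, τ i j) ^ 2 ≤ U ^ 2 / (2 * m) * B :=
      mul_le_mul_of_nonneg_left hτ (by positivity)
    linarith
  rw [e]
  have h4 : U ^ 2 / (2 * m) * B ≤ 2 * lam ^ 2 * m ^ 2 * U ^ 2 := by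
    rw [div_mul_eq_mul_div, div_le_iff₀ (by positivity)]
    nlinarith [mul_le_mul_of_nonneg_left hlB (sq_nonneg U)]
  have h5 : lam * (U ^ 2 / (2 * m) * B) ≤ lam * (2 * lam ^ 2 * m ^ 2 * U ^ 2) :=
    mul_le_mul_of_nonneg_left h4 (by linarith)
  have h6 := mul_le_mul_of_nonneg_left h1 (show 0 ≤ 4 * lam by linarith)
  have h7 := mul_le_mul_of_nonneg_left h2 (show 0 ≤ 4 * lam ^ 3 * U ^ 2 by positivity)
  have h8 := mul_le_mul_of_nonneg_left h3 (show 0 ≤ lam by linarith)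
  linarith

/-- `Δu` in terms of `e^{λφ} Δv`, where `u = e^{λφ} v`. -/
theorem conjugated_laplacian_sq_le (hp : ∑ i, p i ^ 2 ≤ B) (hB : 1 ≤ B) (hlam : 1 ≤ lam)
    (hh : (∑ i, h i i) ^ 2 ≤ B) :
    (∑ i, H i i) ^ 2 ≤
      4 * (∑ i, (H i i - 2 * lam * p i * g i + (lam ^ 2 * p i ^ 2 - lam * h i i) * U)) ^ 2 +
        16 * lam ^ 2 * B * ∑ i, g i ^ 2 + 8 * lam ^ 4 * B ^ 2 * U ^ 2 := by
  set L := ∑ i, (H i i - 2 * lam * p i * g i + (lam ^ 2 * p i ^ 2 - lam * h i i) * U) with hL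
  set P := ∑ i, p i ^ 2 with hP
  set S := ∑ i, h i i with hS
  set G := ∑ i, p i * g i with hG
  have e : ∑ i, H i i = L + 2 * lam * G - lam ^ 2 * P * U + lam * S * U := by
    rw [hL, hP, hS, hG]
    simp only [mul_sum, sum_mul, ← sum_add_distrib, ← sum_sub_distrib]
    refine sum_congr rfl fun i _ => ?_
    ring
  have cs : G ^ 2 ≤ B * ∑ i, g i ^ 2 :=
    (sum_mul_sq_le_sq_mul_sq univ p g).trans
      (mul_le_mul_of_nonneg_right hp (sum_nonneg fun i _ => sq_nonneg _))
  have hP0 : 0 ≤ P := sum_nonneg fun i _ => sq_nonneg _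
  have hP2 : P ^ 2 ≤ B ^ 2 := by gcongr
  have four : ∀ x y z w : ℝ, (x + y - z + w) ^ 2 ≤ 4 * (x ^ 2 + y ^ 2 + z ^ 2 + w ^ 2) := by
    intro x y z w
    nlinarith [sq_nonneg (x - y), sq_nonneg (x + z), sq_nonneg (x - w), sq_nonneg (y + z),
      sq_nonneg (y - w), sq_nonneg (z + w)]
  rw [e]
  refine (four _ _ _ _).trans ?_
  have l2 : lam ^ 2 ≤ lam ^ 4 := pow_le_pow_right₀ hlam (by norm_num)
  have a1 : (2 * lam * G) ^ 2 ≤ 4 * lam ^ 2 * (B * ∑ i, g i ^ 2) := by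
    have := mul_le_mul_of_nonneg_left cs (show 0 ≤ 4 * lam ^ 2 by positivity)
    nlinarith
  have a2 : (lam ^ 2 * P * U) ^ 2 ≤ lam ^ 4 * U ^ 2 * B ^ 2 := by
    have := mul_le_mul_of_nonneg_left hP2 (show 0 ≤ lam ^ 4 * U ^ 2 by positivity)
    nlinarith
  have a3 : (lam * S * U) ^ 2 ≤ lam ^ 4 * U ^ 2 * B ^ 2 := by
    have h1 : S ^ 2 ≤ B ^ 2 := hh.trans (by nlinarith)
    calc (lam * S * U) ^ 2 = lam ^ 2 * U ^ 2 * S ^ 2 := by ring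
      _ ≤ lam ^ 4 * U ^ 2 * B ^ 2 := by gcongr
  linarith

/-- `e^{λφ} D²v` in terms of `D²u`, where `u = e^{λφ} v`. -/
theorem conjugated_hessian_sq_le (hp : ∑ i, p i ^ 2 ≤ B) (hB : 1 ≤ B) (hlam : 1 ≤ lam)
    (hh : ∑ i, ∑ j, h i j ^ 2 ≤ B) :
    ∑ i, ∑ j, (H i j - lam * p i * g j - lam * p j * g i +
        (lam ^ 2 * p i * p j - lam * h i j) * U) ^ 2 ≤
      5 * (∑ i, ∑ j, H i j ^ 2 + 2 * lam ^ 2 * B * ∑ i, g i ^ 2 + 2 * lam ^ 4 * B ^ 2 * U ^ 2) := by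
  have five : ∀ x y z w t : ℝ,
      (x - y - z + (w - t)) ^ 2 ≤ 5 * (x ^ 2 + y ^ 2 + z ^ 2 + w ^ 2 + t ^ 2) := by
    intro x y z w t
    nlinarith [sq_nonneg (x + y), sq_nonneg (x + z), sq_nonneg (x - w), sq_nonneg (x + t),
      sq_nonneg (y - z), sq_nonneg (y + w), sq_nonneg (y - t), sq_nonneg (z + w),
      sq_nonneg (z - t), sq_nonneg (w + t)]
  set P := ∑ i, p i ^ 2 with hP
  set a := ∑ i, g i ^ 2 with ha
  have hP0 : 0 ≤ P := sum_nonneg fun i _ => sq_nonneg _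
  have ha0 : 0 ≤ a := sum_nonneg fun i _ => sq_nonneg _
  calc _ ≤ ∑ i, ∑ j, 5 * (H i j ^ 2 + lam ^ 2 * (p i ^ 2 * g j ^ 2) +
          lam ^ 2 * (g i ^ 2 * p j ^ 2) + lam ^ 4 * U ^ 2 * (p i ^ 2 * p j ^ 2) +
          lam ^ 2 * U ^ 2 * h i j ^ 2) := by
        refine sum_le_sum fun i _ => sum_le_sum fun j _ => ?_
        have := five (H i j) (lam * p i * g j) (lam * p j * g i) (lam ^ 2 * p i * p j * U)
          (lam * h i j * U)
        nlinarith
    _ = 5 * (∑ i, ∑ j, H i j ^ 2 + lam ^ 2 * (P * a) + lam ^ 2 * (a * P) +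
          lam ^ 4 * U ^ 2 * (P * P) + lam ^ 2 * U ^ 2 * ∑ i, ∑ j, h i j ^ 2) := by
        rw [hP, ha, sum_mul_sum, sum_mul_sum, sum_mul_sum]
        simp only [mul_sum, ← sum_add_distrib]
    _ ≤ _ := by
        have l2 : lam ^ 2 ≤ lam ^ 4 := pow_le_pow_right₀ hlam (by norm_num)
        have b1 : lam ^ 2 * (P * a) ≤ lam ^ 2 * (B * a) := by gcongr
        have b2 : lam ^ 4 * U ^ 2 * (P * P) ≤ lam ^ 4 * U ^ 2 * (B * B) := by gcongr
        have b3 : lam ^ 2 * U ^ 2 * ∑ i, ∑ j, h i j ^ 2 ≤ lam ^ 4 * U ^ 2 * (B * B) := by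
          have : ∑ i, ∑ j, h i j ^ 2 ≤ B * B := hh.trans (by nlinarith)
          gcongr
        linarith

/-- The pointwise form of the Carleman estimate. In terms of `u = e^{λφ} v`, with `U`, `g`, `H` the
value, gradient and Hessian of `u`, and `p`, `h` the gradient and Hessian of the weight `φ`, the
weighted derivatives of `v` are controlled by the weighted Laplacian of `v`, up to the two double
sums on the right, which are divergences and integrate to zero. -/
theorem pointwise_carleman (hm : 0 < m) (hB : 1 ≤ B) (hlam : 1 ≤ lam)
    (hlB : B ≤ 4 * m ^ 3 * lam ^ 2)
    (hconv : ∀ ξ : Fin d → ℝ, m * ∑ i, ξ i ^ 2 ≤ ∑ i, ∑ j, h i j * ξ i * ξ j)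
    (hp : m ≤ ∑ i, p i ^ 2) (hτ : ∑ i, (∑ j, τ i j) ^ 2 ≤ B)
    (hpB : ∑ i, p i ^ 2 ≤ B) (hhB : (∑ i, h i i) ^ 2 ≤ B) (hhB' : ∑ i, ∑ j, h i j ^ 2 ≤ B) :
    lam⁻¹ * ∑ i, ∑ j, (H i j - lam * p i * g j - lam * p j * g i +
        (lam ^ 2 * p i * p j - lam * h i j) * U) ^ 2 + lam ^ 3 * U ^ 2 +
        lam * ∑ i, (g i - lam * p i * U) ^ 2 ≤
      (20 + (46 * B / m + 27 * B ^ 2 / m ^ 2)) *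
        (∑ i, (H i i - 2 * lam * p i * g i + (lam ^ 2 * p i ^ 2 - lam * h i i) * U)) ^ 2
      - (46 * B / m + 27 * B ^ 2 / m ^ 2) * ∑ i, ∑ j,
        (-2 * ((H i i + lam ^ 2 * p i ^ 2 * U) * (2 * lam * p j * g j + lam * h j j * U)) -
          (4 * lam * (h i j * g i * g j) + 2 * lam * (τ i j * U * g i) +
            4 * lam ^ 3 * (h i j * p i * p j) * U ^ 2))
      + 5 * lam⁻¹ * ∑ i, ∑ j, (H i j ^ 2 - H i i * H j j) := by
  have c1 := commutator_lower_bound (g := g) (U := U) hm hlam hlB hconv hp hτ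
  have c2 := conjugated_laplacian_sq_le (H := H) (g := g) (U := U) hpB hB hlam hhB
  have c3 := conjugated_hessian_sq_le (H := H) (g := g) (U := U) hpB hB hlam hhB'
  set L := ∑ i, (H i i - 2 * lam * p i * g i + (lam ^ 2 * p i ^ 2 - lam * h i i) * U) with hL
  set R := ∑ i, ∑ j, (4 * lam * (h i j * g i * g j) + 2 * lam * (τ i j * U * g i) +
            4 * lam ^ 3 * (h i j * p i * p j) * U ^ 2) with hR
  set a := ∑ i, g i ^ 2 with ha
  set s := ∑ i, ∑ j, H i j ^ 2 with hs
  set X := ∑ i, (H i i + lam ^ 2 * p i ^ 2 * U) with hX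
  set Y := ∑ j, (2 * lam * p j * g j + lam * h j j * U) with hY
  have ha0 : 0 ≤ a := sum_nonneg fun i _ => sq_nonneg _
  have hLXY : L = X - Y := by
    rw [hL, hX, hY, ← sum_sub_distrib]
    refine sum_congr rfl fun i _ => ?_
    ring
  have hD : ∑ i, ∑ j,
        (-2 * ((H i i + lam ^ 2 * p i ^ 2 * U) * (2 * lam * p j * g j + lam * h j j * U)) -
          (4 * lam * (h i j * g i * g j) + 2 * lam * (τ i j * U * g i) +
            4 * lam ^ 3 * (h i j * p i * p j) * U ^ 2)) = -2 * (X * Y) - R := by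
    rw [hX, hY, hR, sum_mul_sum]
    simp only [mul_sum, ← sum_sub_distrib]
  have hD2 : ∑ i, ∑ j, (H i j ^ 2 - H i i * H j j) = s - (∑ i, H i i) ^ 2 := by
    rw [hs, sq, sum_mul_sum]
    simp only [← sum_sub_distrib]
  have hg : ∑ i, (g i - lam * p i * U) ^ 2 ≤ 2 * a + 2 * lam ^ 2 * B * U ^ 2 := by
    calc _ ≤ ∑ i, (2 * g i ^ 2 + 2 * lam ^ 2 * U ^ 2 * p i ^ 2) := by
          refine sum_le_sum fun i _ => ?_
          nlinarith [sq_nonneg (g i + lam * p i * U)]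
      _ = 2 * a + 2 * lam ^ 2 * U ^ 2 * ∑ i, p i ^ 2 := by
          rw [sum_add_distrib, ← mul_sum, ← mul_sum]
      _ ≤ 2 * a + 2 * lam ^ 2 * U ^ 2 * B := by gcongr
      _ = _ := by ring
  rw [hD, hD2]
  set Q := 46 * B / m + 27 * B ^ 2 / m ^ 2 with hQ
  have hl0 : 0 < lam := by linarith
  have hQ1 : 92 * B ≤ Q * (2 * m) := by
    rw [hQ]
    have : (46 * B / m + 27 * B ^ 2 / m ^ 2) * (2 * m) = 92 * B + 54 * B ^ 2 / m := by
      field_simp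
      ring
    rw [this]
    have : 0 ≤ 54 * B ^ 2 / m := by positivity
    linarith
  have hQ2 : 53 * B ^ 2 ≤ Q * (2 * m ^ 2) := by
    rw [hQ]
    have : (46 * B / m + 27 * B ^ 2 / m ^ 2) * (2 * m ^ 2) = 92 * B * m + 54 * B ^ 2 := by
      field_simp
      ring
    rw [this]
    linarith only [mul_pos (show 0 < B by linarith) hm, sq_nonneg B]
  have hQ0 : 0 ≤ Q := by
    have : 0 < B := by linarith
    positivity
  have q1 : lam⁻¹ * (∑ i, ∑ j, (H i j - lam * p i * g j - lam * p j * g i +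
        (lam ^ 2 * p i * p j - lam * h i j) * U) ^ 2) ≤
      lam⁻¹ * (5 * (s - (∑ i, H i i) ^ 2)) + 20 * L ^ 2 + 90 * lam * B * a +
        50 * lam ^ 3 * B ^ 2 * U ^ 2 := by
    have : lam⁻¹ * (∑ i, ∑ j, (H i j - lam * p i * g j - lam * p j * g i +
        (lam ^ 2 * p i * p j - lam * h i j) * U) ^ 2) ≤ lam⁻¹ * (5 * (s - (∑ i, H i i) ^ 2) +
          20 * L ^ 2 + lam * (90 * lam * B * a + 50 * lam ^ 3 * B ^ 2 * U ^ 2)) := by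
      refine mul_le_mul_of_nonneg_left (c3.trans ?_) (by positivity)
      linarith only [c2]
    refine this.trans ?_
    have e : lam⁻¹ * (5 * (s - (∑ i, H i i) ^ 2) +
          20 * L ^ 2 + lam * (90 * lam * B * a + 50 * lam ^ 3 * B ^ 2 * U ^ 2)) =
        lam⁻¹ * (5 * (s - (∑ i, H i i) ^ 2)) + lam⁻¹ * (20 * L ^ 2) +
          (90 * lam * B * a + 50 * lam ^ 3 * B ^ 2 * U ^ 2) := by
      field_simp
    rw [e]
    have : lam⁻¹ * (20 * L ^ 2) ≤ 1 * (20 * L ^ 2) :=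
      mul_le_mul_of_nonneg_right (inv_le_one_of_one_le₀ hlam) (by positivity)
    linarith
  have q2 : Q * (2 * lam * m * a + 2 * lam ^ 3 * m ^ 2 * U ^ 2) ≤ Q * R :=
    mul_le_mul_of_nonneg_left c1 hQ0
  have q3 : Q * (-2 * (X * Y)) ≤ Q * L ^ 2 := by
    refine mul_le_mul_of_nonneg_left ?_ hQ0
    rw [hLXY, sub_sq]
    linarith only [sq_nonneg X, sq_nonneg Y]
  have q4 := mul_le_mul_of_nonneg_left hg hl0.le
  have q5 : lam * a * (92 * B) ≤ lam * a * (Q * (2 * m)) :=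
    mul_le_mul_of_nonneg_left hQ1 (by positivity)
  have q6 : lam ^ 3 * U ^ 2 * (53 * B ^ 2) ≤ lam ^ 3 * U ^ 2 * (Q * (2 * m ^ 2)) :=
    mul_le_mul_of_nonneg_left hQ2 (by positivity)
  have q7 : lam ^ 3 * U ^ 2 * (1 + 2 * B) ≤ lam ^ 3 * U ^ 2 * (3 * B ^ 2) :=
    mul_le_mul_of_nonneg_left (by nlinarith only [hB]) (by positivity)
  have q8 : lam * a * 2 ≤ lam * a * (2 * B) :=
    mul_le_mul_of_nonneg_left (by linarith) (by positivity)
  linarith only [q1, q2, q3, q4, q5, q6, q7, q8]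

end PointwiseCarleman

/-! ### The Carleman estimate for smooth functions -/

section SmoothCarleman

open Finset

variable {d : ℕ}

/-- The hypotheses on a Carleman weight function `φ` at the points of `W`: it is uniformly convex,
has a gradient bounded away from zero, and derivatives up to third order bounded. -/
structure IsConvexWeight (φ : Pt d → ℝ) (W : Set (Pt d)) (m B : ℝ) : Prop where
  smooth : ContDiff ℝ ∞ φ
  pos : 0 < m
  one_le : 1 ≤ B
  convex : ∀ x ∈ W, ∀ ξ : Fin d → ℝ,
    m * ∑ i, ξ i ^ 2 ≤ ∑ i, ∑ j, pderiv i (pderiv j φ) x * ξ i * ξ j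
  grad_lower : ∀ x ∈ W, m ≤ ∑ i, pderiv i φ x ^ 2
  grad_upper : ∀ x ∈ W, ∑ i, pderiv i φ x ^ 2 ≤ B
  lap_upper : ∀ x ∈ W, (∑ i, pderiv i (pderiv i φ) x) ^ 2 ≤ B
  hess_upper : ∀ x ∈ W, ∑ i, ∑ j, pderiv i (pderiv j φ) x ^ 2 ≤ B
  third_upper : ∀ x ∈ W, ∑ i, (∑ j, pderiv i (pderiv j (pderiv j φ)) x) ^ 2 ≤ B

theorem exp_mul_pderiv {φ v : Pt d → ℝ} (hφ : ContDiff ℝ ∞ φ) (hv : ContDiff ℝ ∞ v) (lam : ℝ)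
    (i : Fin d) (x : Pt d) :
    pderiv i (fun y => Real.exp (lam * φ y) * v y) x =
      Real.exp (lam * φ x) * (pderiv i v x + lam * pderiv i φ x * v x) := by
  rw [pderiv_mul_apply _ (by fun_prop) hv, pderiv_exp_apply _ (by fun_prop),
    pderiv_const_mul_apply _ _ hφ]
  ring

theorem exp_mul_pderiv_pderiv {φ v : Pt d → ℝ} (hφ : ContDiff ℝ ∞ φ) (hv : ContDiff ℝ ∞ v)
    (lam : ℝ) (i j : Fin d) (x : Pt d) :
    pderiv i (pderiv j (fun y => Real.exp (lam * φ y) * v y)) x =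
      Real.exp (lam * φ x) * (pderiv i (pderiv j v) x + lam * pderiv i φ x * pderiv j v x +
        lam * pderiv j φ x * pderiv i v x +
        (lam ^ 2 * pderiv i φ x * pderiv j φ x + lam * pderiv i (pderiv j φ) x) * v x) := by
  have e : pderiv j (fun y => Real.exp (lam * φ y) * v y) = fun y => Real.exp (lam * φ y) *
      (pderiv j v y + lam * (pderiv j φ y * v y)) := by
    funext y
    rw [exp_mul_pderiv hφ hv]
    ring
  have h1 := hφ.pderiv j
  have h2 := hv.pderiv j
  rw [e, exp_mul_pderiv hφ (by fun_prop), pderiv_add_apply _ h2 (by fun_prop),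
    pderiv_const_mul_apply _ _ (by fun_prop), pderiv_mul_apply _ h1 hv]
  ring

/-- The Carleman estimate for smooth functions whose support is a compact subset of `W`. -/
theorem IsConvexWeight.carleman_smooth {φ : Pt d → ℝ} {W : Set (Pt d)} {m B : ℝ}
    (hw : IsConvexWeight φ W m B) {lam : ℝ} (hlam : 1 ≤ lam) (hlB : B ≤ 4 * m ^ 3 * lam ^ 2)
    {v : Pt d → ℝ} (hv : ContDiff ℝ ∞ v) (hc : HasCompactSupport v) (hs : tsupport v ⊆ W) :
    ∫ x, Real.exp (2 * lam * φ x) * (lam⁻¹ * ∑ i, ∑ j, (pderiv i (pderiv j v) x) ^ 2 +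
        lam ^ 3 * v x ^ 2 + lam * ∑ i, (pderiv i v x) ^ 2) ≤
      (20 + (46 * B / m + 27 * B ^ 2 / m ^ 2)) *
        ∫ x, Real.exp (2 * lam * φ x) * (∑ i, pderiv i (pderiv i v) x) ^ 2 := by
  set Q := 46 * B / m + 27 * B ^ 2 / m ^ 2 with hQ
  have hφ := hw.smooth
  set u : Pt d → ℝ := fun y => Real.exp (lam * φ y) * v y with hu
  have hus : ContDiff ℝ ∞ u := by fun_prop
  have huc : HasCompactSupport u := HasCompactSupport.mul_left hc
  have s1 : ∀ i, ContDiff ℝ ∞ (pderiv i u) := fun i => hus.pderiv i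
  have s2 : ∀ i j, ContDiff ℝ ∞ (pderiv i (pderiv j u)) := fun i j => (s1 j).pderiv i
  have p1 : ∀ i, ContDiff ℝ ∞ (pderiv i φ) := fun i => hφ.pderiv i
  have p2 : ∀ i j, ContDiff ℝ ∞ (pderiv i (pderiv j φ)) := fun i j => (p1 j).pderiv i
  have p3 : ∀ i j k, ContDiff ℝ ∞ (pderiv i (pderiv j (pderiv k φ))) :=
    fun i j k => (p2 j k).pderiv i
  have v1 : ∀ i, ContDiff ℝ ∞ (pderiv i v) := fun i => hv.pderiv i
  have v2 : ∀ i j, ContDiff ℝ ∞ (pderiv i (pderiv j v)) := fun i j => (v1 j).pderiv i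
  have cpt1 : ∀ i, HasCompactSupport (pderiv i u) := fun i => pderiv_hasCompactSupport huc
  have cpt2 : ∀ i j, HasCompactSupport (pderiv i (pderiv j u)) :=
    fun i j => pderiv_hasCompactSupport (cpt1 j)
  -- the two families of divergences
  set D : Fin d → Fin d → Pt d → ℝ := fun i j x =>
    -2 * ((pderiv i (pderiv i u) x + lam ^ 2 * (pderiv i φ x) ^ 2 * u x) *
        (2 * lam * pderiv j φ x * pderiv j u x + lam * pderiv j (pderiv j φ) x * u x)) -
      (4 * lam * (pderiv i (pderiv j φ) x * pderiv i u x * pderiv j u x) +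
        2 * lam * (pderiv i (pderiv j (pderiv j φ)) x * u x * pderiv i u x) +
        4 * lam ^ 3 * (pderiv i (pderiv j φ) x * pderiv i φ x * pderiv j φ x) * u x ^ 2) with hD
  set E : Fin d → Fin d → Pt d → ℝ := fun i j x =>
    (pderiv i (pderiv j u) x) ^ 2 - pderiv i (pderiv i u) x * pderiv j (pderiv j u) x with hE
  -- all integrands are continuous and vanish off the compact set `tsupport v`
  have hcont : ∀ {g : Pt d → ℝ}, Continuous g → (∀ x ∉ tsupport v, g x = 0) → Integrable g := by
    intro g hg h0
    exact hg.integrable_of_hasCompactSupport (HasCompactSupport.intro hc h0)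
  have z0 : ∀ x ∉ tsupport v, v x = 0 := fun x hx => image_eq_zero_of_notMem_tsupport hx
  have tsub : ∀ {f : Pt d → ℝ} (i : Fin d), tsupport (pderiv i f) ⊆ tsupport f :=
    fun {f} i => tsupport_fderiv_apply_subset ℝ _
  have z1 : ∀ i, ∀ x ∉ tsupport v, pderiv i v x = 0 := fun i x hx =>
    image_eq_zero_of_notMem_tsupport fun h => hx (tsub i h)
  have z2 : ∀ i j, ∀ x ∉ tsupport v, pderiv i (pderiv j v) x = 0 := fun i j x hx =>
    image_eq_zero_of_notMem_tsupport fun h => hx (tsub j (tsub i h))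
  have zu0 : ∀ x ∉ tsupport v, u x = 0 := fun x hx => by simp [hu, z0 x hx]
  have zu1 : ∀ i, ∀ x ∉ tsupport v, pderiv i u x = 0 := fun i x hx => by
    rw [hu, exp_mul_pderiv hφ hv]
    simp [z0 x hx, z1 i x hx]
  have zu2 : ∀ i j, ∀ x ∉ tsupport v, pderiv i (pderiv j u) x = 0 := fun i j x hx => by
    rw [hu, exp_mul_pderiv_pderiv hφ hv]
    simp [z0 x hx, z1 i x hx, z1 j x hx, z2 i j x hx]
  have zD : ∀ i j, ∀ x ∉ tsupport v, D i j x = 0 := fun i j x hx => by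
    simp [hD, zu0 x hx, zu1 _ x hx]
  have zE : ∀ i j, ∀ x ∉ tsupport v, E i j x = 0 := fun i j x hx => by
    simp [hE, zu2 _ _ x hx]
  have contu := hus.continuous
  have contu1 : ∀ i, Continuous (pderiv i u) := fun i => (s1 i).continuous
  have contu2 : ∀ i j, Continuous (pderiv i (pderiv j u)) := fun i j => (s2 i j).continuous
  have contφ := hφ.continuous
  have contφ1 : ∀ i, Continuous (pderiv i φ) := fun i => (p1 i).continuous
  have contφ2 : ∀ i j, Continuous (pderiv i (pderiv j φ)) := fun i j => (p2 i j).continuous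
  have contφ3 : ∀ i j k, Continuous (pderiv i (pderiv j (pderiv k φ))) :=
    fun i j k => (p3 i j k).continuous
  have contv := hv.continuous
  have contv1 : ∀ i, Continuous (pderiv i v) := fun i => (v1 i).continuous
  have contv2 : ∀ i j, Continuous (pderiv i (pderiv j v)) := fun i j => (v2 i j).continuous
  have iD : ∀ i j, Integrable (D i j) := fun i j => hcont (by simp only [hD]; fun_prop) (zD i j)
  have iE : ∀ i j, Integrable (E i j) := fun i j => hcont (by simp only [hE]; fun_prop) (zE i j)
  have ID : ∫ x, ∑ i, ∑ j, D i j x = 0 := by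
    rw [integral_finsetSum _ fun i _ => integrable_finsetSum _ fun j _ => iD i j]
    refine sum_eq_zero fun i _ => ?_
    rw [integral_finsetSum _ fun j _ => iD i j]
    exact sum_eq_zero fun j _ => carleman_multiplier_identity hus huc hφ lam i j
  have IE : ∫ x, ∑ i, ∑ j, E i j x = 0 := by
    rw [integral_finsetSum _ fun i _ => integrable_finsetSum _ fun j _ => iE i j]
    refine sum_eq_zero fun i _ => ?_
    rw [integral_finsetSum _ fun j _ => iE i j]
    exact sum_eq_zero fun j _ => integral_hessian_null_lagrangian hus huc i j
  have sD : Integrable fun x => ∑ i, ∑ j, D i j x :=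
    integrable_finsetSum _ fun i _ => integrable_finsetSum _ fun j _ => iD i j
  have sE : Integrable fun x => ∑ i, ∑ j, E i j x :=
    integrable_finsetSum _ fun i _ => integrable_finsetSum _ fun j _ => iE i j
  have sL : Integrable fun x => Real.exp (2 * lam * φ x) * (∑ i, pderiv i (pderiv i v) x) ^ 2 :=
    hcont (by fun_prop) fun x hx => by simp [z2 _ _ x hx]
  have sR : Integrable fun x => Real.exp (2 * lam * φ x) *
      (lam⁻¹ * ∑ i, ∑ j, (pderiv i (pderiv j v) x) ^ 2 +
        lam ^ 3 * v x ^ 2 + lam * ∑ i, (pderiv i v x) ^ 2) :=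
    hcont (by fun_prop) fun x hx => by simp [z2 _ _ x hx, z1 _ x hx, z0 x hx]
  have e : ∫ x, ((20 + Q) * (Real.exp (2 * lam * φ x) * (∑ i, pderiv i (pderiv i v) x) ^ 2) -
      Q * ∑ i, ∑ j, D i j x + 5 * lam⁻¹ * ∑ i, ∑ j, E i j x) =
      (20 + Q) * ∫ x, Real.exp (2 * lam * φ x) * (∑ i, pderiv i (pderiv i v) x) ^ 2 := by
    have sLD : Integrable fun x => (20 + Q) * (Real.exp (2 * lam * φ x) *
        (∑ i, pderiv i (pderiv i v) x) ^ 2) - Q * ∑ i, ∑ j, D i j x :=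
      (sL.const_mul _).sub (sD.const_mul _)
    rw [integral_add sLD (sE.const_mul _),
      integral_sub (sL.const_mul _) (sD.const_mul _), integral_const_mul, integral_const_mul,
      integral_const_mul, ID, IE]
    ring
  rw [← e]
  refine integral_mono sR (((sL.const_mul _).sub (sD.const_mul _)).add (sE.const_mul _)) ?_
  intro x
  by_cases hx : x ∈ tsupport v
  swap
  · simp [z2 _ _ x hx, z1 _ x hx, z0 x hx, zD _ _ x hx, zE _ _ x hx]
  have hxW := hs hx
  have key := pointwise_carleman (p := fun i => pderiv i φ x) (g := fun i => pderiv i u x)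
    (h := fun i j => pderiv i (pderiv j φ) x) (H := fun i j => pderiv i (pderiv j u) x)
    (τ := fun i j => pderiv i (pderiv j (pderiv j φ)) x) (U := u x) hw.pos hw.one_le hlam hlB
    (hw.convex x hxW) (hw.grad_lower x hxW) (hw.third_upper x hxW) (hw.grad_upper x hxW)
    (hw.lap_upper x hxW) (hw.hess_upper x hxW)
  have hexp : Real.exp (2 * lam * φ x) = Real.exp (lam * φ x) ^ 2 := by
    rw [← Real.exp_nat_mul]
    congr 1
    push_cast
    ring
  have k0 : u x = Real.exp (lam * φ x) * v x := rfl
  have k1 : ∀ i, pderiv i u x - lam * pderiv i φ x * u x =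
      Real.exp (lam * φ x) * pderiv i v x := fun i => by
    rw [hu, exp_mul_pderiv hφ hv]
    ring
  have k2 : ∀ i j, pderiv i (pderiv j u) x - lam * pderiv i φ x * pderiv j u x -
      lam * pderiv j φ x * pderiv i u x + (lam ^ 2 * pderiv i φ x * pderiv j φ x -
        lam * pderiv i (pderiv j φ) x) * u x =
      Real.exp (lam * φ x) * pderiv i (pderiv j v) x := fun i j => by
    rw [hu, exp_mul_pderiv hφ hv, exp_mul_pderiv hφ hv, exp_mul_pderiv_pderiv hφ hv]
    ring
  have k3 : ∀ i, pderiv i (pderiv i u) x - 2 * lam * pderiv i φ x * pderiv i u x +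
      (lam ^ 2 * (pderiv i φ x) ^ 2 - lam * pderiv i (pderiv i φ) x) * u x =
      Real.exp (lam * φ x) * pderiv i (pderiv i v) x := fun i => by
    rw [← k2 i i]
    ring
  simp only [k1, k2, k3, mul_pow, ← mul_sum] at key
  rw [k0] at key
  simp only [hexp]
  refine le_trans (le_of_eq ?_) (key.trans (le_of_eq ?_))
  · ring
  · simp only [hD, hE, hu, hQ]

end SmoothCarleman

/-! ### The radial weight -/

section RadialWeight

open Finset

variable {d : ℕ}

theorem pderiv_congr {f g : Pt d → ℝ} {x : Pt d} (i : Fin d) (h : f =ᶠ[𝓝 x] g) :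
    pderiv i f x = pderiv i g x := by
  simp [pderiv, h.fderiv_eq]

/-- The power `|x - x₀|^{2s}`, modified for `|x - x₀|² < 1/2` so as to be smooth everywhere. -/
noncomputable def radialPow (x₀ : Pt d) (s : ℝ) (x : Pt d) : ℝ :=
  (‖x - x₀‖ ^ 2 + (1 - Real.smoothTransition (2 * ‖x - x₀‖ ^ 2))) ^ s

theorem radialPow_base_pos (x₀ x : Pt d) :
    0 < ‖x - x₀‖ ^ 2 + (1 - Real.smoothTransition (2 * ‖x - x₀‖ ^ 2)) := by
  have h1 := Real.smoothTransition.le_one (2 * ‖x - x₀‖ ^ 2)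
  rcases eq_or_ne x x₀ with rfl | h
  · simp
  · have : 0 < ‖x - x₀‖ := norm_pos_iff.2 (sub_ne_zero.2 h)
    nlinarith [pow_pos this 2]

theorem contDiff_radialPow (x₀ : Pt d) (s : ℝ) : ContDiff ℝ ∞ (radialPow x₀ s) := by
  have h1 : ContDiff ℝ ∞ fun x : Pt d => ‖x - x₀‖ ^ 2 :=
    (contDiff_id.sub contDiff_const).norm_sq ℝ
  have h2 : ContDiff ℝ ∞ fun x : Pt d => Real.smoothTransition (2 * ‖x - x₀‖ ^ 2) :=
    Real.smoothTransition.contDiff.comp (contDiff_const.mul h1)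
  exact (h1.add (contDiff_const.sub h2)).rpow_const_of_ne fun x => (radialPow_base_pos x₀ x).ne'

theorem radialPow_eq {x₀ x : Pt d} (s : ℝ) (hx : 1 / 2 < ‖x - x₀‖ ^ 2) :
    radialPow x₀ s x = (‖x - x₀‖ ^ 2) ^ s := by
  rw [radialPow, Real.smoothTransition.one_of_one_le (by linarith)]
  simp

theorem isOpen_radial_region (x₀ : Pt d) : IsOpen {x : Pt d | 1 / 2 < ‖x - x₀‖ ^ 2} :=
  isOpen_lt continuous_const (by fun_prop)

theorem pderiv_radialPow {x₀ x : Pt d} (s : ℝ) (hx : 1 / 2 < ‖x - x₀‖ ^ 2) (i : Fin d) :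
    pderiv i (radialPow x₀ s) x = 2 * s * radialPow x₀ (s - 1) x * (x i - x₀ i) := by
  have ev : radialPow x₀ s =ᶠ[𝓝 x] fun y => (‖y - x₀‖ ^ 2) ^ s := by
    filter_upwards [(isOpen_radial_region x₀).mem_nhds hx] with y hy using radialPow_eq s hy
  rw [pderiv_congr i ev, radialPow_eq _ hx]
  have h1 : HasFDerivAt (fun y : Pt d => ‖y - x₀‖ ^ 2) _ x :=
    ((hasFDerivAt_id x).sub_const x₀).norm_sq
  have h2 := h1.rpow_const (p := s) (Or.inl (by linarith : (0 : ℝ) < ‖x - x₀‖ ^ 2).ne')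
  rw [pderiv, h2.fderiv]
  simp [EuclideanSpace.inner_single_right]
  ring

theorem pderiv_coord_sub (x₀ x : Pt d) (i j : Fin d) :
    pderiv i (fun y : Pt d => y j - x₀ j) x = if i = j then 1 else 0 := by
  have : HasFDerivAt (fun y : Pt d => y j - x₀ j) (EuclideanSpace.proj j : Pt d →L[ℝ] ℝ) x :=
    (EuclideanSpace.proj j : Pt d →L[ℝ] ℝ).hasFDerivAt.sub_const _
  rw [pderiv, this.fderiv]
  simp [eq_comm]

/-- The weight function `b^{-β} |x - x₀|^β`, smooth also near `x₀`. -/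
noncomputable def radialWeight (x₀ : Pt d) (b β : ℝ) (x : Pt d) : ℝ :=
  b ^ (-β) * radialPow x₀ (β / 2) x

theorem contDiff_radialWeight (x₀ : Pt d) (b β : ℝ) : ContDiff ℝ ∞ (radialWeight x₀ b β) :=
  contDiff_const.mul (contDiff_radialPow x₀ _)

theorem radialWeight_eq {x₀ x : Pt d} (b β : ℝ) (hx : 1 / 2 < ‖x - x₀‖ ^ 2) :
    radialWeight x₀ b β x = b ^ (-β) * dist x x₀ ^ β := by
  rw [radialWeight, radialPow_eq _ hx, dist_eq_norm, ← Real.rpow_natCast,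
    ← Real.rpow_mul (norm_nonneg _)]
  congr 2
  push_cast
  ring

theorem pderiv_radialWeight {x₀ x : Pt d} (b β : ℝ) (hx : 1 / 2 < ‖x - x₀‖ ^ 2) (i : Fin d) :
    pderiv i (radialWeight x₀ b β) x =
      b ^ (-β) * β * (radialPow x₀ (β / 2 - 1) x * (x i - x₀ i)) := by
  unfold radialWeight
  rw [pderiv_const_mul_apply _ _ (contDiff_radialPow x₀ _), pderiv_radialPow _ hx]
  ring

theorem pderiv_pderiv_radialWeight {x₀ x : Pt d} (b β : ℝ) (hx : 1 / 2 < ‖x - x₀‖ ^ 2)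
    (i j : Fin d) : pderiv i (pderiv j (radialWeight x₀ b β)) x =
      b ^ (-β) * β * ((β - 2) * radialPow x₀ (β / 2 - 2) x * (x i - x₀ i) * (x j - x₀ j) +
        radialPow x₀ (β / 2 - 1) x * if i = j then 1 else 0) := by
  have ev : pderiv j (radialWeight x₀ b β) =ᶠ[𝓝 x]
      fun y => b ^ (-β) * β * (radialPow x₀ (β / 2 - 1) y * (y j - x₀ j)) := by
    filter_upwards [(isOpen_radial_region x₀).mem_nhds hx] with y hy
    exact pderiv_radialWeight b β hy j
  have c1 := contDiff_radialPow x₀ (β / 2 - 1)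
  have c2 : ContDiff ℝ ∞ fun y : Pt d => y j - x₀ j := by fun_prop
  rw [pderiv_congr i ev, pderiv_const_mul_apply _ _ (c1.mul c2), pderiv_mul_apply _ c1 c2,
    pderiv_radialPow _ hx, pderiv_coord_sub]
  ring_nf

/-- For `β ≥ 2` the Hessian of `r^β` is bounded below by `β r^{β-2}`, so `r^β` is uniformly convex
away from `x₀`. -/
theorem exists_isConvexWeight_radialWeight (x₀ : Pt d) {b β : ℝ} (hb : 0 < b) (hβ : 2 ≤ β)
    (R : ℝ) : ∃ m B, IsConvexWeight (radialWeight x₀ b β)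
      ({x | 1 / 2 < ‖x - x₀‖ ^ 2} ∩ Metric.ball x₀ R) m B := by
  have hφ := contDiff_radialWeight x₀ b β
  have p1 : ∀ i, ContDiff ℝ ∞ (pderiv i (radialWeight x₀ b β)) := fun i => hφ.pderiv i
  have p2 : ∀ i j, ContDiff ℝ ∞ (pderiv i (pderiv j (radialWeight x₀ b β))) :=
    fun i j => (p1 j).pderiv i
  have c1 : ∀ i, Continuous (pderiv i (radialWeight x₀ b β)) := fun i => (p1 i).continuous
  have c2 : ∀ i j, Continuous (pderiv i (pderiv j (radialWeight x₀ b β))) :=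
    fun i j => (p2 i j).continuous
  have c3 : ∀ i j k, Continuous (pderiv i (pderiv j (pderiv k (radialWeight x₀ b β)))) :=
    fun i j k => ((p2 j k).pderiv i).continuous
  have bdd : ∀ {g : Pt d → ℝ}, Continuous g → ∃ C, ∀ x ∈ Metric.ball x₀ R, g x ≤ C := by
    intro g hg
    obtain ⟨C, hC⟩ := (isCompact_closedBall x₀ R).exists_bound_of_continuousOn hg.continuousOn
    exact ⟨C, fun x hx => (le_abs_self _).trans (hC x (Metric.ball_subset_closedBall hx))⟩
  obtain ⟨B1, h1⟩ := bdd (g := fun x => ∑ i, pderiv i (radialWeight x₀ b β) x ^ 2) (by fun_prop)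
  obtain ⟨B2, h2⟩ := bdd (g := fun x => (∑ i, pderiv i (pderiv i (radialWeight x₀ b β)) x) ^ 2)
    (by fun_prop)
  obtain ⟨B3, h3⟩ := bdd
    (g := fun x => ∑ i, ∑ j, pderiv i (pderiv j (radialWeight x₀ b β)) x ^ 2) (by fun_prop)
  obtain ⟨B4, h4⟩ := bdd (g := fun x => ∑ i, (∑ j,
    pderiv i (pderiv j (pderiv j (radialWeight x₀ b β))) x) ^ 2) (by fun_prop)
  set κ : ℝ := b ^ (-β) * β with hκ
  set a : ℝ := (1 / 2 : ℝ) ^ (β / 2 - 1) with ha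
  have hκ0 : 0 < κ := by positivity
  have ha0 : 0 < a := by positivity
  have low : ∀ x : Pt d, 1 / 2 < ‖x - x₀‖ ^ 2 → a ≤ radialPow x₀ (β / 2 - 1) x := by
    intro x hx
    rw [radialPow_eq _ hx]
    exact Real.rpow_le_rpow (by norm_num) hx.le (by linarith)
  have nrm : ∀ x : Pt d, ∑ i, (x i - x₀ i) ^ 2 = ‖x - x₀‖ ^ 2 := by
    intro x
    rw [EuclideanSpace.norm_sq_eq]
    simp
  refine ⟨min (κ * a) (κ ^ 2 * a ^ 2 / 2), max 1 (max B1 (max B2 (max B3 B4))), hφ,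
    by positivity, le_max_left _ _, ?_, ?_, ?_, ?_, ?_, ?_⟩
  · rintro x ⟨hx, -⟩ ξ
    have e : ∑ i, ∑ j, pderiv i (pderiv j (radialWeight x₀ b β)) x * ξ i * ξ j =
        κ * ((β - 2) * radialPow x₀ (β / 2 - 2) x * (∑ i, (x i - x₀ i) * ξ i) ^ 2 +
          radialPow x₀ (β / 2 - 1) x * ∑ i, ξ i ^ 2) := by
      rw [sq (∑ i, (x i - x₀ i) * ξ i), sum_mul_sum, mul_add, mul_sum, mul_sum, mul_sum,
        mul_sum, ← sum_add_distrib]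
      refine sum_congr rfl fun i _ => ?_
      have : κ * (radialPow x₀ (β / 2 - 1) x * ξ i ^ 2) = ∑ j,
          κ * (radialPow x₀ (β / 2 - 1) x * (if i = j then 1 else 0) * ξ i * ξ j) := by
        simp only [mul_ite, ite_mul, mul_one, mul_zero, zero_mul, Finset.sum_ite_eq,
          Finset.mem_univ, if_true]
        ring
      rw [this, mul_sum, mul_sum, ← sum_add_distrib]
      refine sum_congr rfl fun j _ => ?_
      rw [pderiv_pderiv_radialWeight b β hx]
      ring
    rw [e]
    have s0 : 0 ≤ ∑ i, ξ i ^ 2 := sum_nonneg fun i _ => sq_nonneg _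
    have r0 : 0 ≤ radialPow x₀ (β / 2 - 2) x := Real.rpow_nonneg (radialPow_base_pos x₀ x).le _
    have b0 : 0 ≤ β - 2 := by linarith
    calc min (κ * a) (κ ^ 2 * a ^ 2 / 2) * ∑ i, ξ i ^ 2 ≤ κ * a * ∑ i, ξ i ^ 2 := by
          gcongr
          exact min_le_left _ _
      _ = κ * (0 + a * ∑ i, ξ i ^ 2) := by ring
      _ ≤ _ := by
          gcongr
          · positivity
          · exact low x hx
  · rintro x ⟨hx, -⟩
    have e : ∑ i, pderiv i (radialWeight x₀ b β) x ^ 2 =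
        κ ^ 2 * radialPow x₀ (β / 2 - 1) x ^ 2 * ‖x - x₀‖ ^ 2 := by
      rw [← nrm, mul_sum]
      refine sum_congr rfl fun i _ => ?_
      rw [pderiv_radialWeight b β hx]
      ring
    rw [e]
    calc _ ≤ κ ^ 2 * a ^ 2 / 2 := min_le_right _ _
      _ = κ ^ 2 * a ^ 2 * (1 / 2) := by ring
      _ ≤ _ := by
          have := low x hx
          have hx' : 1 / 2 < ‖x - x₀‖ ^ 2 := hx
          gcongr
  · rintro x ⟨-, hx⟩
    exact (h1 x hx).trans (by simp)
  · rintro x ⟨-, hx⟩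
    exact (h2 x hx).trans (by simp)
  · rintro x ⟨-, hx⟩
    exact (h3 x hx).trans (by simp)
  · rintro x ⟨-, hx⟩
    exact (h4 x hx).trans (by simp)

end RadialWeight

/-! ### Functions with vanishing Cauchy data -/

section Traces

variable {d : ℕ} {Ω : Set (Pt d)}

namespace H2

theorem memLp_val (v : H2 Ω) : MemLp v.val 2 (volume.restrict Ω) := v.2.1

theorem memLp_grad (v : H2 Ω) (i : Fin d) : MemLp (v.grad i) 2 (volume.restrict Ω) :=
  (v.2.2.1 i).1

theorem memLp_hess (v : H2 Ω) (i j : Fin d) : MemLp (v.hess i j) 2 (volume.restrict Ω) :=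
  (v.2.2.2 i j).1

theorem isWeakPartial_val (v : H2 Ω) (i : Fin d) : IsWeakPartial Ω i v.val (v.grad i) :=
  (v.2.2.1 i).2

theorem isWeakPartial_grad (v : H2 Ω) (i j : Fin d) : IsWeakPartial Ω j (v.grad i) (v.hess i j) :=
  (v.2.2.2 i j).2

end H2

theorem gradient_apply (ρ : Pt d → ℝ) (x : Pt d) (i : Fin d) :
    gradient ρ x i = pderiv i ρ x := by
  have := inner_gradient_left (𝕜 := ℝ) (f := ρ) (x := x) (y := EuclideanSpace.single i (1 : ℝ))
  rw [pderiv, ← this, EuclideanSpace.inner_single_right]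
  simp

theorem outerNormal_eq (hΩ : IsSmoothBoundedDomain Ω) :
    ∃ ρ, IsDefiningFunction Ω ρ ∧ outerNormal Ω = fun x => ‖gradient ρ x‖⁻¹ • gradient ρ x := by
  refine ⟨hΩ.exists_defining.choose, hΩ.exists_defining.choose_spec, ?_⟩
  funext x
  rw [outerNormal, dif_pos hΩ.exists_defining]

theorem measurable_outerNormal (hΩ : IsSmoothBoundedDomain Ω) : Measurable (outerNormal Ω) := by
  obtain ⟨ρ, hρ, e⟩ := outerNormal_eq hΩ
  rw [e]
  have : Continuous (gradient ρ) :=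
    (InnerProductSpace.toDual ℝ (Pt d)).symm.continuous.comp (hρ.smooth.continuous_fderiv (by simp))
  exact this.norm.measurable.inv.smul this.measurable

theorem norm_outerNormal_le (Ω : Set (Pt d)) (x : Pt d) : ‖outerNormal Ω x‖ ≤ 1 := by
  unfold outerNormal
  split_ifs with h
  · rw [norm_smul, norm_inv, norm_norm]
    exact inv_mul_le_one
  · simp

theorem abs_outerNormal_apply_le (Ω : Set (Pt d)) (x : Pt d) (i : Fin d) :
    |outerNormal Ω x i| ≤ 1 :=
  (PiLp.norm_apply_le (outerNormal Ω x) i).trans (norm_outerNormal_le Ω x)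

theorem integrable_mul_outerNormal (hΩ : IsSmoothBoundedDomain Ω) {g φ : Pt d → ℝ}
    (hg : Integrable g (surfaceMeasure Ω)) (hφ : Continuous φ) (hc : HasCompactSupport φ)
    (i : Fin d) :
    Integrable (fun x => g x * φ x * outerNormal Ω x i) (surfaceMeasure Ω) := by
  obtain ⟨C, hC⟩ := hφ.bounded_above_of_compact_support hc
  have h1 : Integrable (fun x => g x * φ x) (surfaceMeasure Ω) :=
    hg.mul_bdd (c := C) hφ.aestronglyMeasurable (ae_of_all _ hC)
  have hm : Measurable fun x => outerNormal Ω x i :=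
    (EuclideanSpace.proj i : Pt d →L[ℝ] ℝ).continuous.measurable.comp (measurable_outerNormal hΩ)
  exact h1.mul_bdd (c := 1) hm.aestronglyMeasurable (ae_of_all _ fun x =>
    abs_outerNormal_apply_le Ω x i)

theorem integrable_trace_integrand {u Du φ : Pt d → ℝ} (hu : MemLp u 2 (volume.restrict Ω))
    (hD : MemLp Du 2 (volume.restrict Ω)) (hφ : ContDiff ℝ ∞ φ) (hc : HasCompactSupport φ)
    (i : Fin d) :
    Integrable (fun x => u x * pderiv i φ x + Du x * φ x) (volume.restrict Ω) :=
  (integrable_mul_test hu (pderiv_continuous hφ) (pderiv_hasCompactSupport hc)).add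
    (integrable_mul_test hD hφ.continuous hc)

theorem HasTrace.sub (hΩ : IsSmoothBoundedDomain Ω) {u u' : Pt d → ℝ} {Du Du' : Fin d → Pt d → ℝ}
    {g g' : Pt d → ℝ} (hu : MemLp u 2 (volume.restrict Ω)) (hu' : MemLp u' 2 (volume.restrict Ω))
    (hD : ∀ i, MemLp (Du i) 2 (volume.restrict Ω)) (hD' : ∀ i, MemLp (Du' i) 2 (volume.restrict Ω))
    (h : HasTrace Ω u Du g) (h' : HasTrace Ω u' Du' g') :
    HasTrace Ω (u - u') (Du - Du') (g - g') := by
  refine ⟨h.1.sub h'.1, fun φ h1 h2 i => ?_⟩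
  have e1 := h.2 φ h1 h2 i
  have e2 := h'.2 φ h1 h2 i
  have s1 := integral_sub (integrable_trace_integrand hu (hD i) h1 h2 i)
    (integrable_trace_integrand hu' (hD' i) h1 h2 i)
  have s2 := integral_sub (integrable_mul_outerNormal hΩ h.1 h1.continuous h2 i)
    (integrable_mul_outerNormal hΩ h'.1 h1.continuous h2 i)
  rw [e1, e2, ← s2] at s1
  convert s1 using 2
  · funext x
    simp only [Pi.sub_apply]
    ring
  · funext x
    simp only [Pi.sub_apply]
    ring

theorem HasBoundaryValue.sub (hΩ : IsSmoothBoundedDomain Ω) {v v' : H2 Ω} {g g' : Pt d → ℝ}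
    (h : HasBoundaryValue v g) (h' : HasBoundaryValue v' g') :
    HasBoundaryValue (v - v') (g - g') :=
  HasTrace.sub hΩ v.memLp_val v'.memLp_val v.memLp_grad v'.memLp_grad h h'

theorem HasNormalDerivative.sub (hΩ : IsSmoothBoundedDomain Ω) {v v' : H2 Ω} {q q' : Pt d → ℝ}
    (h : HasNormalDerivative v q) (h' : HasNormalDerivative v' q') :
    HasNormalDerivative (v - v') (q - q') := by
  obtain ⟨g, hg, hq⟩ := h
  obtain ⟨g', hg', hq'⟩ := h'
  refine ⟨fun i => g i - g' i, fun i => HasTrace.sub hΩ (v.memLp_grad i) (v'.memLp_grad i)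
    (v.memLp_hess i) (v'.memLp_hess i) (hg i) (hg' i), ?_⟩
  filter_upwards [hq, hq'] with x h1 h2
  simp [h1, h2, mul_sub]

/-- A smooth function that is the reciprocal of `q ≥ 0` wherever `q ≥ ε`. -/
theorem exists_smooth_reciprocal {q : Pt d → ℝ} (hq : ContDiff ℝ ∞ q) (h0 : ∀ x, 0 ≤ q x) {ε : ℝ}
    (hε : 0 < ε) : ∃ h : Pt d → ℝ, ContDiff ℝ ∞ h ∧ ∀ x, ε ≤ q x → q x * h x = 1 := by
  have hpos : ∀ x, q x + (1 - Real.smoothTransition (q x / ε)) ≠ 0 := by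
    intro x
    have h1 := Real.smoothTransition.le_one (q x / ε)
    rcases lt_or_ge (q x) ε with h | h
    · have : q x / ε < 1 := (div_lt_one hε).2 h
      have := Real.smoothTransition.lt_one_of_lt_one this
      linarith [h0 x]
    · linarith
  refine ⟨fun x => (q x + (1 - Real.smoothTransition (q x / ε)))⁻¹, ?_, ?_⟩
  · exact (hq.add (contDiff_const.sub
      (Real.smoothTransition.contDiff.comp (hq.div_const ε)))).inv hpos
  · intro x hx
    dsimp only
    rw [Real.smoothTransition.one_of_one_le ((one_le_div hε).2 hx)]
    simp only [sub_self, add_zero]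
    exact mul_inv_cancel₀ (by linarith)

/-- Second weak derivatives commute. -/
theorem H2.hess_symm (hΩ : IsOpen Ω) (hb : Bornology.IsBounded Ω) (v : H2 Ω) (i j : Fin d) :
    ∀ᵐ x ∂volume.restrict Ω, v.hess i j x = v.hess j i x := by
  have : IsFiniteMeasure (volume.restrict Ω) :=
    ⟨by rw [Measure.restrict_apply_univ]; exact hb.measure_lt_top⟩
  have hi : ∀ i j, IntegrableOn (v.hess i j) Ω := fun i j =>
    (v.memLp_hess i j).integrable (by norm_num)
  have key := hΩ.ae_eq_zero_of_integral_contDiff_smul_eq_zero (μ := volume)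
    (f := fun x => v.hess i j x - v.hess j i x) ((hi i j).sub (hi j i)).locallyIntegrableOn ?_
  · rw [ae_restrict_iff' hΩ.measurableSet]
    filter_upwards [key] with x hx hxΩ using sub_eq_zero.1 (hx hxΩ)
  intro φ h1 h2 h3
  have t : ∀ i j, ∫ x in Ω, v.hess i j x * φ x = ∫ x in Ω, v.val x * pderiv i (pderiv j φ) x := by
    intro i j
    have e1 := v.isWeakPartial_grad i j φ h1 h2 h3
    have e2 := v.isWeakPartial_val i (pderiv j φ) (h1.pderiv j) (pderiv_hasCompactSupport h2)
      ((tsupport_fderiv_apply_subset ℝ _).trans h3)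
    linarith
  have hz : ∀ x ∉ Ω, φ x • (v.hess i j x - v.hess j i x) = 0 := by
    intro x hx
    rw [image_eq_zero_of_notMem_tsupport fun h => hx (h3 h), zero_smul]
  rw [← setIntegral_eq_integral_of_forall_compl_eq_zero hz]
  have e : ∀ x, φ x • (v.hess i j x - v.hess j i x) = v.hess i j x * φ x - v.hess j i x * φ x := by
    intro x
    simp only [smul_eq_mul]
    ring
  simp only [e]
  rw [integral_sub (integrable_mul_test (v.memLp_hess i j) h1.continuous h2)
    (integrable_mul_test (v.memLp_hess j i) h1.continuous h2), t i j, t j i, pderiv_comm h1 i j,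
    sub_self]

/-- A function with zero trace, extended by zero, has its weak gradient extended by zero: the
integration by parts formula holds for test functions that do not vanish on the boundary. -/
theorem integral_val_mul_pderiv_of_zero_trace {v : H2 Ω} (h : HasBoundaryValue v 0)
    {φ : Pt d → ℝ} (h1 : ContDiff ℝ ∞ φ) (h2 : HasCompactSupport φ) (i : Fin d) :
    ∫ x in Ω, v.val x * pderiv i φ x = -∫ x in Ω, v.grad i x * φ x := by
  have e := h.2 φ h1 h2 i
  rw [integral_add (integrable_mul_test v.memLp_val (pderiv_continuous h1)
    (pderiv_hasCompactSupport h2)) (integrable_mul_test (v.memLp_grad i) h1.continuous h2)] at e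
  simp only [Pi.zero_apply, zero_mul, integral_zero] at e
  linarith

/-- If `v` and `∂_ν v` vanish on `∂Ω`, then so do the traces of all `∂_i v`. The traces `g_i` of
`∂_i v` satisfy `g_i ν_j = g_j ν_i`, because the Hessian is symmetric and `v` has zero trace; so
the vector `g` is normal to the boundary, and its normal component is zero. -/
theorem integral_grad_mul_pderiv_of_zero_trace (hΩ : IsSmoothBoundedDomain Ω) {v : H2 Ω}
    (h : HasBoundaryValue v 0) (h' : HasNormalDerivative v 0) {φ : Pt d → ℝ}
    (h1 : ContDiff ℝ ∞ φ) (h2 : HasCompactSupport φ) (i j : Fin d) :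
    ∫ x in Ω, v.grad i x * pderiv j φ x = -∫ x in Ω, v.hess i j x * φ x := by
  obtain ⟨g, hg, hq⟩ := h'
  have split : ∀ {ψ : Pt d → ℝ}, ContDiff ℝ ∞ ψ → HasCompactSupport ψ → ∀ i j,
      (∫ x in Ω, v.grad i x * pderiv j ψ x) + ∫ x in Ω, v.hess i j x * ψ x =
        ∫ x, g i x * ψ x * outerNormal Ω x j ∂surfaceMeasure Ω := by
    intro ψ p1 p2 i j
    rw [← (hg i).2 ψ p1 p2 j, integral_add (integrable_mul_test (v.memLp_grad i)
      (pderiv_continuous p1) (pderiv_hasCompactSupport p2))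
      (integrable_mul_test (v.memLp_hess i j) p1.continuous p2)]
  have symm : ∀ {ψ : Pt d → ℝ}, ContDiff ℝ ∞ ψ → HasCompactSupport ψ → ∀ i j,
      ∫ x, g i x * ψ x * outerNormal Ω x j ∂surfaceMeasure Ω =
        ∫ x, g j x * ψ x * outerNormal Ω x i ∂surfaceMeasure Ω := by
    intro ψ p1 p2 i j
    rw [← split p1 p2 i j, ← split p1 p2 j i]
    have a1 := integral_val_mul_pderiv_of_zero_trace h (p1.pderiv j)
      (pderiv_hasCompactSupport p2) i
    have a2 := integral_val_mul_pderiv_of_zero_trace h (p1.pderiv i)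
      (pderiv_hasCompactSupport p2) j
    rw [pderiv_comm p1 i j] at a1
    have a3 : ∫ x in Ω, v.hess i j x * ψ x = ∫ x in Ω, v.hess j i x * ψ x := by
      refine integral_congr_ae ?_
      filter_upwards [v.hess_symm hΩ.isOpen hΩ.isBounded i j] with x hx
      rw [hx]
    linarith
  suffices hs : ∫ x, g i x * φ x * outerNormal Ω x j ∂surfaceMeasure Ω = 0 by
    have := split h1 h2 i j
    linarith
  obtain ⟨ρ, hρ, hν⟩ := outerNormal_eq hΩ
  have n1 : ∀ k, ContDiff ℝ ∞ (pderiv k ρ) := fun k => hρ.smooth.pderiv k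
  have hfr : IsCompact (frontier Ω) :=
    hΩ.isBounded.isCompact_closure.of_isClosed_subset isClosed_frontier frontier_subset_closure
  set q : Pt d → ℝ := fun x => ∑ k, pderiv k ρ x ^ 2 with hqdef
  have hqs : ContDiff ℝ ∞ q := by fun_prop
  have hq0 : ∀ x, 0 ≤ q x := fun x => Finset.sum_nonneg fun k _ => sq_nonneg _
  have hqn : ∀ x, q x = ‖gradient ρ x‖ ^ 2 := by
    intro x
    rw [EuclideanSpace.norm_sq_eq]
    simp [hqdef, gradient_apply]
  have hqpos : ∀ x ∈ frontier Ω, 0 < q x := by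
    intro x hx
    rw [hqn]
    have := norm_pos_iff.2 (hρ.gradient_ne_zero x hx)
    positivity
  obtain ⟨ε, hε, hεq⟩ := hfr.exists_forall_le' hqs.continuous.continuousOn hqpos
  obtain ⟨r, hr, hqr⟩ := exists_smooth_reciprocal hqs hq0 hε
  -- `ν` is parallel to `∇ρ`, so the components may be interchanged between the two vectors
  have hpar : ∀ x k l, pderiv k ρ x * outerNormal Ω x l = pderiv l ρ x * outerNormal Ω x k := by
    intro x k l
    simp only [hν, PiLp.smul_apply, smul_eq_mul, gradient_apply]
    ring
  have hfrae : ∀ᵐ x ∂surfaceMeasure Ω, x ∈ frontier Ω :=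
    ae_restrict_mem isClosed_frontier.measurableSet
  have t1 : ∀ k, ContDiff ℝ ∞ fun x => φ x * (pderiv k ρ x * pderiv j ρ x * r x) := by
    intro k
    fun_prop
  have t2 : ∀ k, HasCompactSupport fun x => φ x * (pderiv k ρ x * pderiv j ρ x * r x) :=
    fun k => HasCompactSupport.mul_right h2
  calc ∫ x, g i x * φ x * outerNormal Ω x j ∂surfaceMeasure Ω
      = ∫ x, ∑ k, g i x * (φ x * (pderiv k ρ x * pderiv j ρ x * r x)) * outerNormal Ω x k
          ∂surfaceMeasure Ω := by
        refine integral_congr_ae ?_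
        filter_upwards [hfrae] with x hx
        have e : ∀ k, g i x * (φ x * (pderiv k ρ x * pderiv j ρ x * r x)) * outerNormal Ω x k =
            g i x * φ x * outerNormal Ω x j * r x * pderiv k ρ x ^ 2 := by
          intro k
          linear_combination (g i x * φ x * r x * pderiv k ρ x) * hpar x j k
        simp only [e, ← Finset.mul_sum]
        have := hqr x (hεq x hx)
        linear_combination (-(g i x * φ x * outerNormal Ω x j)) * this
    _ = ∑ k, ∫ x, g i x * (φ x * (pderiv k ρ x * pderiv j ρ x * r x)) * outerNormal Ω x k
          ∂surfaceMeasure Ω :=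
        integral_finsetSum _ fun k _ =>
          integrable_mul_outerNormal hΩ (hg i).1 (t1 k).continuous (t2 k) k
    _ = ∑ k, ∫ x, g k x * (φ x * (pderiv k ρ x * pderiv j ρ x * r x)) * outerNormal Ω x i
          ∂surfaceMeasure Ω := Finset.sum_congr rfl fun k _ => symm (t1 k) (t2 k) i k
    _ = ∫ x, ∑ k, g k x * (φ x * (pderiv k ρ x * pderiv j ρ x * r x)) * outerNormal Ω x i
          ∂surfaceMeasure Ω :=
        (integral_finsetSum _ fun k _ =>
          integrable_mul_outerNormal hΩ (hg k).1 (t1 k).continuous (t2 k) i).symm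
    _ = 0 := by
        rw [← integral_zero (Pt d) ℝ (μ := surfaceMeasure Ω)]
        refine integral_congr_ae ?_
        filter_upwards [hq] with x hx
        have e : ∀ k, g k x * (φ x * (pderiv k ρ x * pderiv j ρ x * r x)) * outerNormal Ω x i =
            φ x * pderiv j ρ x * r x * pderiv i ρ x * (outerNormal Ω x k * g k x) := by
          intro k
          linear_combination (g k x * φ x * pderiv j ρ x * r x) * hpar x k i
        simp only [e, ← Finset.mul_sum, ← hx]
        simp

end Traces

/-! ### Mollification -/

section Mollification

variable {d : ℕ}

/-- The mollification of `f` by the normalised bump function `η`. -/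
noncomputable def mollify (η : ContDiffBump (0 : Pt d)) (f : Pt d → ℝ) : Pt d → ℝ :=
  convolution (η.normed volume) f (ContinuousLinearMap.lsmul ℝ ℝ) volume

variable {η : ContDiffBump (0 : Pt d)} {f g : Pt d → ℝ}

theorem mollify_apply (η : ContDiffBump (0 : Pt d)) (f : Pt d → ℝ) (x : Pt d) :
    mollify η f x = ∫ t, η.normed volume (x - t) * f t := by
  rw [mollify, convolution_eq_swap]
  rfl

theorem contDiff_mollify (hf : LocallyIntegrable f) : ContDiff ℝ ∞ (mollify η f) :=
  HasCompactSupport.contDiff_convolution_left _ η.hasCompactSupport_normed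
    η.contDiff_normed hf

theorem integrable_kernel_mul (η : ContDiffBump (0 : Pt d)) (hf : Integrable f) (x : Pt d) :
    Integrable fun t => η.normed volume (x - t) * f t := by
  have hc : Continuous fun t => η.normed volume (x - t) :=
    η.continuous_normed.comp (continuous_const.sub continuous_id)
  obtain ⟨C, hC⟩ := η.continuous_normed.bounded_above_of_compact_support
    (η.hasCompactSupport_normed (μ := volume))
  exact hf.bdd_mul (c := C) hc.aestronglyMeasurable (ae_of_all _ fun t => hC _)

theorem integrable_mollify (hf : Integrable f) : Integrable (mollify η f) :=
  Integrable.integrable_convolution _ η.integrable_normed hf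

theorem integral_mollify (hf : Integrable f) : ∫ x, mollify η f x = ∫ x, f x := by
  have := integral_convolution (ContinuousLinearMap.lsmul ℝ ℝ) (μ := (volume : Measure (Pt d)))
    (ν := volume) (η.integrable_normed (μ := volume)) hf
  rw [η.integral_normed] at this
  simpa [mollify] using this

theorem mollify_finsetSum {ι : Type*} (s : Finset ι) {F : ι → Pt d → ℝ}
    (hF : ∀ i, Integrable (F i)) (x : Pt d) :
    mollify η (fun y => ∑ i ∈ s, F i y) x = ∑ i ∈ s, mollify η (F i) x := by
  simp only [mollify_apply, Finset.mul_sum]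
  exact integral_finsetSum _ fun i _ => integrable_kernel_mul η (hF i) x

theorem tsupport_mollify_subset (η : ContDiffBump (0 : Pt d)) {S : Set (Pt d)}
    (hS : ∀ x ∉ S, f x = 0) : tsupport (mollify η f) ⊆ Metric.cthickening η.rOut S := by
  refine closure_minimal ?_ Metric.isClosed_cthickening
  intro x hx
  have h1 := support_convolution_subset (L := ContinuousLinearMap.lsmul ℝ ℝ)
    (f := η.normed volume) (g := f) (μ := (volume : Measure (Pt d))) hx
  obtain ⟨y, hy, z, hz, rfl⟩ := h1
  rw [η.support_normed_eq] at hy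
  have hzS : z ∈ S := by
    by_contra h
    exact hz (hS z h)
  refine Metric.mem_cthickening_of_dist_le _ z _ _ hzS ?_
  simpa [dist_eq_norm] using (Metric.mem_ball.1 hy).le

/-- Mollification commutes with weak differentiation on the whole space. -/
theorem pderiv_mollify (hf : LocallyIntegrable f) (i : Fin d)
    (h : ∀ φ : Pt d → ℝ, ContDiff ℝ ∞ φ → HasCompactSupport φ →
      ∫ x, f x * pderiv i φ x = -∫ x, g x * φ x) :
    pderiv i (mollify η f) = mollify η g := by
  funext x
  have h2 : ContDiff ℝ ∞ (η.normed (volume : Measure (Pt d))) := η.contDiff_normed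
  have hc := η.hasCompactSupport_normed (μ := (volume : Measure (Pt d)))
  have e : mollify η f = convolution f (η.normed volume)
      (ContinuousLinearMap.lsmul ℝ ℝ : ℝ →L[ℝ] ℝ →L[ℝ] ℝ).flip volume :=
    (convolution_flip _).symm
  have h1 := hc.hasFDerivAt_convolution_right
    (ContinuousLinearMap.lsmul ℝ ℝ : ℝ →L[ℝ] ℝ →L[ℝ] ℝ).flip hf (h2.of_le (by simp)) x
  rw [pderiv, e, h1.fderiv, convolution_precompR_apply _ hf (hc.fderiv ℝ)
    (h2.continuous_fderiv (by simp)), convolution_def]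
  have hφs : ContDiff ℝ ∞ fun t => η.normed volume (x - t) :=
    h2.comp (contDiff_const.sub contDiff_id)
  have hφc : HasCompactSupport fun t => η.normed volume (x - t) :=
    (η.hasCompactSupport_normed (μ := volume)).comp_homeomorph (Homeomorph.subLeft x)
  have hd : ∀ t, pderiv i (fun t => η.normed volume (x - t)) t =
      -pderiv i (η.normed volume) (x - t) := by
    intro t
    have a1 : HasFDerivAt (fun t : Pt d => x - t) (-ContinuousLinearMap.id ℝ (Pt d)) t :=
      (hasFDerivAt_id t).const_sub x
    have a2 := (h2.differentiable (by simp) (x - t)).hasFDerivAt.comp t a1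
    rw [pderiv, show (fun t => η.normed volume (x - t)) = η.normed volume ∘ fun t => x - t from rfl,
      a2.fderiv]
    simp [pderiv]
  have key := h _ hφs hφc
  simp only [hd, mul_neg, integral_neg, neg_inj] at key
  rw [mollify_apply]
  calc _ = ∫ t, f t * pderiv i (η.normed volume) (x - t) := by
        congr 1
        funext t
        simp [pderiv, mul_comm]
    _ = _ := by
        rw [key]
        congr 1
        funext t
        ring

/-- Jensen's inequality for mollifications, with a slowly varying weight. -/
theorem weight_mul_mollify_sq_le {w : Pt d → ℝ} {x : Pt d} {c : ℝ} (hf : Integrable f)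
    (hf2 : Integrable fun t => f t ^ 2) (hwf : Integrable fun t => (w t + c) * f t ^ 2)
    (hx0 : 0 ≤ w x) (hx : ∀ t, f t ≠ 0 → dist x t < η.rOut → w x ≤ w t + c) :
    w x * mollify η f x ^ 2 ≤ mollify η (fun t => (w t + c) * f t ^ 2) x := by
  set a := mollify η f x with ha
  have i1 := integrable_kernel_mul η hf x
  have i2 := integrable_kernel_mul η hf2 x
  have i0 : Integrable fun t => η.normed volume (x - t) :=
    (η.integrable_normed (μ := volume)).comp_sub_left x
  have e0 : ∫ t, η.normed volume (x - t) = 1 := by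
    rw [integral_sub_left_eq_self (fun t => η.normed volume t) volume x, η.integral_normed]
  have jensen : a ^ 2 ≤ ∫ t, η.normed volume (x - t) * f t ^ 2 := by
    -- the variance of `f` under the probability density `η (x - ·)` is nonnegative
    have pos : 0 ≤ ∫ t, (η.normed volume (x - t) * f t ^ 2 -
        2 * a * (η.normed volume (x - t) * f t) + a ^ 2 * η.normed volume (x - t)) := by
      refine integral_nonneg fun t => ?_
      have : η.normed volume (x - t) * f t ^ 2 - 2 * a * (η.normed volume (x - t) * f t) +
          a ^ 2 * η.normed volume (x - t) = η.normed volume (x - t) * (f t - a) ^ 2 := by ring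
      simp only [Pi.zero_apply, this]
      exact mul_nonneg (η.nonneg_normed _) (sq_nonneg _)
    have i3 : Integrable fun t => η.normed volume (x - t) * f t ^ 2 -
        2 * a * (η.normed volume (x - t) * f t) := i2.sub (i1.const_mul _)
    rw [integral_add i3 (i0.const_mul _), integral_sub i2 (i1.const_mul _), integral_const_mul,
      integral_const_mul, e0, ← mollify_apply η f, ← ha] at pos
    linarith
  refine (mul_le_mul_of_nonneg_left jensen hx0).trans ?_
  rw [mollify_apply, ← integral_const_mul]
  refine integral_mono (i2.const_mul _) (integrable_kernel_mul η hwf x) fun t => ?_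
  dsimp only
  by_cases hd : dist x t < η.rOut
  · by_cases hft : f t = 0
    · simp [hft]
    · have := mul_le_mul_of_nonneg_right (hx t hft hd)
        (mul_nonneg (η.nonneg_normed (μ := volume) (x - t)) (sq_nonneg (f t)))
      linarith
  · have : η.normed volume (x - t) = 0 := by
      rw [← Function.notMem_support, η.support_normed_eq]
      simpa [dist_eq_norm] using hd
    simp [this]

/-- Fatou's lemma in terms of Bochner integrals. -/
theorem integral_le_of_ae_tendsto {G : Pt d → ℝ} {Gn : ℕ → Pt d → ℝ} {R : ℝ}
    (h0 : ∀ n x, 0 ≤ Gn n x) (hi : ∀ᶠ n in atTop, Integrable (Gn n)) (hG : Integrable G)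
    (hm : ∀ n, Measurable (Gn n))
    (ht : ∀ᵐ x, Tendsto (fun n => Gn n x) atTop (𝓝 (G x)))
    (hR : ∀ᶠ n in atTop, ∫ x, Gn n x ≤ R) : ∫ x, G x ≤ R := by
  have hG0 : 0 ≤ᵐ[volume] G := by
    filter_upwards [ht] with x hx
    exact ge_of_tendsto' hx fun n => h0 n x
  have hR0 : 0 ≤ R := by
    obtain ⟨n, hn⟩ := hR.exists
    exact (integral_nonneg (h0 n)).trans hn
  rw [← ENNReal.ofReal_le_ofReal_iff hR0, ofReal_integral_eq_lintegral_ofReal hG hG0]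
  calc ∫⁻ x, ENNReal.ofReal (G x)
      = ∫⁻ x, liminf (fun n => ENNReal.ofReal (Gn n x)) atTop := by
        refine lintegral_congr_ae ?_
        filter_upwards [ht] with x hx
        exact ((ENNReal.continuous_ofReal.tendsto _).comp hx).liminf_eq.symm
    _ ≤ liminf (fun n => ∫⁻ x, ENNReal.ofReal (Gn n x)) atTop :=
        lintegral_liminf_le fun n => (hm n).ennreal_ofReal
    _ ≤ liminf (fun _ : ℕ => ENNReal.ofReal R) atTop := by
        refine liminf_le_liminf ?_
        filter_upwards [hi, hR] with n h1 h2
        rw [← ofReal_integral_eq_lintegral_ofReal h1 (ae_of_all _ (h0 n))]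
        exact ENNReal.ofReal_le_ofReal h2
    _ = ENNReal.ofReal R := by simp

end Mollification

/-! ### The Carleman estimate in `H²` -/

section SobolevCarleman

variable {d : ℕ} {Ω : Set (Pt d)}

theorem integrableOn_continuous_mul (hb : Bornology.IsBounded Ω) (hm : MeasurableSet Ω)
    {w h : Pt d → ℝ} (hw : Continuous w) (hh : IntegrableOn h Ω) :
    IntegrableOn (fun x => w x * h x) Ω := by
  obtain ⟨C, hC⟩ := hb.isCompact_closure.exists_bound_of_continuousOn hw.continuousOn
  refine Integrable.bdd_mul (c := C) hh hw.aestronglyMeasurable ?_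
  filter_upwards [ae_restrict_mem hm] with x hx using hC x (subset_closure hx)

namespace H2

theorem memLp_lap (v : H2 Ω) : MemLp v.lap 2 (volume.restrict Ω) :=
  memLp_finsetSum (p := 2) Finset.univ (f := fun i => v.hess i i) fun i _ => v.memLp_hess i i

theorem integrableOn_val_sq (v : H2 Ω) : IntegrableOn (fun x => v.val x ^ 2) Ω :=
  v.memLp_val.integrable_sq

theorem integrableOn_gradSq (v : H2 Ω) : IntegrableOn v.gradSq Ω :=
  integrable_finsetSum _ fun i _ => (v.memLp_grad i).integrable_sq

theorem integrableOn_hessSq (v : H2 Ω) : IntegrableOn v.hessSq Ω :=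
  integrable_finsetSum _ fun i _ => integrable_finsetSum _ fun j _ =>
    (v.memLp_hess i j).integrable_sq

end H2

theorem H2.gradSq_nonneg (v : H2 Ω) (x : Pt d) : 0 ≤ v.gradSq x :=
  Finset.sum_nonneg fun _ _ => sq_nonneg _

theorem H2.hessSq_nonneg (v : H2 Ω) (x : Pt d) : 0 ≤ v.hessSq x :=
  Finset.sum_nonneg fun _ _ => Finset.sum_nonneg fun _ _ => sq_nonneg _

/-- The bump functions used for mollification, with supports shrinking to the origin. The ratio of
the radii is fixed, as is needed for almost everywhere convergence. -/
noncomputable def shrinkingBump (d : ℕ) (n : ℕ) : ContDiffBump (0 : Pt d) where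
  rIn := 1 / ((n : ℝ) + 1) / 2
  rOut := 1 / ((n : ℝ) + 1)
  rIn_pos := by positivity
  rIn_lt_rOut := half_lt_self (by positivity)

theorem tendsto_shrinkingBump_rOut (d : ℕ) :
    Tendsto (fun n => (shrinkingBump d n).rOut) atTop (𝓝 0) :=
  tendsto_one_div_add_atTop_nhds_zero_nat

theorem ae_tendsto_mollify {f : Pt d → ℝ} (hf : LocallyIntegrable f) :
    ∀ᵐ x, Tendsto (fun n => mollify (shrinkingBump d n) f x) atTop (𝓝 (f x)) :=
  ContDiffBump.ae_convolution_tendsto_right_of_locallyIntegrable (K := 2)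
    (tendsto_shrinkingBump_rOut d) (Eventually.of_forall fun n => by
      simp only [shrinkingBump]
      linarith) hf

/-- For mollifications of `f`, the weighted `L²` norms are asymptotically at most that of `f`. -/
theorem eventually_integral_weight_mul_mollify_sq_le (hb : Bornology.IsBounded Ω)
    {w f : Pt d → ℝ} (hw : Continuous w) (hw0 : ∀ x, 0 ≤ w x) (hf0 : ∀ x ∉ Ω, f x = 0)
    (hf : Integrable f) (hf2 : Integrable fun x => f x ^ 2)
    (hwf : Integrable fun x => w x * f x ^ 2) {δ : ℝ} (hδ : 0 < δ) :
    ∀ᶠ n in atTop, ∫ x, w x * mollify (shrinkingBump d n) f x ^ 2 ≤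
      (∫ x, w x * f x ^ 2) + δ * ∫ x, f x ^ 2 := by
  have hK : IsCompact (Metric.cthickening 1 Ω) :=
    Metric.isCompact_of_isClosed_isBounded Metric.isClosed_cthickening hb.cthickening
  obtain ⟨r, hr, hwr⟩ := Metric.uniformContinuousOn_iff.1
    (hK.uniformContinuousOn_of_continuous hw.continuousOn) δ hδ
  have hsum : Integrable fun t => (w t + δ) * f t ^ 2 := by
    simp only [add_mul]
    exact hwf.add (hf2.const_mul δ)
  filter_upwards [(tendsto_shrinkingBump_rOut d).eventually_lt_const hr] with n hn
  have hn1 : (shrinkingBump d n).rOut ≤ 1 := by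
    simp only [shrinkingBump]
    rw [div_le_one (by positivity)]
    linarith [Nat.cast_nonneg (α := ℝ) n]
  have hcs : HasCompactSupport (mollify (shrinkingBump d n) f) :=
    (Metric.isCompact_of_isClosed_isBounded Metric.isClosed_cthickening
      hb.cthickening).of_isClosed_subset (isClosed_tsupport _) (tsupport_mollify_subset _ hf0)
  have hcont : Continuous (mollify (shrinkingBump d n) f) :=
    (contDiff_mollify hf.locallyIntegrable).continuous
  calc ∫ x, w x * mollify (shrinkingBump d n) f x ^ 2
      ≤ ∫ x, mollify (shrinkingBump d n) (fun t => (w t + δ) * f t ^ 2) x := by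
        refine integral_mono ?_ (integrable_mollify hsum) fun x => ?_
        · refine (show Continuous fun x => w x * mollify (shrinkingBump d n) f x ^ 2 by
            fun_prop).integrable_of_hasCompactSupport ?_
          refine HasCompactSupport.mul_left ?_
          simp only [sq]
          exact hcs.mul_left
        · refine weight_mul_mollify_sq_le hf hf2 hsum (hw0 x) fun t ht hxt => ?_
          have htΩ : t ∈ Ω := by
            by_contra h
            exact ht (hf0 t h)
          have := hwr x (Metric.mem_cthickening_of_dist_le _ t _ _ htΩ (hxt.le.trans hn1)) t
            (Metric.self_subset_cthickening _ htΩ) (hxt.trans hn)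
          rw [Real.dist_eq] at this
          linarith [(abs_lt.1 this).2]
    _ = _ := by
        rw [integral_mollify hsum]
        simp only [add_mul]
        rw [integral_add hwf (hf2.const_mul δ), integral_const_mul]

/-- The Carleman estimate for `H²` functions with vanishing Cauchy data. Extended by zero, such a
function is in `H²` of the whole space; its mollifications are smooth with supports close to `Ω`,
and the estimate passes to the limit by Fatou's lemma on the left and Jensen's inequality on the
right. -/
theorem IsConvexWeight.carleman_sobolev {φ : Pt d → ℝ} {W : Set (Pt d)} {m B : ℝ}
    (hw : IsConvexWeight φ W m B) (hWo : IsOpen W) (hΩ : IsSmoothBoundedDomain Ω)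
    (hΩW : closure Ω ⊆ W) {lam : ℝ} (hlam : 1 ≤ lam) (hlB : B ≤ 4 * m ^ 3 * lam ^ 2)
    {v : H2 Ω} (h : HasBoundaryValue v 0) (h' : HasNormalDerivative v 0) :
    ∫ x in Ω, Real.exp (2 * lam * φ x) * (lam⁻¹ * v.hessSq x + lam ^ 3 * v.val x ^ 2 +
        lam * v.gradSq x) ≤
      (20 + (46 * B / m + 27 * B ^ 2 / m ^ 2)) *
        ∫ x in Ω, Real.exp (2 * lam * φ x) * v.lap x ^ 2 := by
  have hm := hΩ.isOpen.measurableSet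
  have : IsFiniteMeasure (volume.restrict Ω) :=
    ⟨by rw [Measure.restrict_apply_univ]; exact hΩ.isBounded.measure_lt_top⟩
  have hm0 := hw.pos
  have hB0 := hw.one_le
  have hφ := hw.smooth
  set Q := 20 + (46 * B / m + 27 * B ^ 2 / m ^ 2) with hQ
  have hQ0 : 0 ≤ Q := by positivity
  set w : Pt d → ℝ := fun x => Real.exp (2 * lam * φ x) with hwdef
  have hwc : Continuous w := by
    have := hφ.continuous
    fun_prop
  have ext : ∀ {f : Pt d → ℝ}, MemLp f 2 (volume.restrict Ω) → Integrable (Ω.indicator f) :=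
    fun hf => (integrable_indicator_iff hm).2 (hf.integrable (by norm_num))
  have i0 := ext v.memLp_val
  have i1 := fun i => ext (v.memLp_grad i)
  have i2 := fun i j => ext (v.memLp_hess i j)
  have iL := ext v.memLp_lap
  have d1 : ∀ (η : ContDiffBump (0 : Pt d)) i,
      pderiv i (mollify η (Ω.indicator v.val)) = mollify η (Ω.indicator (v.grad i)) := by
    intro η i
    refine pderiv_mollify i0.locallyIntegrable i fun ψ p1 p2 => ?_
    have := integral_val_mul_pderiv_of_zero_trace h p1 p2 i
    simp only [← integral_indicator hm, Set.indicator_mul_left] at this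
    exact this
  have d2 : ∀ (η : ContDiffBump (0 : Pt d)) i j,
      pderiv j (pderiv i (mollify η (Ω.indicator v.val))) =
        mollify η (Ω.indicator (v.hess i j)) := by
    intro η i j
    rw [d1]
    refine pderiv_mollify (i1 i).locallyIntegrable j fun ψ p1 p2 => ?_
    have := integral_grad_mul_pderiv_of_zero_trace hΩ h h' p1 p2 i j
    simp only [← integral_indicator hm, Set.indicator_mul_left] at this
    exact this
  have dL : ∀ (η : ContDiffBump (0 : Pt d)) x,
      ∑ i, pderiv i (pderiv i (mollify η (Ω.indicator v.val))) x =
        mollify η (Ω.indicator v.lap) x := by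
    intro η x
    have : Ω.indicator v.lap = fun y => ∑ i, Ω.indicator (v.hess i i) y := by
      funext y
      by_cases hy : y ∈ Ω <;> simp [hy, H2.lap]
    rw [this, mollify_finsetSum _ fun i => i2 i i]
    simp only [d2]
  have smooth : ∀ (η : ContDiffBump (0 : Pt d)), ContDiff ℝ ∞ (mollify η (Ω.indicator v.val)) :=
    fun η => contDiff_mollify i0.locallyIntegrable
  have s1 : ∀ (η : ContDiffBump (0 : Pt d)) i, Continuous
      (pderiv i (mollify η (Ω.indicator v.val))) := fun η i => ((smooth η).pderiv i).continuous
  have s2 : ∀ (η : ContDiffBump (0 : Pt d)) i j, Continuous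
      (pderiv i (pderiv j (mollify η (Ω.indicator v.val)))) :=
    fun η i j => (((smooth η).pderiv j).pderiv i).continuous
  have tsup : ∀ η : ContDiffBump (0 : Pt d),
      tsupport (mollify η (Ω.indicator v.val)) ⊆ Metric.cthickening η.rOut Ω :=
    fun η => tsupport_mollify_subset η fun x hx => Set.indicator_of_notMem hx _
  have cpt : ∀ η : ContDiffBump (0 : Pt d), HasCompactSupport (mollify η (Ω.indicator v.val)) :=
    fun η => (Metric.isCompact_of_isClosed_isBounded Metric.isClosed_cthickening
      hΩ.isBounded.cthickening).of_isClosed_subset (isClosed_tsupport _) (tsup η)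
  have intL : Integrable fun x => w x * Ω.indicator v.lap x ^ 2 := by
    have e : (fun x => w x * Ω.indicator v.lap x ^ 2) =
        Ω.indicator fun x => w x * v.lap x ^ 2 := by
      funext x
      by_cases hx : x ∈ Ω <;> simp [hx]
    rw [e, integrable_indicator_iff hm]
    exact integrableOn_continuous_mul hΩ.isBounded hm hwc v.memLp_lap.integrable_sq
  have intL2 : Integrable fun x => Ω.indicator v.lap x ^ 2 := by
    have e : (fun x => Ω.indicator v.lap x ^ 2) = Ω.indicator fun x => v.lap x ^ 2 := by
      funext x
      by_cases hx : x ∈ Ω <;> simp [hx]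
    rw [e, integrable_indicator_iff hm]
    exact v.memLp_lap.integrable_sq
  have eL : ∫ x, w x * Ω.indicator v.lap x ^ 2 = ∫ x in Ω, w x * v.lap x ^ 2 := by
    rw [← integral_indicator hm]
    congr 1
    funext x
    by_cases hx : x ∈ Ω <;> simp [hx]
  -- it suffices to prove the estimate up to a small error
  suffices hs : ∀ δ : ℝ, 0 < δ → ∫ x in Ω, w x * (lam⁻¹ * v.hessSq x + lam ^ 3 * v.val x ^ 2 +
      lam * v.gradSq x) ≤
      Q * ((∫ x in Ω, w x * v.lap x ^ 2) + δ * ∫ x, Ω.indicator v.lap x ^ 2) by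
    have lim : Tendsto (fun δ : ℝ => Q * ((∫ x in Ω, w x * v.lap x ^ 2) +
        δ * ∫ x, Ω.indicator v.lap x ^ 2)) (𝓝[>] 0)
        (𝓝 (Q * ((∫ x in Ω, w x * v.lap x ^ 2) + 0 * ∫ x, Ω.indicator v.lap x ^ 2))) := by
      refine Tendsto.mono_left ?_ nhdsWithin_le_nhds
      exact Continuous.tendsto (by fun_prop) 0
    rw [zero_mul, add_zero] at lim
    exact ge_of_tendsto lim (eventually_mem_nhdsWithin.mono fun δ hδ => hs δ hδ)
  intro δ hδ
  rw [← integral_indicator hm]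
  refine integral_le_of_ae_tendsto (Gn := fun n x => w x * (lam⁻¹ * ∑ i, ∑ j,
      (pderiv i (pderiv j (mollify (shrinkingBump d n) (Ω.indicator v.val))) x) ^ 2 +
      lam ^ 3 * mollify (shrinkingBump d n) (Ω.indicator v.val) x ^ 2 +
      lam * ∑ i, (pderiv i (mollify (shrinkingBump d n) (Ω.indicator v.val)) x) ^ 2))
    ?_ ?_ ?_ ?_ ?_ ?_
  · intro n x
    positivity
  · refine Eventually.of_forall fun n => ?_
    have c0 := (smooth (shrinkingBump d n)).continuous
    have c1 := s1 (shrinkingBump d n)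
    have c2 := s2 (shrinkingBump d n)
    refine Continuous.integrable_of_hasCompactSupport (by fun_prop) ?_
    refine HasCompactSupport.intro (cpt (shrinkingBump d n)) fun x hx => ?_
    have tsub : ∀ {f : Pt d → ℝ} (i : Fin d), tsupport (pderiv i f) ⊆ tsupport f :=
      fun {f} i => tsupport_fderiv_apply_subset ℝ _
    have z0 := image_eq_zero_of_notMem_tsupport hx
    have z1 : ∀ i, pderiv i (mollify (shrinkingBump d n) (Ω.indicator v.val)) x = 0 := fun i =>
      image_eq_zero_of_notMem_tsupport fun hh => hx (tsub i hh)
    have z2 : ∀ i j, pderiv i (pderiv j (mollify (shrinkingBump d n) (Ω.indicator v.val))) x = 0 :=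
      fun i j => image_eq_zero_of_notMem_tsupport fun hh => hx (tsub j (tsub i hh))
    simp [z0, z1, z2]
  · rw [integrable_indicator_iff hm]
    exact integrableOn_continuous_mul hΩ.isBounded hm hwc
      (((v.integrableOn_hessSq.const_mul _).add (v.integrableOn_val_sq.const_mul _)).add
        (v.integrableOn_gradSq.const_mul _))
  · intro n
    have c0 := (smooth (shrinkingBump d n)).continuous
    have c1 := s1 (shrinkingBump d n)
    have c2 := s2 (shrinkingBump d n)
    exact Continuous.measurable (by fun_prop)
  · have a0 := ae_tendsto_mollify i0.locallyIntegrable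
    have a1 := ae_all_iff.2 fun i => ae_tendsto_mollify (i1 i).locallyIntegrable
    have a2 := ae_all_iff.2 fun i => ae_all_iff.2 fun j =>
      ae_tendsto_mollify (i2 i j).locallyIntegrable
    filter_upwards [a0, a1, a2] with x b0 b1 b2
    have e : Ω.indicator (fun x => w x * (lam⁻¹ * v.hessSq x + lam ^ 3 * v.val x ^ 2 +
        lam * v.gradSq x)) x = w x * (lam⁻¹ * ∑ i, ∑ j, Ω.indicator (v.hess j i) x ^ 2 +
        lam ^ 3 * Ω.indicator v.val x ^ 2 + lam * ∑ i, Ω.indicator (v.grad i) x ^ 2) := by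
      by_cases hx : x ∈ Ω
      · simp only [hx, Set.indicator_of_mem, H2.hessSq, H2.gradSq]
        rw [Finset.sum_comm]
      · simp [hx]
    rw [e]
    simp only [d2]
    simp only [d1]
    refine Tendsto.const_mul _ ((Tendsto.add (Tendsto.const_mul _ ?_)
      ((b0.pow 2).const_mul _)).add (Tendsto.const_mul _ ?_))
    · exact tendsto_finsetSum _ fun i _ => tendsto_finsetSum _ fun j _ => (b2 j i).pow 2
    · exact tendsto_finsetSum _ fun i _ => (b1 i).pow 2
  · obtain ⟨r, hr, hrW⟩ := hΩ.isBounded.isCompact_closure.exists_cthickening_subset_open hWo hΩW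
    filter_upwards [(tendsto_shrinkingBump_rOut d).eventually_lt_const hr,
      eventually_integral_weight_mul_mollify_sq_le hΩ.isBounded hwc (fun x => (Real.exp_pos _).le)
        (fun x hx => Set.indicator_of_notMem hx _) iL intL2 intL hδ] with n hn hle
    have sub : tsupport (mollify (shrinkingBump d n) (Ω.indicator v.val)) ⊆ W :=
      (tsup _).trans ((Metric.cthickening_mono hn.le _).trans
        ((Metric.cthickening_subset_of_subset _ subset_closure).trans hrW))
    have key := hw.carleman_smooth hlam hlB (smooth (shrinkingBump d n)) (cpt _) sub
    simp only [dL] at key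
    rw [eL] at hle
    exact key.trans (mul_le_mul_of_nonneg_left hle hQ0)

end SobolevCarleman

/-! ### The nonlinearity -/

section Nonlinearity

variable {d N : ℕ} {Ω : Set (Pt d)} {T : ℝ} {Ψ : ℕ → ℝ → ℝ} {F : Pt d → ℝ → ℝ → Pt d → ℝ}

theorem le_of_c1Norm_le {M : ℝ≥0} (hM : c1Norm Ω T F ≤ M) {x : Pt d} (hx : x ∈ Ω) {t : ℝ}
    (ht : t ∈ Ioo 0 T) (s : ℝ) (p : Pt d) :
    |F x t s p| + |deriv (fun s' => F x t s' p) s| + ‖gradient (F x t s) p‖ ≤ M := by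
  have h1 : ENNReal.ofReal
      (|F x t s p| + |deriv (fun s' => F x t s' p) s| + ‖gradient (F x t s) p‖) ≤ M := by
    refine le_trans ?_ hM
    refine le_trans ?_ (le_iSup₂ (f := fun x (_ : x ∈ Ω) => ⨆ t ∈ Ioo 0 T, ⨆ (s : ℝ) (p : Pt d),
      ENNReal.ofReal (|F x t s p| + |deriv (fun s' => F x t s' p) s| +
        ‖gradient (F x t s) p‖)) x hx)
    refine le_trans ?_ (le_iSup₂ (f := fun t (_ : t ∈ Ioo 0 T) => ⨆ (s : ℝ) (p : Pt d),
      ENNReal.ofReal (|F x t s p| + |deriv (fun s' => F x t s' p) s| +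
        ‖gradient (F x t s) p‖)) t ht)
    exact le_iSup₂ (f := fun (s : ℝ) (p : Pt d) => ENNReal.ofReal (|F x t s p| +
      |deriv (fun s' => F x t s' p) s| + ‖gradient (F x t s) p‖)) s p
  rw [← ENNReal.ofReal_coe_nnreal] at h1
  exact (ENNReal.ofReal_le_ofReal_iff M.2).1 h1

/-- A bound of the `C¹` norm is a Lipschitz constant in the last two variables. -/
theorem abs_sub_le_of_c1Norm_le
    (hF : ContDiff ℝ 1 (fun z : Pt d × ℝ × ℝ × Pt d => F z.1 z.2.1 z.2.2.1 z.2.2.2))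
    {M : ℝ≥0} (hM : c1Norm Ω T F ≤ M) {x : Pt d} (hx : x ∈ Ω) {t : ℝ} (ht : t ∈ Ioo 0 T)
    (s s' : ℝ) (p p' : Pt d) :
    |F x t s p - F x t s' p'| ≤ M * (|s - s'| + ‖p - p'‖) := by
  have hd := hF.differentiable one_ne_zero
  have d1 : ∀ p, Differentiable ℝ fun s => F x t s p := fun p =>
    hd.comp (f := fun s : ℝ => ((x, t, s, p) : Pt d × ℝ × ℝ × Pt d)) (by fun_prop)
  have d2 : ∀ s, Differentiable ℝ fun p => F x t s p := fun s =>
    hd.comp (f := fun p : Pt d => ((x, t, s, p) : Pt d × ℝ × ℝ × Pt d)) (by fun_prop)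
  have b1 : ‖F x t s p - F x t s' p‖ ≤ M * ‖s - s'‖ := by
    refine Convex.norm_image_sub_le_of_norm_deriv_le (f := fun s => F x t s p) (s := univ)
      (fun y _ => d1 p y) (fun y _ => ?_) convex_univ (mem_univ _) (mem_univ _)
    have := le_of_c1Norm_le hM hx ht y p
    rw [Real.norm_eq_abs]
    linarith [abs_nonneg (F x t y p), norm_nonneg (gradient (F x t y) p)]
  have b2 : ‖F x t s' p - F x t s' p'‖ ≤ M * ‖p - p'‖ := by
    refine Convex.norm_image_sub_le_of_norm_fderiv_le (𝕜 := ℝ) (f := fun p => F x t s' p)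
      (s := univ) (fun y _ => d2 s' y) (fun y _ => ?_) convex_univ (mem_univ _) (mem_univ _)
    have := le_of_c1Norm_le hM hx ht s' y
    have e : ‖gradient (F x t s') y‖ = ‖fderiv ℝ (F x t s') y‖ :=
      LinearIsometryEquiv.norm_map _ _
    rw [e] at this
    change ‖fderiv ℝ (F x t s') y‖ ≤ M
    linarith [abs_nonneg (F x t s' y), abs_nonneg (deriv (fun s => F x t s y) s')]
  calc |F x t s p - F x t s' p'| = ‖(F x t s p - F x t s' p) + (F x t s' p - F x t s' p')‖ := by
        rw [Real.norm_eq_abs]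
        ring_nf
    _ ≤ M * ‖s - s'‖ + M * ‖p - p'‖ := (norm_add_le _ _).trans (add_le_add b1 b2)
    _ = _ := by
        rw [Real.norm_eq_abs]
        ring

/-- The basis functions on `[0,T]`, extended continuously by constants. -/
theorem IsC1OrthonormalBasis.exists_continuous (hT : 0 < T) (hΨ : IsC1OrthonormalBasis T Ψ) :
    ∃ Ψ' : ℕ → ℝ → ℝ, (∀ n, Continuous (Ψ' n)) ∧ ∀ n, ∀ t ∈ Icc 0 T, Ψ' n t = Ψ n t := by
  refine ⟨fun n => IccExtend hT.le ((Icc 0 T).domRestrict (Ψ n)), fun n => ?_, fun n t ht => ?_⟩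
  · exact (hΨ.contDiffOn n).continuousOn.domRestrict.Icc_extend'
  · dsimp only
    rw [IccExtend_of_mem _ _ ht]
    rfl

/-- The nonlinearity depends on the values of the basis functions in `[0,T]` only. -/
theorem nonlin_congr (hT : 0 < T) {Ψ' : ℕ → ℝ → ℝ} (h : ∀ n, ∀ t ∈ Icc 0 T, Ψ' n t = Ψ n t)
    (U : Fin N → H2 Ω) (m : Fin N) (x : Pt d) : nonlin T Ψ F U m x = nonlin T Ψ' F U m x := by
  refine intervalIntegral.integral_congr fun t ht => ?_
  rw [uIcc_of_le hT.le] at ht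
  simp only [h _ t ht]

/-- The nonlinearity is measurable, being a continuous function of `x`, `U(x)` and `∇U(x)`. -/
theorem aestronglyMeasurable_nonlin (hT : 0 < T) (hΨ : IsC1OrthonormalBasis T Ψ)
    (hF : ContDiff ℝ 1 (fun z : Pt d × ℝ × ℝ × Pt d => F z.1 z.2.1 z.2.2.1 z.2.2.2))
    (U : Fin N → H2 Ω) (m : Fin N) :
    AEStronglyMeasurable (nonlin T Ψ F U m) (volume.restrict Ω) := by
  obtain ⟨Ψ', hc, hΨ'⟩ := hΨ.exists_continuous hT
  rw [show nonlin T Ψ F U m = nonlin T Ψ' F U m from funext (nonlin_congr hT hΨ' U m)]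
  have hFc := hF.continuous
  set Φ : Pt d × (Fin N → ℝ) × (Fin N → Fin d → ℝ) → ℝ := fun y => ∫ t in (0 : ℝ)..T,
    F y.1 t (∑ n : Fin N, y.2.1 n * Ψ' n t) (∑ n : Fin N, Ψ' n t • WithLp.toLp 2 (y.2.2 n)) *
      Ψ' m t with hΦ
  have hΦc : Continuous Φ := by
    refine intervalIntegral.continuous_parametric_intervalIntegral_of_continuous' ?_ 0 T
    have : Continuous fun z : (Pt d × (Fin N → ℝ) × (Fin N → Fin d → ℝ)) × ℝ =>
        ((z.1.1, z.2, ∑ n : Fin N, z.1.2.1 n * Ψ' n z.2,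
          ∑ n : Fin N, Ψ' n z.2 • WithLp.toLp 2 (z.1.2.2 n)) : Pt d × ℝ × ℝ × Pt d) := by
      fun_prop
    exact (hFc.comp this).mul ((hc m).comp continuous_snd)
  have hmeas : AEMeasurable (fun x => (x, (fun n => (U n).val x), fun n i => (U n).grad i x) :
      Pt d → Pt d × (Fin N → ℝ) × (Fin N → Fin d → ℝ)) (volume.restrict Ω) := by
    refine aemeasurable_id.prodMk (AEMeasurable.prodMk ?_ ?_)
    · exact aemeasurable_pi_lambda _ fun n => (U n).memLp_val.aestronglyMeasurable.aemeasurable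
    · exact aemeasurable_pi_lambda _ fun n => aemeasurable_pi_lambda _ fun i =>
        ((U n).memLp_grad i).aestronglyMeasurable.aemeasurable
  exact (hΦc.measurable.comp_aemeasurable hmeas).aestronglyMeasurable

theorem H2.norm_gradVec_sq (v : H2 Ω) (x : Pt d) : ‖v.gradVec x‖ ^ 2 = v.gradSq x := by
  rw [EuclideanSpace.norm_sq_eq]
  simp [H2.gradVec, H2.gradSq]

/-- The nonlinearity is pointwise Lipschitz in the function and its gradient. -/
theorem abs_nonlin_sub_le (hT : 0 < T) (hΨ : IsC1OrthonormalBasis T Ψ)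
    (hF : ContDiff ℝ 1 (fun z : Pt d × ℝ × ℝ × Pt d => F z.1 z.2.1 z.2.2.1 z.2.2.2))
    {M : ℝ≥0} (hM : c1Norm Ω T F ≤ M) {P : ℝ} (hP : ∀ n : Fin N, ∀ t ∈ Icc 0 T, |Ψ n t| ≤ P)
    (U V : Fin N → H2 Ω) (m : Fin N) {x : Pt d} (hx : x ∈ Ω) :
    |nonlin T Ψ F U m x - nonlin T Ψ F V m x| ≤
      M * P ^ 2 * T * ∑ n, (|(U n - V n).val x| + ‖(U n - V n).gradVec x‖) := by
  obtain ⟨Ψ', hc, hΨ'⟩ := hΨ.exists_continuous hT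
  have hP' : ∀ n : Fin N, ∀ t ∈ Icc 0 T, |Ψ' n t| ≤ P := fun n t ht => by
    rw [hΨ' n t ht]
    exact hP n t ht
  have hP0 : 0 ≤ P := (abs_nonneg _).trans (hP m 0 ⟨le_rfl, hT.le⟩)
  rw [nonlin_congr hT hΨ', nonlin_congr hT hΨ' V]
  have hFc := hF.continuous
  have hint : ∀ U : Fin N → H2 Ω, IntervalIntegrable (fun t =>
      F x t (∑ n : Fin N, (U n).val x * Ψ' n t) (∑ n : Fin N, Ψ' n t • (U n).gradVec x) * Ψ' m t)
      volume 0 T := by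
    intro U
    refine Continuous.intervalIntegrable ?_ 0 T
    have : Continuous fun t : ℝ => ((x, t, ∑ n : Fin N, (U n).val x * Ψ' n t,
        ∑ n : Fin N, Ψ' n t • (U n).gradVec x) : Pt d × ℝ × ℝ × Pt d) := by
      fun_prop
    exact (hFc.comp this).mul (hc m)
  unfold nonlin
  rw [← intervalIntegral.integral_sub (hint U) (hint V)]
  have hbound : ∀ᵐ t : ℝ, t ∈ uIoc 0 T →
      ‖F x t (∑ n : Fin N, (U n).val x * Ψ' n t) (∑ n : Fin N, Ψ' n t • (U n).gradVec x) * Ψ' m t -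
        F x t (∑ n : Fin N, (V n).val x * Ψ' n t) (∑ n : Fin N, Ψ' n t • (V n).gradVec x) *
          Ψ' m t‖ ≤
      M * P ^ 2 * ∑ n, (|(U n - V n).val x| + ‖(U n - V n).gradVec x‖) := by
    have hne : ∀ᵐ t : ℝ, t ≠ T := by simp [ae_iff]
    filter_upwards [hne] with t htT ht
    rw [uIoc_of_le hT.le] at ht
    have htI : t ∈ Ioo 0 T := ⟨ht.1, lt_of_le_of_ne ht.2 htT⟩
    have htc : t ∈ Icc 0 T := ⟨ht.1.le, ht.2⟩
    have lip := abs_sub_le_of_c1Norm_le hF hM hx htI (∑ n : Fin N, (U n).val x * Ψ' n t)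
      (∑ n : Fin N, (V n).val x * Ψ' n t) (∑ n : Fin N, Ψ' n t • (U n).gradVec x)
      (∑ n : Fin N, Ψ' n t • (V n).gradVec x)
    have e1 : |∑ n : Fin N, (U n).val x * Ψ' n t - ∑ n : Fin N, (V n).val x * Ψ' n t| ≤
        ∑ n, P * |(U n - V n).val x| := by
      rw [← Finset.sum_sub_distrib]
      refine (Finset.abs_sum_le_sum_abs _ _).trans (Finset.sum_le_sum fun n _ => ?_)
      rw [← sub_mul, abs_mul, mul_comm]
      exact mul_le_mul_of_nonneg_right (hP' n t htc) (abs_nonneg _)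
    have e2 : ‖∑ n : Fin N, Ψ' n t • (U n).gradVec x - ∑ n : Fin N, Ψ' n t • (V n).gradVec x‖ ≤
        ∑ n, P * ‖(U n - V n).gradVec x‖ := by
      rw [← Finset.sum_sub_distrib]
      refine (norm_sum_le _ _).trans (Finset.sum_le_sum fun n _ => ?_)
      rw [← smul_sub, norm_smul, Real.norm_eq_abs]
      exact mul_le_mul_of_nonneg_right (hP' n t htc) (norm_nonneg _)
    rw [← sub_mul, norm_mul, Real.norm_eq_abs, Real.norm_eq_abs]
    calc _ ≤ M * (∑ n, P * |(U n - V n).val x| + ∑ n, P * ‖(U n - V n).gradVec x‖) * P := by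
          refine mul_le_mul (lip.trans ?_) (hP' m t htc) (abs_nonneg _) (by positivity)
          gcongr
      _ = _ := by
          rw [Finset.sum_add_distrib, ← Finset.mul_sum, ← Finset.mul_sum]
          ring
  have := intervalIntegral.norm_integral_le_of_norm_le_const_ae hbound
  rw [Real.norm_eq_abs, sub_zero, abs_of_pos hT] at this
  refine this.trans (le_of_eq ?_)
  ring

/-- The squared form of the Lipschitz bound, for the whole vector. -/
theorem sum_nonlin_sub_sq_le (hT : 0 < T) (hΨ : IsC1OrthonormalBasis T Ψ)
    (hF : ContDiff ℝ 1 (fun z : Pt d × ℝ × ℝ × Pt d => F z.1 z.2.1 z.2.2.1 z.2.2.2))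
    {M : ℝ≥0} (hM : c1Norm Ω T F ≤ M) {P : ℝ} (hP : ∀ n : Fin N, ∀ t ∈ Icc 0 T, |Ψ n t| ≤ P)
    (U V : Fin N → H2 Ω) {x : Pt d} (hx : x ∈ Ω) :
    ∑ m, (nonlin T Ψ F U m x - nonlin T Ψ F V m x) ^ 2 ≤
      2 * N ^ 2 * (M * P ^ 2 * T) ^ 2 * ∑ n, ((U n - V n).gradSq x + (U n - V n).val x ^ 2) := by
  have h1 : (∑ n, (|(U n - V n).val x| + ‖(U n - V n).gradVec x‖)) ^ 2 ≤
      N * (2 * ∑ n, ((U n - V n).gradSq x + (U n - V n).val x ^ 2)) := by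
    have := sq_sum_le_card_mul_sum_sq (s := (Finset.univ : Finset (Fin N)))
      (f := fun n => |(U n - V n).val x| + ‖(U n - V n).gradVec x‖)
    rw [Finset.card_univ, Fintype.card_fin] at this
    refine this.trans ?_
    rw [Finset.mul_sum _ _ (2 : ℝ)]
    refine mul_le_mul_of_nonneg_left (Finset.sum_le_sum fun n _ => ?_) (Nat.cast_nonneg _)
    rw [← H2.norm_gradVec_sq, ← sq_abs ((U n - V n).val x)]
    nlinarith [sq_nonneg (|(U n - V n).val x| - ‖(U n - V n).gradVec x‖)]
  calc _ ≤ ∑ _m : Fin N, (M * P ^ 2 * T) ^ 2 *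
          (N * (2 * ∑ n, ((U n - V n).gradSq x + (U n - V n).val x ^ 2))) := by
        refine Finset.sum_le_sum fun m _ => ?_
        rw [← sq_abs]
        refine (pow_le_pow_left₀ (abs_nonneg _) (abs_nonlin_sub_le hT hΨ hF hM hP U V m hx) 2).trans
          ?_
        rw [mul_pow (M * P ^ 2 * T : ℝ)]
        exact mul_le_mul_of_nonneg_left h1 (sq_nonneg _)
    _ = _ := by
        rw [Finset.sum_const, Finset.card_univ, Fintype.card_fin, nsmul_eq_mul]
        ring

end Nonlinearity

/-! ### Consequences for the Carleman weight -/

section CarlemanWeight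

variable {d N : ℕ} {Ω : Set (Pt d)} {x₀ : Pt d} {b β : ℝ}

theorem continuous_carlemanWeight (x₀ : Pt d) (b : ℝ) (hβ : 0 ≤ β) (lam : ℝ) :
    Continuous (carlemanWeight x₀ b β lam) := by
  unfold carlemanWeight
  have : Continuous fun x : Pt d => dist x x₀ ^ β :=
    (continuous_id.dist continuous_const).rpow_const fun _ => Or.inr hβ
  fun_prop

theorem carlemanWeight_pos (x₀ : Pt d) (b β lam : ℝ) (x : Pt d) :
    0 < carlemanWeight x₀ b β lam x := Real.exp_pos _

theorem one_le_carlemanWeight (x₀ : Pt d) (hb : 0 ≤ b) {lam : ℝ} (hlam : 0 ≤ lam) (x : Pt d) :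
    1 ≤ carlemanWeight x₀ b β lam x :=
  Real.one_le_exp (by positivity)

theorem carlemanWeight_mono (x₀ : Pt d) (hb : 0 ≤ b) {lam lam' : ℝ} (h : lam ≤ lam')
    (x : Pt d) : carlemanWeight x₀ b β lam x ≤ carlemanWeight x₀ b β lam' x := by
  unfold carlemanWeight
  gcongr

/-- On the set where `|x - x₀| < b`, all weights with bounded parameter are comparable. -/
theorem carlemanWeight_le_exp_mul (hb : 0 < b) (hβ : 0 ≤ β) {lam lam' : ℝ} (h0 : 0 ≤ lam)
    (h : lam ≤ lam') {x : Pt d} (hx : dist x x₀ < b) :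
    carlemanWeight x₀ b β lam' x ≤ Real.exp (2 * lam') * carlemanWeight x₀ b β lam x := by
  unfold carlemanWeight
  rw [← Real.exp_add]
  refine Real.exp_le_exp.2 ?_
  have h1 : b ^ (-β) * dist x x₀ ^ β ≤ 1 := by
    rw [Real.rpow_neg hb.le, inv_mul_le_one₀ (by positivity)]
    exact Real.rpow_le_rpow dist_nonneg hx.le hβ
  have h2 : 0 ≤ b ^ (-β) * dist x x₀ ^ β := by positivity
  nlinarith

/-- The Carleman estimate holds for every `β ≥ 2`, since `r^β` is then uniformly convex. -/
theorem exists_carlemanEstimate (hΩ : IsSmoothBoundedDomain Ω) (hr : ∀ x ∈ Ω, 1 < dist x x₀)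
    (hb0 : 0 < b) (hb : ∀ x ∈ closure Ω, dist x x₀ < b) (hβ : 2 ≤ β) :
    ∃ lam₀ : ℝ, 1 < lam₀ ∧ CarlemanEstimate Ω x₀ b β lam₀ := by
  obtain ⟨m, B, hw⟩ := exists_isConvexWeight_radialWeight x₀ hb0 hβ b
  have hm0 := hw.pos
  have hB1 := hw.one_le
  have hΩm := hΩ.isOpen.measurableSet
  have hr1 : ∀ x ∈ closure Ω, 1 / 2 < ‖x - x₀‖ ^ 2 := by
    intro x hx
    have h1 : closure Ω ⊆ {x | 1 ≤ dist x x₀} :=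
      closure_minimal (fun y hy => (hr y hy).le)
        (isClosed_le continuous_const (continuous_id.dist continuous_const))
    have h2 : 1 ≤ dist x x₀ := h1 hx
    rw [dist_eq_norm] at h2
    nlinarith
  set Q := 20 + (46 * B / m + 27 * B ^ 2 / m ^ 2) with hQ
  have hQ0 : 0 < Q := by positivity
  -- for `λ ≥ 1` the second entry gives `B ≤ 4 m³ λ²`
  refine ⟨max 2 (B / (4 * m ^ 3)), lt_of_lt_of_le one_lt_two (le_max_left _ _), Q⁻¹,
    by positivity, ?_⟩
  intro lam hlam v h h'
  have hl2 : 2 ≤ lam := (le_max_left _ _).trans hlam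
  have hlB : B ≤ 4 * m ^ 3 * lam ^ 2 := by
    have := (div_le_iff₀ (by positivity)).1 ((le_max_right _ _).trans hlam)
    have h4 : lam ≤ lam ^ 2 := by nlinarith
    nlinarith [mul_le_mul_of_nonneg_left h4 (show 0 ≤ 4 * m ^ 3 by positivity)]
  have key := hw.carleman_sobolev ((isOpen_radial_region x₀).inter Metric.isOpen_ball) hΩ
    (fun x hx => ⟨hr1 x hx, hb x hx⟩) (by linarith) hlB h h'
  have ew : ∀ x ∈ Ω, Real.exp (2 * lam * radialWeight x₀ b β x) = carlemanWeight x₀ b β lam x := by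
    intro x hx
    rw [radialWeight_eq b β (hr1 x (subset_closure hx)), carlemanWeight, mul_assoc (2 * lam)]
  have ew' : ∀ g : Pt d → ℝ, ∫ x in Ω, Real.exp (2 * lam * radialWeight x₀ b β x) * g x =
      ∫ x in Ω, carlemanWeight x₀ b β lam x * g x := fun g =>
    setIntegral_congr_fun hΩm fun x hx => by simp only [ew x hx]
  rw [ew', ew'] at key
  have wc := continuous_carlemanWeight x₀ b (show 0 ≤ β by linarith) lam
  have iH := integrableOn_continuous_mul hΩ.isBounded hΩm wc v.integrableOn_hessSq
  have iV := integrableOn_continuous_mul hΩ.isBounded hΩm wc v.integrableOn_val_sq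
  have iG := integrableOn_continuous_mul hΩ.isBounded hΩm wc v.integrableOn_gradSq
  have e : ∫ x in Ω, carlemanWeight x₀ b β lam x * (lam⁻¹ * v.hessSq x + lam ^ 3 * v.val x ^ 2 +
      lam * v.gradSq x) =
      lam⁻¹ * (∫ x in Ω, carlemanWeight x₀ b β lam x * v.hessSq x)
      + lam ^ 3 * (∫ x in Ω, carlemanWeight x₀ b β lam x * (v.val x) ^ 2)
      + lam * (∫ x in Ω, carlemanWeight x₀ b β lam x * v.gradSq x) := by
    rw [← integral_const_mul, ← integral_const_mul, ← integral_const_mul,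
      ← integral_add (iH.const_mul _) (iV.const_mul _), ← integral_add _ (iG.const_mul _)]
    · congr 1
      funext x
      ring
    · exact (iH.const_mul _).add (iV.const_mul _)
  rw [e] at key
  calc _ = Q⁻¹ * (lam⁻¹ * (∫ x in Ω, carlemanWeight x₀ b β lam x * v.hessSq x)
      + lam ^ 3 * (∫ x in Ω, carlemanWeight x₀ b β lam x * (v.val x) ^ 2)
      + lam * (∫ x in Ω, carlemanWeight x₀ b β lam x * v.gradSq x)) := by ring
    _ ≤ Q⁻¹ * (Q * ∫ x in Ω, carlemanWeight x₀ b β lam x * v.lap x ^ 2) := by gcongr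
    _ = _ := inv_mul_cancel_left₀ hQ0.ne' _

theorem errorDensity_nonneg (lam : ℝ) (V : Fin N → H2 Ω) (x : Pt d) : 0 ≤ errorDensity lam V x :=
  Finset.sum_nonneg fun n _ => by
    have h1 := (V n).hessSq_nonneg x
    have h2 := (V n).gradSq_nonneg x
    positivity

theorem integrableOn_errorDensity (lam : ℝ) (V : Fin N → H2 Ω) :
    IntegrableOn (errorDensity lam V) Ω :=
  integrable_finsetSum _ fun n _ => ((((V n).integrableOn_hessSq.const_mul _).add
    (V n).integrableOn_gradSq).add (V n).integrableOn_val_sq)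

theorem memLp_linear_residual (hΩb : Bornology.IsBounded Ω) (hΩm : MeasurableSet Ω)
    {c : Pt d → ℝ} (hc : Continuous c) (s : Fin N → Fin N → ℝ) (D : Fin N → H2 Ω) (m : Fin N) :
    MemLp (fun x => (D m).lap x - c x * ∑ n, s m n * (D n).val x) 2 (volume.restrict Ω) := by
  refine (D m).memLp_lap.sub ?_
  have h1 : MemLp (fun x => ∑ n, s m n * (D n).val x) 2 (volume.restrict Ω) :=
    memLp_finsetSum (p := 2) Finset.univ (f := fun n x => s m n * (D n).val x)
      fun n _ => (D n).memLp_val.const_mul _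
  obtain ⟨C, hC⟩ := hΩb.isCompact_closure.exists_bound_of_continuousOn hc.continuousOn
  refine MemLp.of_le_mul (c := C) h1 (hc.aestronglyMeasurable.mul h1.aestronglyMeasurable) ?_
  filter_upwards [ae_restrict_mem hΩm] with x hx
  rw [norm_mul]
  exact mul_le_mul_of_nonneg_right (hC x (subset_closure hx)) (norm_nonneg _)

/-- The energy estimate for the linear operator `Δ - c S`, when `λ` is so large that the zero order
term is absorbed by the Carleman estimate. -/
theorem energy_estimate_large (hΩ : IsSmoothBoundedDomain Ω) (hβ : 0 ≤ β) {lam₀ K : ℝ}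
    (hlam₀ : 1 < lam₀) (hK : 0 < K)
    (hC : ∀ lam : ℝ, lam₀ ≤ lam → ∀ v : H2 Ω, HasBoundaryValue v 0 → HasNormalDerivative v 0 →
      K * lam⁻¹ * (∫ x in Ω, carlemanWeight x₀ b β lam x * v.hessSq x)
      + K * lam ^ 3 * (∫ x in Ω, carlemanWeight x₀ b β lam x * (v.val x) ^ 2)
      + K * lam * (∫ x in Ω, carlemanWeight x₀ b β lam x * v.gradSq x)
      ≤ ∫ x in Ω, carlemanWeight x₀ b β lam x * (v.lap x) ^ 2)
    {c : Pt d → ℝ} (hc : Continuous c) {c₁ : ℝ} (hc₁ : ∀ x ∈ Ω, |c x| ≤ c₁)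
    (s : Fin N → Fin N → ℝ) {lam : ℝ} (hlam : lam₀ ≤ lam)
    (hlam' : 4 * c₁ ^ 2 * ∑ m, ∑ n, s m n ^ 2 ≤ K * lam) {D : Fin N → H2 Ω}
    (h : ∀ n, HasBoundaryValue (D n) 0) (h' : ∀ n, HasNormalDerivative (D n) 0) :
    ∫ x in Ω, carlemanWeight x₀ b β lam x * errorDensity lam D x ≤
      4 / K / lam * ∫ x in Ω, carlemanWeight x₀ b β lam x *
        ∑ m, ((D m).lap x - c x * ∑ n, s m n * (D n).val x) ^ 2 := by
  have hΩm := hΩ.isOpen.measurableSet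
  have wc := continuous_carlemanWeight x₀ b hβ lam
  have w0 := carlemanWeight_pos x₀ b β lam
  set w := carlemanWeight x₀ b β lam with hw
  have hl1 : 1 ≤ lam := hlam₀.le.trans hlam
  have iH := fun n => integrableOn_continuous_mul hΩ.isBounded hΩm wc (D n).integrableOn_hessSq
  have iV := fun n => integrableOn_continuous_mul hΩ.isBounded hΩm wc (D n).integrableOn_val_sq
  have iG := fun n => integrableOn_continuous_mul hΩ.isBounded hΩm wc (D n).integrableOn_gradSq
  have iL := fun m => integrableOn_continuous_mul hΩ.isBounded hΩm wc
    ((D m).memLp_lap.integrable_sq)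
  have iR := fun m => integrableOn_continuous_mul hΩ.isBounded hΩm wc
    ((memLp_linear_residual hΩ.isBounded hΩm hc s D m).integrable_sq)
  set H := ∑ n, ∫ x in Ω, w x * (D n).hessSq x with hH
  set Z := ∑ n, ∫ x in Ω, w x * (D n).val x ^ 2 with hZ
  set G := ∑ n, ∫ x in Ω, w x * (D n).gradSq x with hG
  set I := ∫ x in Ω, w x * ∑ m, ((D m).lap x - c x * ∑ n, s m n * (D n).val x) ^ 2 with hI
  set A := ∑ m, ∑ n, s m n ^ 2 with hA
  have hZ0 : 0 ≤ Z := Finset.sum_nonneg fun n _ => integral_nonneg fun x =>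
    mul_nonneg (w0 x).le (sq_nonneg _)
  have hI' : I = ∑ m, ∫ x in Ω, w x * ((D m).lap x - c x * ∑ n, s m n * (D n).val x) ^ 2 := by
    rw [hI, ← integral_finsetSum _ fun m _ => iR m]
    simp only [Finset.mul_sum]
  have hE : ∫ x in Ω, w x * errorDensity lam D x = (lam ^ 2)⁻¹ * H + G + Z := by
    have e : ∀ x, w x * errorDensity lam D x = ∑ n, ((lam ^ 2)⁻¹ * (w x * (D n).hessSq x) +
        w x * (D n).gradSq x + w x * (D n).val x ^ 2) := by
      intro x
      rw [errorDensity, Finset.mul_sum]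
      refine Finset.sum_congr rfl fun n _ => ?_
      ring
    have i1 : ∀ n, IntegrableOn (fun x => (lam ^ 2)⁻¹ * (w x * (D n).hessSq x) +
        w x * (D n).gradSq x) Ω := fun n => ((iH n).const_mul _).add (iG n)
    have i2 : ∀ n, IntegrableOn (fun x => (lam ^ 2)⁻¹ * (w x * (D n).hessSq x) +
        w x * (D n).gradSq x + w x * (D n).val x ^ 2) Ω := fun n => (i1 n).add (iV n)
    simp only [e]
    rw [integral_finsetSum _ fun n _ => i2 n, hH, hG, hZ,
      Finset.mul_sum, ← Finset.sum_add_distrib, ← Finset.sum_add_distrib]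
    refine Finset.sum_congr rfl fun n _ => ?_
    rw [← integral_const_mul, ← integral_add ((iH n).const_mul _) (iG n),
      ← integral_add (i1 n) (iV n)]
  have comp : ∀ m, ∫ x in Ω, w x * (D m).lap x ^ 2 ≤
      2 * (∫ x in Ω, w x * ((D m).lap x - c x * ∑ n, s m n * (D n).val x) ^ 2) +
        2 * c₁ ^ 2 * (∑ n, s m n ^ 2) * Z := by
    intro m
    have eZ : Z = ∫ x in Ω, ∑ n, w x * (D n).val x ^ 2 := by
      rw [hZ, integral_finsetSum _ fun n _ => iV n]
    have iS : IntegrableOn (fun x => ∑ n, w x * (D n).val x ^ 2) Ω :=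
      integrable_finsetSum _ fun n _ => iV n
    rw [eZ, ← integral_const_mul, ← integral_const_mul,
      ← integral_add ((iR m).const_mul _) (iS.const_mul _)]
    refine setIntegral_mono_on (iL m) (((iR m).const_mul _).add (iS.const_mul _)) hΩm
      fun x hx => ?_
    have cs := Finset.sum_mul_sq_le_sq_mul_sq Finset.univ (s m) fun n => (D n).val x
    have hcx : c x ^ 2 ≤ c₁ ^ 2 := sq_le_sq' (by linarith [neg_abs_le (c x), hc₁ x hx])
      ((le_abs_self _).trans (hc₁ x hx))
    rw [← Finset.mul_sum]
    set y := ∑ n, s m n * (D n).val x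
    set z := ∑ n, (D n).val x ^ 2
    have h1 : (c x * y) ^ 2 ≤ c₁ ^ 2 * ((∑ n, s m n ^ 2) * z) := by
      rw [mul_pow]
      exact mul_le_mul hcx cs (sq_nonneg _) (sq_nonneg _)
    have h2 : (D m).lap x ^ 2 ≤ 2 * ((D m).lap x - c x * y) ^ 2 + 2 * (c x * y) ^ 2 := by
      nlinarith [sq_nonneg ((D m).lap x - c x * y - c x * y)]
    calc w x * (D m).lap x ^ 2 ≤ w x * (2 * ((D m).lap x - c x * y) ^ 2 +
          2 * (c₁ ^ 2 * ((∑ n, s m n ^ 2) * z))) :=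
          mul_le_mul_of_nonneg_left (by linarith) (w0 x).le
      _ = _ := by ring
  have hsum : K * lam⁻¹ * H + K * lam ^ 3 * Z + K * lam * G ≤ 2 * I + 2 * c₁ ^ 2 * A * Z := by
    calc _ = ∑ m, (K * lam⁻¹ * (∫ x in Ω, w x * (D m).hessSq x)
      + K * lam ^ 3 * (∫ x in Ω, w x * ((D m).val x) ^ 2)
      + K * lam * (∫ x in Ω, w x * (D m).gradSq x)) := by
          rw [hH, hZ, hG, Finset.mul_sum, Finset.mul_sum, Finset.mul_sum, Finset.sum_add_distrib,
            Finset.sum_add_distrib]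
      _ ≤ ∑ m, (2 * (∫ x in Ω, w x * ((D m).lap x - c x * ∑ n, s m n * (D n).val x) ^ 2) +
        2 * c₁ ^ 2 * (∑ n, s m n ^ 2) * Z) :=
          Finset.sum_le_sum fun m _ => (hC lam hlam (D m) (h m) (h' m)).trans (comp m)
      _ = _ := by
          rw [hI', hA, Finset.sum_add_distrib, ← Finset.mul_sum, ← Finset.sum_mul, ← Finset.mul_sum]
  have hl3 : lam ≤ lam ^ 3 := by nlinarith [mul_nonneg (sub_nonneg.2 hl1) (sub_nonneg.2 hl1)]
  have hl0 : 0 < lam := by linarith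
  have habs : 4 * c₁ ^ 2 * A * Z ≤ K * lam ^ 3 * Z :=
    mul_le_mul_of_nonneg_right (hlam'.trans (mul_le_mul_of_nonneg_left hl3 hK.le)) hZ0
  rw [hE, div_div, div_mul_eq_mul_div, le_div_iff₀ (by positivity)]
  have e1 : ((lam ^ 2)⁻¹ * H + G + Z) * (K * lam) = K * lam⁻¹ * H + K * lam * G + K * lam * Z := by
    field_simp
  have e2 : K * lam * Z ≤ K * lam ^ 3 * Z := by gcongr
  rw [e1]
  have hG0 : 0 ≤ K * lam * G := mul_nonneg (by positivity) (Finset.sum_nonneg fun n _ =>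
    integral_nonneg fun x => mul_nonneg (w0 x).le ((D n).gradSq_nonneg x))
  have hH0 : 0 ≤ K * lam⁻¹ * H := mul_nonneg (by positivity) (Finset.sum_nonneg fun n _ =>
    integral_nonneg fun x => mul_nonneg (w0 x).le ((D n).hessSq_nonneg x))
  linarith

/-- The energy estimate for the linear operator `Δ - c S`, uniformly in `λ ≥ λ₀`. The threshold
`λ₀` does not depend on `c` and `S`: for the bounded range of `λ` in which the Carleman estimate does
not absorb the zero order term, the weight is compared with the one at the end of that range. -/
theorem energy_estimate (hΩ : IsSmoothBoundedDomain Ω) (hb0 : 0 < b)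
    (hb : ∀ x ∈ closure Ω, dist x x₀ < b) (hβ : 0 ≤ β) {lam₀ : ℝ}
    (hlam₀ : 1 < lam₀) (hC : CarlemanEstimate Ω x₀ b β lam₀)
    {c : Pt d → ℝ} (hc : Continuous c) (s : Fin N → Fin N → ℝ) :
    ∃ C : ℝ, 0 < C ∧ ∀ lam, lam₀ ≤ lam → ∀ D : Fin N → H2 Ω,
      (∀ n, HasBoundaryValue (D n) 0) → (∀ n, HasNormalDerivative (D n) 0) →
      ∫ x in Ω, carlemanWeight x₀ b β lam x * errorDensity lam D x ≤
      C / lam * ∫ x in Ω, carlemanWeight x₀ b β lam x *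
        ∑ m, ((D m).lap x - c x * ∑ n, s m n * (D n).val x) ^ 2 := by
  have hΩm := hΩ.isOpen.measurableSet
  obtain ⟨K, hK, hC⟩ := hC
  obtain ⟨c₁, hc₁⟩ := hΩ.isBounded.isCompact_closure.exists_bound_of_continuousOn hc.continuousOn
  set A := ∑ m, ∑ n, s m n ^ 2 with hA
  -- from `L` on, the zero order term is absorbed
  set L := max lam₀ (4 * c₁ ^ 2 * A / K) with hL
  have hL1 : 1 < L := hlam₀.trans_le (le_max_left _ _)
  have large : ∀ lam, L ≤ lam → ∀ D : Fin N → H2 Ω,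
      (∀ n, HasBoundaryValue (D n) 0) → (∀ n, HasNormalDerivative (D n) 0) →
      ∫ x in Ω, carlemanWeight x₀ b β lam x * errorDensity lam D x ≤
      4 / K / lam * ∫ x in Ω, carlemanWeight x₀ b β lam x *
        ∑ m, ((D m).lap x - c x * ∑ n, s m n * (D n).val x) ^ 2 := by
    intro lam hlam D h h'
    refine energy_estimate_large hΩ hβ hlam₀ hK hC hc (fun x hx => hc₁ x (subset_closure hx)) s
      ((le_max_left _ _).trans hlam) ?_ h h'
    rw [mul_comm K, ← div_le_iff₀ hK]
    exact (le_max_right _ _).trans hlam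
  have hexp : 1 ≤ Real.exp (2 * L) := Real.one_le_exp (by linarith)
  refine ⟨L ^ 2 * (4 / K) * Real.exp (2 * L), by positivity, fun lam hlam D h h' => ?_⟩
  have hl1 : 1 ≤ lam := hlam₀.le.trans hlam
  have iI : ∀ lam, IntegrableOn (fun x => carlemanWeight x₀ b β lam x *
        ∑ m, ((D m).lap x - c x * ∑ n, s m n * (D n).val x) ^ 2) Ω := fun lam =>
    integrableOn_continuous_mul hΩ.isBounded hΩm (continuous_carlemanWeight x₀ b hβ lam)
      (integrable_finsetSum _ fun m _ =>
        (memLp_linear_residual hΩ.isBounded hΩm hc s D m).integrable_sq)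
  have iE : ∀ lam lam', IntegrableOn (fun x => carlemanWeight x₀ b β lam x *
        errorDensity lam' D x) Ω := fun lam lam' =>
    integrableOn_continuous_mul hΩ.isBounded hΩm (continuous_carlemanWeight x₀ b hβ lam)
      (integrableOn_errorDensity lam' D)
  have pos : ∀ lam, 0 ≤ ∫ x in Ω, carlemanWeight x₀ b β lam x *
        ∑ m, ((D m).lap x - c x * ∑ n, s m n * (D n).val x) ^ 2 := fun lam =>
    integral_nonneg fun x => mul_nonneg (carlemanWeight_pos _ _ _ _ _).le
      (Finset.sum_nonneg fun m _ => sq_nonneg _)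
  rcases le_or_gt L lam with hLl | hLl
  · refine (large lam hLl D h h').trans (mul_le_mul_of_nonneg_right ?_ (pos lam))
    gcongr
    have : 1 ≤ L ^ 2 * Real.exp (2 * L) := one_le_mul_of_one_le_of_one_le (by nlinarith) hexp
    calc 4 / K = 4 / K * 1 := (mul_one _).symm
      _ ≤ 4 / K * (L ^ 2 * Real.exp (2 * L)) := by gcongr
      _ = _ := by ring
  · have step1 : ∫ x in Ω, carlemanWeight x₀ b β lam x * errorDensity lam D x ≤
        L ^ 2 * ∫ x in Ω, carlemanWeight x₀ b β L x * errorDensity L D x := by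
      rw [← integral_const_mul]
      refine integral_mono (iE _ _) ((iE _ _).const_mul _) fun x => ?_
      have hd : errorDensity lam D x ≤ L ^ 2 * errorDensity L D x := by
        rw [errorDensity, errorDensity, Finset.mul_sum]
        refine Finset.sum_le_sum fun n _ => ?_
        have h1 := (D n).hessSq_nonneg x
        have h2 := (D n).gradSq_nonneg x
        have h3 : (lam ^ 2)⁻¹ * (D n).hessSq x ≤ 1 * (D n).hessSq x := by
          gcongr
          exact inv_le_one_of_one_le₀ (one_le_pow₀ hl1)
        have h4 : L ^ 2 * ((L ^ 2)⁻¹ * (D n).hessSq x) = (D n).hessSq x :=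
          mul_inv_cancel_left₀ (by positivity) _
        have hL2 : 1 ≤ L ^ 2 := one_le_pow₀ hL1.le
        rw [mul_add, mul_add, h4]
        nlinarith [sq_nonneg ((D n).val x)]
      calc carlemanWeight x₀ b β lam x * errorDensity lam D x
          ≤ carlemanWeight x₀ b β L x * (L ^ 2 * errorDensity L D x) :=
            mul_le_mul (carlemanWeight_mono x₀ hb0.le hLl.le x) hd (errorDensity_nonneg _ _ _)
              (carlemanWeight_pos _ _ _ _ _).le
        _ = _ := by ring
    have step2 : ∫ x in Ω, carlemanWeight x₀ b β L x *
        ∑ m, ((D m).lap x - c x * ∑ n, s m n * (D n).val x) ^ 2 ≤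
        Real.exp (2 * L) * ∫ x in Ω, carlemanWeight x₀ b β lam x *
        ∑ m, ((D m).lap x - c x * ∑ n, s m n * (D n).val x) ^ 2 := by
      rw [← integral_const_mul]
      refine setIntegral_mono_on (iI _) ((iI _).const_mul _) hΩm fun x hx => ?_
      rw [← mul_assoc]
      exact mul_le_mul_of_nonneg_right (carlemanWeight_le_exp_mul hb0 hβ (by linarith) hLl.le
        (hb x (subset_closure hx))) (Finset.sum_nonneg fun m _ => sq_nonneg _)
    have hL0 : 0 < L := by linarith
    calc _ ≤ L ^ 2 * (4 / K / L * (Real.exp (2 * L) * ∫ x in Ω, carlemanWeight x₀ b β lam x *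
          ∑ m, ((D m).lap x - c x * ∑ n, s m n * (D n).val x) ^ 2)) := by
          refine step1.trans (mul_le_mul_of_nonneg_left ?_ (by positivity))
          exact (large L le_rfl D h h').trans (mul_le_mul_of_nonneg_left step2 (by positivity))
      _ = L ^ 2 * (4 / K) * Real.exp (2 * L) / L * ∫ x in Ω, carlemanWeight x₀ b β lam x *
          ∑ m, ((D m).lap x - c x * ∑ n, s m n * (D n).val x) ^ 2 := by ring
      _ ≤ _ := by
          refine mul_le_mul_of_nonneg_right ?_ (pos lam)
          exact div_le_div_of_nonneg_left (by positivity) (by linarith) hLl.le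

end CarlemanWeight

/-! ### The contraction property of the iteration -/

section Contraction

variable {d N : ℕ} {Ω : Set (Pt d)} {x₀ : Pt d} {b β T : ℝ} {Ψ : ℕ → ℝ → ℝ} {c : Pt d → ℝ}
  {F : Pt d → ℝ → ℝ → Pt d → ℝ}

theorem sysResidual_sub (W V V' : Fin N → H2 Ω) (m : Fin N) (x : Pt d) :
    sysResidual T Ψ c F W V m x - sysResidual T Ψ c F W V' m x =
      ((V - V') m).lap x - c x * ∑ n : Fin N, sEntry T Ψ m n * ((V - V') n).val x := by
  have h1 : ((V - V') m).lap x = (V m).lap x - (V' m).lap x := by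
    simp only [H2.lap, ← Finset.sum_sub_distrib]
    rfl
  have h2 : ∑ n : Fin N, sEntry T Ψ m n * ((V - V') n).val x =
      ∑ n : Fin N, sEntry T Ψ m n * (V n).val x - ∑ n : Fin N, sEntry T Ψ m n * (V' n).val x := by
    rw [← Finset.sum_sub_distrib]
    refine Finset.sum_congr rfl fun n _ => ?_
    rw [← mul_sub]
    rfl
  rw [h1, h2, sysResidual, sysResidual]
  ring

/-- Since the minimiser `U` does at least as well as the solution `Ustar`, the linear operator
applied to the error `U - Ustar` is controlled by the error of the previous iterate `W`, through the
Lipschitz property of the nonlinearity. -/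
theorem integral_linear_residual_le (hΩ : IsSmoothBoundedDomain Ω) (hβ : 0 ≤ β) (hT : 0 < T)
    (hΨ : IsC1OrthonormalBasis T Ψ) (hc : Continuous c)
    (hF : ContDiff ℝ 1 (fun z : Pt d × ℝ × ℝ × Pt d => F z.1 z.2.1 z.2.2.1 z.2.2.2))
    {M : ℝ≥0} (hM : c1Norm Ω T F ≤ M) {P : ℝ} (hP : ∀ n : Fin N, ∀ t ∈ Icc 0 T, |Ψ n t| ≤ P)
    {G Q : Fin N → Pt d → ℝ} {Ustar W U : Fin N → H2 Ω}
    (hstar : IsSystemSolution T Ψ c F G Q Ustar) (lam : ℝ)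
    (hU : IsMinOn (carlemanFunctional x₀ b β lam T Ψ c F W) (admissible Ω G Q) U) :
    ∫ x in Ω, carlemanWeight x₀ b β lam x * ∑ m, (((U - Ustar) m).lap x -
        c x * ∑ n : Fin N, sEntry T Ψ m n * ((U - Ustar) n).val x) ^ 2 ≤
      4 * (2 * N ^ 2 * (M * P ^ 2 * T) ^ 2) * ∫ x in Ω, carlemanWeight x₀ b β lam x *
        ∑ n, ((W n - Ustar n).gradSq x + (W n - Ustar n).val x ^ 2) := by
  have hΩm := hΩ.isOpen.measurableSet
  have wc := continuous_carlemanWeight x₀ b hβ lam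
  have w0 := carlemanWeight_pos x₀ b β lam
  set w := carlemanWeight x₀ b β lam with hw
  set CF : ℝ := 2 * N ^ 2 * (M * P ^ 2 * T) ^ 2 with hCF
  set r : Fin N → Pt d → ℝ := sysResidual T Ψ c F W U with hr
  set r' : Fin N → Pt d → ℝ := sysResidual T Ψ c F W Ustar with hr'
  set L : Fin N → Pt d → ℝ := fun m x => ((U - Ustar) m).lap x -
        c x * ∑ n : Fin N, sEntry T Ψ m n * ((U - Ustar) n).val x with hL
  have hrL : ∀ m x, r m x = L m x + r' m x := fun m x => by
    have := sysResidual_sub (T := T) (Ψ := Ψ) (c := c) (F := F) W U Ustar m x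
    simp only [hr, hr', hL]
    linarith
  have iE : IntegrableOn (fun x => ∑ n, ((W n - Ustar n).gradSq x + (W n - Ustar n).val x ^ 2)) Ω :=
    integrable_finsetSum _ fun n _ =>
      (W n - Ustar n).integrableOn_gradSq.add (W n - Ustar n).integrableOn_val_sq
  have hae : ∀ᵐ x ∂volume.restrict Ω, ∀ m,
      r' m x = nonlin T Ψ F W m x - nonlin T Ψ F Ustar m x := by
    filter_upwards [hstar.2] with x hx m
    have := hx m
    simp only [hr', sysResidual] at this ⊢
    linarith
  have hsq : ∀ᵐ x ∂volume.restrict Ω, ∑ m, r' m x ^ 2 ≤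
      CF * ∑ n, ((W n - Ustar n).gradSq x + (W n - Ustar n).val x ^ 2) := by
    filter_upwards [hae, ae_restrict_mem hΩm] with x hx hxΩ
    simp only [hx]
    exact sum_nonlin_sub_sq_le hT hΨ hF hM hP W Ustar hxΩ
  have mr' : ∀ m, MemLp (r' m) 2 (volume.restrict Ω) := by
    intro m
    have am : AEStronglyMeasurable (r' m) (volume.restrict Ω) := by
      refine ((aestronglyMeasurable_nonlin hT hΨ hF W m).sub
        (aestronglyMeasurable_nonlin hT hΨ hF Ustar m)).congr ?_
      filter_upwards [hae] with x hx using (hx m).symm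
    rw [memLp_two_iff_integrable_sq am]
    refine Integrable.mono' (iE.const_mul CF) (am.pow 2) ?_
    filter_upwards [hsq] with x hx
    rw [Real.norm_eq_abs, abs_of_nonneg (sq_nonneg _)]
    exact (Finset.single_le_sum (f := fun m => r' m x ^ 2) (fun m _ => sq_nonneg _)
      (Finset.mem_univ m)).trans hx
  have mL : ∀ m, MemLp (L m) 2 (volume.restrict Ω) := fun m =>
    memLp_linear_residual hΩ.isBounded hΩm hc (fun m n => sEntry T Ψ m n) (U - Ustar) m
  have mr : ∀ m, MemLp (r m) 2 (volume.restrict Ω) := fun m => by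
    rw [show r m = L m + r' m from funext (hrL m)]
    exact (mL m).add (mr' m)
  have intw : ∀ {f : Fin N → Pt d → ℝ}, (∀ m, MemLp (f m) 2 (volume.restrict Ω)) →
      IntegrableOn (fun x => w x * ∑ m, f m x ^ 2) Ω := fun hf =>
    integrableOn_continuous_mul hΩ.isBounded hΩm wc
      (integrable_finsetSum _ fun m _ => (hf m).integrable_sq)
  have hmin : ∫ x in Ω, w x * ∑ m, r m x ^ 2 ≤ ∫ x in Ω, w x * ∑ m, r' m x ^ 2 := hU hstar.1
  have h1 : ∫ x in Ω, w x * ∑ m, L m x ^ 2 ≤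
      2 * (∫ x in Ω, w x * ∑ m, r m x ^ 2) + 2 * ∫ x in Ω, w x * ∑ m, r' m x ^ 2 := by
    rw [← integral_const_mul, ← integral_const_mul,
      ← integral_add ((intw mr).const_mul _) ((intw mr').const_mul _)]
    refine integral_mono (intw mL) (((intw mr).const_mul _).add ((intw mr').const_mul _))
      fun x => ?_
    have : ∑ m, L m x ^ 2 ≤ 2 * ∑ m, r m x ^ 2 + 2 * ∑ m, r' m x ^ 2 := by
      rw [Finset.mul_sum, Finset.mul_sum, ← Finset.sum_add_distrib]
      refine Finset.sum_le_sum fun m _ => ?_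
      rw [hrL]
      nlinarith [sq_nonneg (L m x + 2 * r' m x)]
    calc w x * ∑ m, L m x ^ 2 ≤ w x * (2 * ∑ m, r m x ^ 2 + 2 * ∑ m, r' m x ^ 2) :=
          mul_le_mul_of_nonneg_left this (w0 x).le
      _ = _ := by ring
  have h2 : ∫ x in Ω, w x * ∑ m, r' m x ^ 2 ≤ CF * ∫ x in Ω, w x *
        ∑ n, ((W n - Ustar n).gradSq x + (W n - Ustar n).val x ^ 2) := by
    rw [← integral_const_mul]
    refine integral_mono_ae (intw mr')
      ((integrableOn_continuous_mul hΩ.isBounded hΩm wc iE).const_mul _) ?_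
    filter_upwards [hsq] with x hx
    calc w x * ∑ m, r' m x ^ 2 ≤ w x * (CF *
          ∑ n, ((W n - Ustar n).gradSq x + (W n - Ustar n).val x ^ 2)) :=
          mul_le_mul_of_nonneg_left hx (w0 x).le
      _ = _ := by ring
  linarith

/-- One step of the iteration decreases the weighted error by the factor `C / λ`. -/
theorem exists_contraction (hΩ : IsSmoothBoundedDomain Ω) (hb0 : 0 < b)
    (hb : ∀ x ∈ closure Ω, dist x x₀ < b) (hβ : 0 ≤ β) {lam₀ : ℝ} (hlam₀ : 1 < lam₀)
    (hC : CarlemanEstimate Ω x₀ b β lam₀) (hT : 0 < T) (hΨ : IsC1OrthonormalBasis T Ψ) (N : ℕ)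
    (hc : Continuous c) (M : ℝ≥0) :
    ∃ C : ℝ, 0 < C ∧ ∀ F : Pt d → ℝ → ℝ → Pt d → ℝ,
      ContDiff ℝ 1 (fun z : Pt d × ℝ × ℝ × Pt d => F z.1 z.2.1 z.2.2.1 z.2.2.2) →
      c1Norm Ω T F ≤ M → ∀ (G Q : Fin N → Pt d → ℝ) (Ustar : Fin N → H2 Ω),
      IsSystemSolution T Ψ c F G Q Ustar → ∀ lam : ℝ, lam₀ ≤ lam → ∀ W U : Fin N → H2 Ω,
      U ∈ admissible Ω G Q →
      IsMinOn (carlemanFunctional x₀ b β lam T Ψ c F W) (admissible Ω G Q) U →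
      ∫ x in Ω, carlemanWeight x₀ b β lam x * errorDensity lam (U - Ustar) x ≤
        C / lam * ∫ x in Ω, carlemanWeight x₀ b β lam x * errorDensity lam (W - Ustar) x := by
  have hΩm := hΩ.isOpen.measurableSet
  have hbd : ∀ n, ∃ P, ∀ t ∈ Icc 0 T, |Ψ n t| ≤ P := fun n =>
    isCompact_Icc.exists_bound_of_continuousOn (hΨ.contDiffOn n).continuousOn
  choose p hp using hbd
  have hp0 : ∀ n, 0 ≤ p n := fun n => (abs_nonneg _).trans (hp n 0 ⟨le_rfl, hT.le⟩)
  set P : ℝ := ∑ n : Fin N, p n with hPdef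
  have hP : ∀ n : Fin N, ∀ t ∈ Icc 0 T, |Ψ n t| ≤ P := fun n t ht =>
    (hp n t ht).trans (Finset.single_le_sum (f := fun n : Fin N => p n) (fun n _ => hp0 n)
      (Finset.mem_univ n))
  obtain ⟨C₁, hC₁, henergy⟩ := energy_estimate hΩ hb0 hb hβ hlam₀ hC hc
    (fun m n : Fin N => sEntry T Ψ m n)
  set CF : ℝ := 2 * N ^ 2 * (M * P ^ 2 * T) ^ 2 with hCF
  have hCF0 : 0 ≤ CF := by positivity
  -- the summand `1` makes the constant positive also when `CF = 0`
  refine ⟨C₁ * (4 * CF + 1), by positivity, ?_⟩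
  intro F hF hM G Q Ustar hstar lam hlam W U hUa hU
  have hl0 : 0 < lam := by linarith
  have w0 := carlemanWeight_pos x₀ b β lam
  have wc := continuous_carlemanWeight x₀ b hβ lam
  have bv : ∀ n, HasBoundaryValue ((U - Ustar) n) 0 := fun n => by
    have := (hUa n).1.sub hΩ (hstar.1 n).1
    rwa [sub_self] at this
  have nd : ∀ n, HasNormalDerivative ((U - Ustar) n) 0 := fun n => by
    have := (hUa n).2.sub hΩ (hstar.1 n).2
    rwa [sub_self] at this
  have e1 := henergy lam hlam (U - Ustar) bv nd
  have e2 := integral_linear_residual_le (x₀ := x₀) (b := b) hΩ hβ hT hΨ hc hF hM hP hstar lam hU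
  have e3 : ∫ x in Ω, carlemanWeight x₀ b β lam x *
        ∑ n, ((W n - Ustar n).gradSq x + (W n - Ustar n).val x ^ 2) ≤
      ∫ x in Ω, carlemanWeight x₀ b β lam x * errorDensity lam (W - Ustar) x := by
    refine integral_mono (integrableOn_continuous_mul hΩ.isBounded hΩm wc
      (integrable_finsetSum _ fun n _ => (W n - Ustar n).integrableOn_gradSq.add
        (W n - Ustar n).integrableOn_val_sq))
      (integrableOn_continuous_mul hΩ.isBounded hΩm wc (integrableOn_errorDensity _ _))
      fun x => mul_le_mul_of_nonneg_left (Finset.sum_le_sum fun n _ => ?_) (w0 x).le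
    have h1 := H2.hessSq_nonneg ((W - Ustar) n) x
    have h2 : 0 ≤ (lam ^ 2)⁻¹ * ((W - Ustar) n).hessSq x := by positivity
    simp only [Pi.sub_apply] at h2 ⊢
    linarith
  have e4 : 0 ≤ ∫ x in Ω, carlemanWeight x₀ b β lam x * errorDensity lam (W - Ustar) x :=
    integral_nonneg fun x => mul_nonneg (w0 x).le (errorDensity_nonneg _ _ _)
  calc _ ≤ C₁ / lam * (4 * CF * ∫ x in Ω, carlemanWeight x₀ b β lam x *
          errorDensity lam (W - Ustar) x) := by
        refine e1.trans (mul_le_mul_of_nonneg_left (e2.trans ?_) (by positivity))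
        exact mul_le_mul_of_nonneg_left e3 (by positivity)
    _ ≤ C₁ / lam * ((4 * CF + 1) * ∫ x in Ω, carlemanWeight x₀ b β lam x *
          errorDensity lam (W - Ustar) x) := by
        refine mul_le_mul_of_nonneg_left ?_ (by positivity)
        linarith
    _ = _ := by ring

end Contraction

/-! ### Convergence in unweighted norms -/

section Convergence

variable {d N : ℕ} {Ω : Set (Pt d)} {x₀ : Pt d} {b β : ℝ}

theorem sInf_carlemanWeight_mul_le (hΩ : IsSmoothBoundedDomain Ω) (hβ : 0 ≤ β) {lam : ℝ}
    (V : Fin N → H2 Ω) :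
    sInf (carlemanWeight x₀ b β lam '' closure Ω) * ∫ x in Ω, errorDensity lam V x ≤
      ∫ x in Ω, carlemanWeight x₀ b β lam x * errorDensity lam V x := by
  have hΩm := hΩ.isOpen.measurableSet
  rw [← integral_const_mul]
  refine setIntegral_mono_on ((integrableOn_errorDensity _ _).const_mul _)
    (integrableOn_continuous_mul hΩ.isBounded hΩm (continuous_carlemanWeight x₀ b hβ lam)
      (integrableOn_errorDensity _ _)) hΩm fun x hx => ?_
  refine mul_le_mul_of_nonneg_right (csInf_le ⟨0, ?_⟩ ⟨x, subset_closure hx, rfl⟩)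
    (errorDensity_nonneg _ _ _)
  rintro _ ⟨y, -, rfl⟩
  exact (carlemanWeight_pos _ _ _ _ _).le

theorem le_sSup_carlemanWeight_mul (hΩ : IsSmoothBoundedDomain Ω) (hβ : 0 ≤ β) {lam : ℝ}
    (V : Fin N → H2 Ω) :
    ∫ x in Ω, carlemanWeight x₀ b β lam x * errorDensity lam V x ≤
      sSup (carlemanWeight x₀ b β lam '' closure Ω) * ∫ x in Ω, errorDensity lam V x := by
  have hΩm := hΩ.isOpen.measurableSet
  have wc := continuous_carlemanWeight x₀ b hβ lam
  rw [← integral_const_mul]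
  refine setIntegral_mono_on (integrableOn_continuous_mul hΩ.isBounded hΩm wc
    (integrableOn_errorDensity _ _)) ((integrableOn_errorDensity _ _).const_mul _) hΩm
    fun x hx => ?_
  exact mul_le_mul_of_nonneg_right (le_csSup
    (hΩ.isBounded.isCompact_closure.image wc).bddAbove ⟨x, subset_closure hx, rfl⟩)
    (errorDensity_nonneg _ _ _)

theorem one_le_sInf_carlemanWeight (hΩ : IsSmoothBoundedDomain Ω) (hb : 0 ≤ b) {lam : ℝ}
    (hlam : 0 ≤ lam) : 1 ≤ sInf (carlemanWeight x₀ b β lam '' closure Ω) := by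
  refine le_csInf (hΩ.nonempty.closure.image _) ?_
  rintro _ ⟨y, -, rfl⟩
  exact one_le_carlemanWeight x₀ hb hlam y

theorem integrableOn_vecNorm_density (V : Fin N → H2 Ω) :
    IntegrableOn (fun x => ∑ n, ((V n).hessSq x + (V n).gradSq x + ((V n).val x) ^ 2)) Ω :=
  integrable_finsetSum _ fun n _ => (((V n).integrableOn_hessSq.add
    (V n).integrableOn_gradSq).add (V n).integrableOn_val_sq)

/-- For fixed `λ` the error functional dominates the norm of `H²(Ω)^N`. -/
theorem vecNorm2_le {lam : ℝ} (hlam : 1 ≤ lam) (V : Fin N → H2 Ω) :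
    H2.vecNorm2 V ≤ Real.sqrt (lam ^ 2 * ∫ x in Ω, errorDensity lam V x) := by
  refine Real.sqrt_le_sqrt ?_
  rw [← integral_const_mul]
  refine integral_mono (integrableOn_vecNorm_density V)
    ((integrableOn_errorDensity _ _).const_mul _) fun x => ?_
  dsimp only
  rw [errorDensity, Finset.mul_sum]
  refine Finset.sum_le_sum fun n _ => ?_
  have h2 := (V n).gradSq_nonneg x
  have h4 : lam ^ 2 * ((lam ^ 2)⁻¹ * (V n).hessSq x) = (V n).hessSq x :=
    mul_inv_cancel_left₀ (by positivity) _
  have hL2 : 1 ≤ lam ^ 2 := one_le_pow₀ hlam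
  rw [mul_add, mul_add, h4]
  nlinarith [sq_nonneg ((V n).val x)]

theorem norm2_initialCondition_sub_le (Ψ : ℕ → ℝ → ℝ) (U V : Fin N → H2 Ω) :
    H2.norm2 (initialCondition Ψ U - initialCondition Ψ V) ≤
      Real.sqrt (∑ n : Fin N, Ψ n 0 ^ 2) * H2.vecNorm2 (U - V) := by
  have hval : ∀ (W : Fin N → H2 Ω), (initialCondition Ψ W : H2 Ω).1 =
      ∑ n : Fin N, Ψ n 0 • (W n).1 := fun W => by
    simp [initialCondition]
  have e0 : ∀ x, (initialCondition Ψ U - initialCondition Ψ V).val x =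
      ∑ n : Fin N, Ψ n 0 * ((U - V) n).val x := by
    intro x
    have : (initialCondition Ψ U - initialCondition Ψ V).val x =
      (initialCondition Ψ U).1.1 x - (initialCondition Ψ V).1.1 x := rfl
    rw [this, hval, hval]
    simp only [Prod.fst_sum, Prod.smul_fst, Finset.sum_apply, Pi.smul_apply, smul_eq_mul,
      ← Finset.sum_sub_distrib, ← mul_sub]
    rfl
  have e1 : ∀ i x, (initialCondition Ψ U - initialCondition Ψ V).grad i x =
      ∑ n : Fin N, Ψ n 0 * ((U - V) n).grad i x := by
    intro i x
    have : (initialCondition Ψ U - initialCondition Ψ V).grad i x =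
      (initialCondition Ψ U).1.2.1 i x - (initialCondition Ψ V).1.2.1 i x := rfl
    rw [this, hval, hval]
    simp only [Prod.fst_sum, Prod.snd_sum, Prod.smul_fst, Prod.smul_snd, Finset.sum_apply,
      Pi.smul_apply, smul_eq_mul, ← Finset.sum_sub_distrib, ← mul_sub]
    rfl
  have e2 : ∀ i j x, (initialCondition Ψ U - initialCondition Ψ V).hess i j x =
      ∑ n : Fin N, Ψ n 0 * ((U - V) n).hess i j x := by
    intro i j x
    have : (initialCondition Ψ U - initialCondition Ψ V).hess i j x =
      (initialCondition Ψ U).1.2.2 i j x - (initialCondition Ψ V).1.2.2 i j x := rfl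
    rw [this, hval, hval]
    simp only [Prod.snd_sum, Prod.smul_snd, Finset.sum_apply,
      Pi.smul_apply, smul_eq_mul, ← Finset.sum_sub_distrib, ← mul_sub]
    rfl
  have hA : 0 ≤ ∑ n : Fin N, Ψ n 0 ^ 2 := Finset.sum_nonneg fun _ _ => sq_nonneg _
  rw [H2.norm2, H2.vecNorm2, ← Real.sqrt_mul hA]
  refine Real.sqrt_le_sqrt ?_
  rw [← integral_const_mul]
  refine integral_mono ((((H2.integrableOn_hessSq _).add (H2.integrableOn_gradSq _)).add
    (H2.integrableOn_val_sq _))) ((integrableOn_vecNorm_density _).const_mul _) fun x => ?_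
  set A := ∑ n : Fin N, Ψ n 0 ^ 2
  have cs : ∀ f : Fin N → ℝ, (∑ n : Fin N, Ψ n 0 * f n) ^ 2 ≤ A * ∑ n, f n ^ 2 := fun f =>
    Finset.sum_mul_sq_le_sq_mul_sq _ _ _
  have b1 : (initialCondition Ψ U - initialCondition Ψ V).gradSq x ≤
      A * ∑ n, ((U - V) n).gradSq x := by
    calc _ ≤ ∑ i, A * ∑ n, ((U - V) n).grad i x ^ 2 :=
          Finset.sum_le_sum fun i _ => by
            rw [e1]
            exact cs _
      _ = _ := by
          rw [← Finset.mul_sum, Finset.sum_comm]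
          rfl
  have b2 : (initialCondition Ψ U - initialCondition Ψ V).hessSq x ≤
      A * ∑ n, ((U - V) n).hessSq x := by
    calc _ ≤ ∑ i, ∑ j, A * ∑ n, ((U - V) n).hess i j x ^ 2 :=
          Finset.sum_le_sum fun i _ => Finset.sum_le_sum fun j _ => by
            rw [e2]
            exact cs _
      _ = A * ∑ i, ∑ n, ∑ j, ((U - V) n).hess i j x ^ 2 := by
          rw [Finset.mul_sum]
          refine Finset.sum_congr rfl fun i _ => ?_
          rw [← Finset.mul_sum, Finset.sum_comm]
      _ = _ := by
          rw [Finset.sum_comm]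
          rfl
  have b0 := cs fun n => ((U - V) n).val x
  dsimp only
  rw [Finset.sum_add_distrib, Finset.sum_add_distrib, e0]
  linarith

end Convergence

/-! ### The convergence theorem -/

theorem mainTheorem3 (d : ℕ) (hd : 1 ≤ d) (Ω : Set (Pt d)) (hΩ : IsSmoothBoundedDomain Ω)
    (x₀ : Pt d) (hx₀ : x₀ ∉ closure Ω) (hr : ∀ x ∈ Ω, 1 < dist x x₀)
    (b : ℝ) (hb : ∀ x ∈ closure Ω, dist x x₀ < b) :
    ∃ β₀ : ℝ, 0 < β₀ ∧ ∀ β : ℝ, β₀ ≤ β →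
    ∃ lam₀ : ℝ, 1 < lam₀ ∧ CarlemanEstimate Ω x₀ b β lam₀ ∧
    ∀ (T : ℝ), 0 < T → ∀ (Ψ : ℕ → ℝ → ℝ), IsC1OrthonormalBasis T Ψ → ∀ (N : ℕ),
    ∀ (c : Pt d → ℝ), ContDiff ℝ 1 c → (∃ c₀ : ℝ, 0 < c₀ ∧ ∀ x, c₀ ≤ c x) →
    ∀ (M : ℝ≥0), ∃ C : ℝ, 0 < C ∧
    ∀ (F : Pt d → ℝ → ℝ → Pt d → ℝ),
      ContDiff ℝ 1 (fun z : Pt d × ℝ × ℝ × Pt d => F z.1 z.2.1 z.2.2.1 z.2.2.2) →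
      c1Norm Ω T F ≤ M →
    ∀ (G Q : Fin N → Pt d → ℝ) (Ustar : Fin N → H2 Ω),
      IsSystemSolution T Ψ c F G Q Ustar →
    ∀ (lam : ℝ), lam₀ ≤ lam →
    ∀ (U : ℕ → Fin N → H2 Ω), IsCarlemanIteration x₀ b β lam T Ψ c F G Q U →
      (∀ k : ℕ,
        ∫ x in Ω, carlemanWeight x₀ b β lam x * errorDensity lam (U k - Ustar) x ≤
          (C / lam) ^ k *
            ∫ x in Ω, carlemanWeight x₀ b β lam x * errorDensity lam (U 0 - Ustar) x) ∧
      (C / lam < 1 →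
        (∀ k : ℕ,
          sInf (carlemanWeight x₀ b β lam '' closure Ω) *
              ∫ x in Ω, errorDensity lam (U k - Ustar) x ≤
            (C / lam) ^ k * sSup (carlemanWeight x₀ b β lam '' closure Ω) *
              ∫ x in Ω, errorDensity lam (U 0 - Ustar) x) ∧
        Tendsto (fun k => H2.vecNorm2 (U k - Ustar)) atTop (𝓝 0) ∧
        Tendsto (fun k => H2.norm2 (initialCondition Ψ (U k) - initialCondition Ψ Ustar))
          atTop (𝓝 0)) := by
  have hb0 : 0 < b := by
    obtain ⟨y, hy⟩ := hΩ.nonempty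
    linarith [hr y hy, hb y (subset_closure hy)]
  refine ⟨2, two_pos, fun β hβ => ?_⟩
  have hβ0 : 0 ≤ β := by linarith
  obtain ⟨lam₀, hlam₀, hC⟩ := exists_carlemanEstimate hΩ hr hb0 hb hβ
  refine ⟨lam₀, hlam₀, hC, ?_⟩
  intro T hT Ψ hΨ N c hc _ M
  obtain ⟨C, hC0, hstep⟩ := exists_contraction hΩ hb0 hb hβ0 hlam₀ hC hT hΨ N hc.continuous M
  refine ⟨C, hC0, ?_⟩
  intro F hF hM G Q Ustar hstar lam hlam U hU
  have hl1 : 1 ≤ lam := hlam₀.le.trans hlam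
  have hθ0 : 0 ≤ C / lam := by positivity
  have main : ∀ k : ℕ,
      ∫ x in Ω, carlemanWeight x₀ b β lam x * errorDensity lam (U k - Ustar) x ≤
        (C / lam) ^ k *
          ∫ x in Ω, carlemanWeight x₀ b β lam x * errorDensity lam (U 0 - Ustar) x := by
    intro k
    induction k with
    | zero => simp
    | succ k ih =>
      refine (hstep F hF hM G Q Ustar hstar lam hlam (U k) (U (k + 1)) (hU k).1 (hU k).2).trans ?_
      rw [pow_succ', mul_assoc]
      exact mul_le_mul_of_nonneg_left ih hθ0
  refine ⟨main, fun hθ1 => ?_⟩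
  have unweighted : ∀ k : ℕ, sInf (carlemanWeight x₀ b β lam '' closure Ω) *
      ∫ x in Ω, errorDensity lam (U k - Ustar) x ≤
        (C / lam) ^ k * sSup (carlemanWeight x₀ b β lam '' closure Ω) *
          ∫ x in Ω, errorDensity lam (U 0 - Ustar) x := by
    intro k
    rw [mul_assoc]
    exact (sInf_carlemanWeight_mul_le hΩ hβ0 _).trans ((main k).trans
      (mul_le_mul_of_nonneg_left (le_sSup_carlemanWeight_mul hΩ hβ0 _) (pow_nonneg hθ0 k)))
  have conv : Tendsto (fun k => H2.vecNorm2 (U k - Ustar)) atTop (𝓝 0) := by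
    set E₀ := sSup (carlemanWeight x₀ b β lam '' closure Ω) *
      ∫ x in Ω, errorDensity lam (U 0 - Ustar) x with hE₀
    have lim : Tendsto (fun k : ℕ => Real.sqrt (lam ^ 2 * ((C / lam) ^ k * E₀))) atTop (𝓝 0) := by
      have := (((tendsto_pow_atTop_nhds_zero_of_lt_one hθ0 hθ1).mul_const E₀).const_mul
        (lam ^ 2)).sqrt
      simpa using this
    refine squeeze_zero (fun k => Real.sqrt_nonneg _) (fun k => ?_) lim
    refine (vecNorm2_le hl1 _).trans (Real.sqrt_le_sqrt ?_)
    refine mul_le_mul_of_nonneg_left ?_ (by positivity)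
    have h1 := unweighted k
    rw [mul_assoc] at h1
    refine le_trans ?_ h1
    exact le_mul_of_one_le_left (integral_nonneg fun x => errorDensity_nonneg _ _ _)
      (one_le_sInf_carlemanWeight hΩ hb0.le (by linarith))
  refine ⟨unweighted, conv, ?_⟩
  refine squeeze_zero (fun k => Real.sqrt_nonneg _)
    (fun k => norm2_initialCondition_sub_le Ψ (U k) Ustar) ?_
  simpa using conv.const_mul (Real.sqrt (∑ n : Fin N, Ψ n 0 ^ 2))
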